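/- \textbf{Theorem (Block decomposition).} Let $\mathfrak g$ be a finite dimensional simple complex Lie algebra with Killing form $k$, let $\mathfrak h\subset\mathfrak g$ be a Cartan subalgebra and $\mathfrak b\supset\mathfrak h$ a Borel subalgebra, and let $R$ be the set of roots of $\mathfrak g$ and $R^+$ the set of roots of $\mathfrak b$ with respect to $\mathfrak h$. Let $\widehat{\mathfrak g}=\mathfrak g\otimes_{\mathbb C}\mathbb C[t,t^{-1}]\oplus\mathbb CK\oplus\mathbb CD$ be the affine Kac--Moody algebra: $K$ is central, $[x\otimes t^n,y\otimes t^m]=[x,y]\otimes t^{n+m}+n\delta_{m,-n}k(x,y)K$ and $[D,x\otimes t^n]=nx\otimes t^n$. Put $\widehat{\mathfrak h}=\mathfrak h\oplus\mathbb CK\oplus\mathbb CD$ and $\widehat{\mathfrak b}=\mathfrak g\otimes t\mathbb C[t]\oplus\mathfrak b\oplus\mathbb CK\oplus\mathbb CD$. Extend linear forms on $\mathfrak h$ by zero to $\mathbb CK\oplus\mathbb CD$, let $\delta\in\widehat{\mathfrak h}^\star$ be zero on $\mathfrak h\oplus\mathbb CK$ with $\delta(D)=1$, and for $\lambda,\mu\in\widehat{\mathfrak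 h}^\star$ write $\mu\le\lambda$ if $\lambda-\mu$ is a finite (possibly empty) sum of elements of $R^+\cup\{\alpha+n\delta\mid\alpha\in R,\,n>0\}\cup\{n\delta\mid n>0\}$. Let $A$ be a local deformation algebra, i.e. a commutative, Noetherian, local algebra over the symmetric algebra $S(\mathfrak h)$; let $\mathbb K$ be its residue field and let $\tau\colon\widehat{\mathfrak h}\to\mathfrak h\to A$ be the canonical map, so that $\tau(K)=\tau(D)=0$. A $\widehat{\mathfrak g}_A$-module is an $A$-module $M$ with an $A$-linear action of $\widehat{\mathfrak g}$; for $\lambda\in\widehat{\mathfrak h}^\star$ put $M_\lambda=\{m\in M\mid Hm=(\lambda(H)+\tau(H))m\text{ for all }H\in\widehat{\mathfrak h}\}$. Let $\widehat{\mathcal O}_A$ be the full subcategory of those $\widehat{\mathfrak g}_A$-modules $M$ for which $M=\bigoplus_{\lambda\in\widehat{\mathfrak h}^\star}M_\lambda$ and every element lies in a $\widehat{\mathfrak b}$-stable $A$-submodule that is finitely generated over $A$. Let $\Delta_{\mathbb K}(\lambda)=U(\widehat{\mathfrak g})\otimes_{U(\widehat{\mathfrak b})}\mathbb K_\lambda$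 be the Verma module over $\mathbb K$, where $\mathbb K_\lambda=\mathbb K$ with $\widehat{\mathfrak h}$ acting by $\lambda+\tau$ and $[\widehat{\mathfrak b},\widehat{\mathfrak b}]$ acting by $0$, and let $L_A(\lambda)$ be its simple quotient, regarded as a $\widehat{\mathfrak g}_A$-module through $A\to\mathbb K$. A subset $\mathcal J\subset\widehat{\mathfrak h}^\star$ is open if $\mu\le\lambda\in\mathcal J$ implies $\mu\in\mathcal J$, and locally bounded if $\{\gamma\in\mathcal J\mid\gamma\ge\mu\}$ is finite for every $\mu\in\widehat{\mathfrak h}^\star$. For such $\mathcal J$ let $\widehat{\mathcal O}_A^{\mathcal J}\subset\widehat{\mathcal O}_A$ be the full subcategory of all $M$ such that $M_\lambda\ne0$ implies $\lambda\in\mathcal J$, and for $\lambda\in\mathcal J$ let $P_A^{\mathcal J}(\lambda)\to L_A(\lambda)$ denote the projective cover in $\widehat{\mathcal O}_A^{\mathcal J}$, i.e. a surjection $c$ from a projective object $P$ of $\widehat{\mathcal O}_A^{\mathcal J}$ such that every $f\colon M\to P$ in $\widehat{\mathcal O}_A^{\mathcal J}$ with $c\circ f$ surjective is surjective. Let $\sim_A$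 be the equivalence relation on $\widehat{\mathfrak h}^\star$ generated by $\lambda\sim_A\mu$ whenever there are an open, locally bounded subset $\mathcal J$ containing $\lambda$ and $\mu$ and a nonzero homomorphism $P_A^{\mathcal J}(\lambda)\to P_A^{\mathcal J}(\mu)$. For an equivalence class $\Lambda$ let $\widehat{\mathcal O}_{A,\Lambda}\subset\widehat{\mathcal O}_A$ be the full subcategory of all $M$ such that $\lambda\in\Lambda$ whenever $L_A(\lambda)$ is isomorphic to a subquotient of $M$. Then the functor $$\prod_{\Lambda\in\widehat{\mathfrak h}^\star/\sim_A}\widehat{\mathcal O}_{A,\Lambda}\longrightarrow\widehat{\mathcal O}_A,\qquad\{M_\Lambda\}_\Lambda\longmapsto\bigoplus_\Lambda M_\Lambda,$$ is an equivalence of categories. -/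

import Mathlib

open CategoryTheory TensorProduct DirectSum

universe u

noncomputable section

set_option linter.unusedSectionVars false

namespace AffineO

/-! ### The affine Kac-Moody algebra -/

variable {g : Type u} [LieRing g] [LieAlgebra ℂ g]

variable (g) in
/-- The vector space `g ⊗ ℂ[t, t⁻¹]`, as finitely supported functions `ℤ → g`: the function with the
only value `x`, at `n`, is `x ⊗ tⁿ`. -/
abbrev Loop : Type u := ℤ →₀ g

/-- `x ⊗ tⁿ`. -/
abbrev mon (n : ℤ) (x : g) : Loop g := Finsupp.single n x

/-- The bracket of the loop algebra, `[x ⊗ tⁿ, y ⊗ tᵐ] = [x, y] ⊗ tⁿ⁺ᵐ`. -/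
def loopBr : Loop g →ₗ[ℂ] Loop g →ₗ[ℂ] Loop g :=
  Finsupp.lsum ℂ fun n : ℤ => LinearMap.flip <| Finsupp.lsum ℂ fun m : ℤ =>
    ((LinearMap.mk₂ ℂ (fun x y : g => ⁅x, y⁆) add_lie smul_lie lie_add lie_smul).compr₂
      (Finsupp.lsingle (n + m))).flip

/-- The derivation `t ∂/∂t` of the loop algebra, `x ⊗ tⁿ ↦ n x ⊗ tⁿ`. -/
def loopDer : Loop g →ₗ[ℂ] Loop g :=
  Finsupp.lsum ℂ fun n : ℤ => (n : ℂ) • Finsupp.lsingle n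

/-- The form `(x ⊗ tⁿ, y ⊗ tᵐ) ↦ n δ_{m,-n} k(x, y)` on the loop algebra, `k` the Killing form. -/
def loopForm : LinearMap.BilinForm ℂ (Loop g) :=
  Finsupp.lsum ℂ fun n : ℤ => (n : ℂ) • (killingForm ℂ g).compl₂ (Finsupp.lapply (-n))

@[simp] lemma loopBr_mon (n m : ℤ) (x y : g) :
    loopBr (mon n x) (mon m y) = mon (n + m) ⁅x, y⁆ := by
  simp [loopBr]

@[simp] lemma loopDer_mon (n : ℤ) (x : g) : loopDer (mon n x) = mon n ((n : ℂ) • x) := by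
  simp [loopDer]

@[simp] lemma loopForm_mon (n m : ℤ) (x y : g) :
    loopForm (mon n x) (mon m y) = if m = -n then (n : ℂ) * killingForm ℂ g x y else 0 := by
  by_cases h : m = -n
  · subst h; simp [loopForm]
  · simp [loopForm, h, Finsupp.single_eq_of_ne (show -n ≠ m by omega)]

lemma loopBr_swap (a b : Loop g) : loopBr a b = -loopBr b a := by
  induction a using Finsupp.induction_linear with
  | zero => simp
  | add a a' h h' => simp only [map_add, LinearMap.add_apply, h, h']; abel
  | single n x =>
    induction b using Finsupp.induction_linear with
    | zero => simp
    | add b b' h h' => simp only [map_add, LinearMap.add_apply, h, h']; abel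
    | single m y =>
      rw [loopBr_mon, loopBr_mon, ← lie_skew, add_comm]
      exact Finsupp.single_neg _ _

lemma loopBr_jacobi (a b c : Loop g) :
    loopBr a (loopBr b c) = loopBr (loopBr a b) c + loopBr b (loopBr a c) := by
  induction a using Finsupp.induction_linear with
  | zero => simp
  | add a a' h h' => simp only [map_add, LinearMap.add_apply, h, h']; abel
  | single n x =>
    induction b using Finsupp.induction_linear with
    | zero => simp
    | add b b' h h' => simp only [map_add, LinearMap.add_apply, h, h']; abel
    | single m y =>
      induction c using Finsupp.induction_linear with
      | zero => simp
      | add c c' h h' => simp only [map_add, h, h']; abel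
      | single l z =>
        simp only [loopBr_mon, leibniz_lie x y z, Finsupp.single_add]
        rw [add_assoc n m l, add_left_comm m n l]

lemma loopDer_br (a b : Loop g) :
    loopDer (loopBr a b) = loopBr (loopDer a) b + loopBr a (loopDer b) := by
  induction a using Finsupp.induction_linear with
  | zero => simp
  | add a a' h h' => simp only [map_add, LinearMap.add_apply, h, h']; abel
  | single n x =>
    induction b using Finsupp.induction_linear with
    | zero => simp
    | add b b' h h' => simp only [map_add, h, h']; abel
    | single m y =>
      simp only [loopDer_mon, loopBr_mon, smul_lie, lie_smul, ← Finsupp.single_add, ← add_smul]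
      push_cast; rfl

lemma loopForm_der (a b : Loop g) :
    loopForm (loopDer a) b + loopForm a (loopDer b) = 0 := by
  induction a using Finsupp.induction_linear with
  | zero => simp
  | add a a' h h' => simp only [map_add, LinearMap.add_apply]; linear_combination h + h'
  | single n x =>
    induction b using Finsupp.induction_linear with
    | zero => simp
    | add b b' h h' => simp only [map_add]; linear_combination h + h'
    | single m y =>
      simp only [loopDer_mon, map_smul, LinearMap.smul_apply, loopForm_mon, smul_eq_mul]
      split_ifs with h
      · subst h; push_cast; ring
      · simp

lemma loopForm_swap (a b : Loop g) : loopForm a b = -loopForm b a := by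
  induction a using Finsupp.induction_linear with
  | zero => simp
  | add a a' h h' => simp only [map_add, LinearMap.add_apply, h, h']; ring
  | single n x =>
    induction b using Finsupp.induction_linear with
    | zero => simp
    | add b b' h h' => simp only [map_add, LinearMap.add_apply, h, h']; ring
    | single m y =>
      simp only [loopForm_mon]
      by_cases h : m = -n
      · subst h; simp [LieModule.traceForm_comm ℂ g g x y]
      · rw [if_neg h, if_neg (by omega)]; simp

lemma loopForm_cocycle (a b c : Loop g) :
    loopForm a (loopBr b c) = loopForm (loopBr a b) c + loopForm b (loopBr a c) := by
  induction a using Finsupp.induction_linear with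
  | zero => simp
  | add a a' h h' => simp only [map_add, LinearMap.add_apply, h, h']; ring
  | single n x =>
    induction b using Finsupp.induction_linear with
    | zero => simp
    | add b b' h h' => simp only [map_add, LinearMap.add_apply, h, h']; ring
    | single m y =>
      induction c using Finsupp.induction_linear with
      | zero => simp
      | add c c' h h' => simp only [map_add, h, h']; ring
      | single l z =>
        simp only [loopBr_mon, loopForm_mon]
        by_cases h : l = -(n + m)
        · subst h
          have h1 := LieModule.traceForm_apply_lie_apply ℂ g g x y z
          have h2 : killingForm ℂ g y ⁅x, z⁆ = -killingForm ℂ g ⁅x, y⁆ z := by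
            rw [← LieModule.traceForm_apply_lie_apply ℂ g g y x z, ← lie_skew x y, map_neg,
              LinearMap.neg_apply, neg_neg]
          rw [if_pos (by ring), if_pos rfl, if_pos (by ring), h2, ← h1]
          push_cast; ring
        · rw [if_neg (by omega), if_neg h, if_neg (by omega)]; simp

variable (g) in
/-- The affine Kac-Moody algebra `ĝ = g ⊗ ℂ[t, t⁻¹] ⊕ ℂ K ⊕ ℂ D` as a vector space. -/
@[ext] structure AffineLie where
  /-- the component in the loop algebra -/
  loop : Loop g
  /-- the coefficient of the central element `K` -/
  cK : ℂ
  /-- the coefficient of the derivation `D` -/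
  cD : ℂ

namespace AffineLie

/-- `ĝ` as a product of vector spaces. -/
def toProd : AffineLie g ≃ Loop g × ℂ × ℂ where
  toFun x := (x.loop, x.cK, x.cD)
  invFun x := ⟨x.1, x.2.1, x.2.2⟩
  left_inv _ := rfl
  right_inv _ := rfl

instance : AddCommGroup (AffineLie g) := toProd.addCommGroup

instance : Module ℂ (AffineLie g) := toProd.module ℂ

@[simp] lemma loop_zero : (0 : AffineLie g).loop = 0 := rfl
@[simp] lemma cK_zero : (0 : AffineLie g).cK = 0 := rfl
@[simp] lemma cD_zero : (0 : AffineLie g).cD = 0 := rfl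
@[simp] lemma loop_add (x y : AffineLie g) : (x + y).loop = x.loop + y.loop := rfl
@[simp] lemma cK_add (x y : AffineLie g) : (x + y).cK = x.cK + y.cK := rfl
@[simp] lemma cD_add (x y : AffineLie g) : (x + y).cD = x.cD + y.cD := rfl
@[simp] lemma loop_smul (c : ℂ) (x : AffineLie g) : (c • x).loop = c • x.loop := rfl
@[simp] lemma cK_smul (c : ℂ) (x : AffineLie g) : (c • x).cK = c * x.cK := rfl
@[simp] lemma cD_smul (c : ℂ) (x : AffineLie g) : (c • x).cD = c * x.cD := rfl

/-- The bracket: `K` is central, `[D, x ⊗ tⁿ] = n x ⊗ tⁿ`, and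
`[x ⊗ tⁿ, y ⊗ tᵐ] = [x, y] ⊗ tⁿ⁺ᵐ + n δ_{m,-n} k(x, y) K`. -/
instance : Bracket (AffineLie g) (AffineLie g) where
  bracket x y :=
    ⟨loopBr x.loop y.loop + x.cD • loopDer y.loop - y.cD • loopDer x.loop,
      loopForm x.loop y.loop, 0⟩

@[simp] lemma loop_lie (x y : AffineLie g) :
    ⁅x, y⁆.loop = loopBr x.loop y.loop + x.cD • loopDer y.loop - y.cD • loopDer x.loop := rfl
@[simp] lemma cK_lie (x y : AffineLie g) : ⁅x, y⁆.cK = loopForm x.loop y.loop := rfl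
@[simp] lemma cD_lie (x y : AffineLie g) : ⁅x, y⁆.cD = 0 := rfl

instance : LieRing (AffineLie g) where
  add_lie x y z := by
    ext1
    · simp only [loop_lie, loop_add, cD_add, map_add, LinearMap.add_apply, add_smul, smul_add]
      abel
    · simp
    · simp
  lie_add x y z := by
    ext1
    · simp only [loop_lie, loop_add, cD_add, map_add, add_smul, smul_add]
      abel
    · simp
    · simp
  lie_self x := by
    ext1
    · have h := loopBr_swap x.loop x.loop
      have h2 : (2 : ℂ) • loopBr x.loop x.loop = 0 := by
        rw [two_smul]; nth_rewrite 1 [h]; simp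
      simpa using h2
    · simpa using self_eq_neg.mp (loopForm_swap x.loop x.loop)
    · simp
  leibniz_lie x y z := by
    ext1
    · simp only [loop_lie, cD_lie, loop_add, map_add, map_sub, map_smul, LinearMap.add_apply,
        LinearMap.sub_apply, LinearMap.smul_apply, loopDer_br, smul_add, smul_sub, zero_smul,
        loopBr_jacobi x.loop y.loop z.loop, loopBr_swap (loopDer x.loop) y.loop, smul_neg]
      rw [smul_comm z.cD x.cD, smul_comm z.cD y.cD, smul_comm y.cD x.cD]
      abel
    · simp only [loop_lie, cK_lie, cK_add, map_add, map_sub, map_smul, LinearMap.add_apply,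
        LinearMap.sub_apply, LinearMap.smul_apply, smul_eq_mul,
        loopForm_cocycle x.loop y.loop z.loop]
      have h1 := loopForm_der x.loop y.loop
      have h2 := loopForm_der x.loop z.loop
      have h3 := loopForm_der y.loop z.loop
      have h4 := loopForm_swap (loopDer x.loop) y.loop
      linear_combination y.cD * h2 - x.cD * h3 - z.cD * h1 + z.cD * h4
    · simp

instance : LieAlgebra ℂ (AffineLie g) where
  lie_smul c x y := by
    ext1
    · simp only [loop_lie, loop_smul, cD_smul, map_smul, smul_add, smul_sub, mul_smul,
        smul_comm x.cD c]
    · simp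
    · simp

end AffineLie

/-! ### Cartan and Borel subalgebras, roots, the partial order -/

/-- A Borel subalgebra: a maximal solvable subalgebra. -/
def IsBorel (b : LieSubalgebra ℂ g) : Prop :=
  Maximal (fun c : LieSubalgebra ℂ g => LieAlgebra.IsSolvable c) b

/-- The affine Cartan algebra `ĥ = h ⊕ ℂ K ⊕ ℂ D`. -/
abbrev AffCartan (h : LieSubalgebra ℂ g) : Type u := h × ℂ × ℂ

/-- The inclusion `ĥ → ĝ`, `(H, a, d) ↦ H ⊗ 1 + a K + d D`. -/
def cartanIncl (h : LieSubalgebra ℂ g) (H : AffCartan h) : AffineLie g :=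
  ⟨mon 0 (H.1 : g), H.2.1, H.2.2⟩

/-- The dual space of `ĥ`. -/
abbrev Wt (h : LieSubalgebra ℂ g) : Type u := Module.Dual ℂ (AffCartan h)

/-- The underlying vector space of the affine Borel subalgebra
`b̂ = g ⊗ t ℂ[t] ⊕ b ⊕ ℂ K ⊕ ℂ D`. -/
def affBorel (b : LieSubalgebra ℂ g) : Submodule ℂ (AffineLie g) where
  carrier := {x | (∀ n < 0, x.loop n = 0) ∧ x.loop 0 ∈ b}
  zero_mem' := by simp
  add_mem' := by
    rintro x y ⟨hx, hx'⟩ ⟨hy, hy'⟩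
    refine ⟨fun n hn => ?_, ?_⟩
    · simp [hx n hn, hy n hn]
    · simpa using add_mem hx' hy'
  smul_mem' := by
    rintro c x ⟨hx, hx'⟩
    refine ⟨fun n hn => ?_, ?_⟩
    · simp [hx n hn]
    · simpa using b.smul_mem c hx'

/-- A linear form on `h` seen as a linear form on `ĥ`, through the projection `ĥ → h` along
`ℂ K ⊕ ℂ D`. -/
def finToAff (h : LieSubalgebra ℂ g) (α : Module.Dual ℂ h) : Wt h :=
  α ∘ₗ LinearMap.fst ℂ h (ℂ × ℂ)

/-- The linear form `δ` on `ĥ`: zero on `h ⊕ ℂ K`, and `δ(D) = 1`. -/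
def delta (h : LieSubalgebra ℂ g) : Wt h :=
  LinearMap.snd ℂ ℂ ℂ ∘ₗ LinearMap.snd ℂ h (ℂ × ℂ)

section Roots

variable (h : LieSubalgebra ℂ g) [h.IsCartanSubalgebra] (b : LieSubalgebra ℂ g)

/-- The set `R` of roots of `g` with respect to `h`. -/
def finRoots : Set (Module.Dual ℂ h) :=
  {α | α ≠ 0 ∧ LieAlgebra.rootSpace h α ≠ ⊥}

/-- The set `R⁺` of positive roots: the roots of `b`. -/
def finPosRoots : Set (Module.Dual ℂ h) :=
  {α | α ∈ finRoots h ∧ ∀ x ∈ LieAlgebra.rootSpace h α, x ∈ b}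

/-- The set of positive affine roots,
`R⁺ ∪ {α + n δ | α ∈ R, n > 0} ∪ {n δ | n > 0}`. -/
def affPosRoots : Set (Wt h) :=
  finToAff h '' finPosRoots h b ∪
    {γ | ∃ α ∈ finRoots h, ∃ n : ℕ, 0 < n ∧ γ = finToAff h α + n • delta h} ∪
    {γ | ∃ n : ℕ, 0 < n ∧ γ = n • delta h}

/-- The partial order on `ĥ*`: `μ ≤ lam` if `lam - μ` is a sum of positive affine roots. -/
def WtLE (μ lam : Wt h) : Prop :=
  lam - μ ∈ AddSubmonoid.closure (affPosRoots h b)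

/-- Open sets of weights: closed under passing to smaller weights. -/
def IsOpenWts (J : Set (Wt h)) : Prop :=
  ∀ lam ∈ J, ∀ μ, WtLE h b μ lam → μ ∈ J

/-- Locally bounded sets of weights. -/
def IsLocBddWts (J : Set (Wt h)) : Prop :=
  ∀ μ : Wt h, {γ | γ ∈ J ∧ WtLE h b μ γ}.Finite

end Roots

/-! ### `ĝ_A`-modules -/

section Modules

variable (g) in
/-- The algebra `A ⊗ U(ĝ)`.  Its modules are the `A`-modules with an `A`-linear action of `ĝ`. -/
abbrev EnvAlg (A : Type u) [CommRing A] [Algebra ℂ A] : Type u :=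
  A ⊗[ℂ] UniversalEnvelopingAlgebra ℂ (AffineLie g)

/-- The element `1 ⊗ x` through which `x ∈ ĝ` acts on `ĝ_A`-modules. -/
def act (A : Type u) [CommRing A] [Algebra ℂ A] (x : AffineLie g) : EnvAlg g A :=
  1 ⊗ₜ[ℂ] UniversalEnvelopingAlgebra.ι ℂ x

variable (g) in
/-- The category of `ĝ_A`-modules. -/
abbrev GMod (A : Type u) [CommRing A] [Algebra ℂ A] : Type (u + 1) := ModuleCat.{u} (EnvAlg g A)

section BaseAction

variable {A : Type u} [CommRing A] [Algebra ℂ A]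

/-- The `A`-module underlying a `ĝ_A`-module. -/
instance baseModule (M : GMod g A) : Module A M :=
  Module.compHom M (algebraMap A (EnvAlg g A))

instance baseTower (M : GMod g A) : IsScalarTower A (EnvAlg g A) M :=
  ⟨fun a r m => by rw [Algebra.smul_def, mul_smul]; rfl⟩

lemma base_smul_def (M : GMod g A) (a : A) (m : M) : a • m = algebraMap A (EnvAlg g A) a • m := rfl

lemma act_smul_comm (M : GMod g A) (x : AffineLie g) (a : A) (m : M) :
    act A x • a • m = a • act A x • m := by
  rw [base_smul_def, base_smul_def, ← mul_smul, ← mul_smul, Algebra.commutes]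

/-- A morphism of `ĝ_A`-modules, as an `A`-linear map. -/
def toBaseLin {M N : GMod g A} (f : M →ₗ[EnvAlg g A] N) : M →ₗ[A] N where
  toFun := f
  map_add' := f.map_add
  map_smul' a m := f.map_smul (algebraMap A (EnvAlg g A) a) m

/-- `M` is locally `b̂_A`-finite: every element lies in an `A`-submodule that is stable under `b̂` and
finitely generated over `A`. -/
def IsLocBorelFinite (b : LieSubalgebra ℂ g) (M : GMod g A) : Prop :=
  ∀ m : M, ∃ N : Submodule A M, m ∈ N ∧ N.FG ∧ ∀ x ∈ affBorel b, ∀ n ∈ N, act A x • n ∈ N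

end BaseAction

variable (h : LieSubalgebra ℂ g) (b : LieSubalgebra ℂ g)
variable (A : Type u) [CommRing A] [Algebra ℂ A] [Algebra (SymmetricAlgebra ℂ h) A]

/-- The scalar `(lam + τ)(H)` in `A`, where `τ : ĥ → h → S(h) → A` is the canonical map. -/
def wtScalar (lam : Wt h) (H : AffCartan h) : A :=
  algebraMap ℂ A (lam H) + algebraMap (SymmetricAlgebra ℂ h) A (SymmetricAlgebra.ι ℂ h H.1)

variable {A}

/-- The weight space `M_lam = {m | H m = (lam + τ)(H) m for all H ∈ ĥ}`. -/
def wtSpace (M : GMod g A) (lam : Wt h) : Submodule A M where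
  carrier := {m | ∀ H : AffCartan h, act A (cartanIncl h H) • m = wtScalar h A lam H • m}
  zero_mem' H := by simp
  add_mem' hx hy H := by rw [smul_add, smul_add, hx H, hy H]
  smul_mem' a m hm H := by rw [act_smul_comm, hm H, smul_comm]

open Classical in
/-- Weight modules: `M` is the direct sum of its weight spaces. -/
def IsWeightModule (M : GMod g A) : Prop :=
  DirectSum.IsInternal fun lam : Wt h => wtSpace h M lam

variable (A)

/-- The deformed category `Ô_A`: the locally `b̂_A`-finite weight modules. -/
def catO : ObjectProperty (GMod g A) :=
  fun M => IsWeightModule h M ∧ IsLocBorelFinite b M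

/-- The truncated category `Ô_A^J`: all weights lie in `J`. -/
def catOTrunc (J : Set (Wt h)) : ObjectProperty (GMod g A) :=
  fun M => catO h b A M ∧ ∀ lam, wtSpace h M lam ≠ ⊥ → lam ∈ J

/-! ### Verma modules and simple modules -/

/-- The left ideal of `A ⊗ U(ĝ)` generated by the elements `H - (lam + τ)(H)`, `H ∈ ĥ`, and by
`[b̂, b̂]`. -/
def vermaIdeal (lam : Wt h) : Submodule (EnvAlg g A) (EnvAlg g A) :=
  Submodule.span (EnvAlg g A)
    (Set.range (fun H : AffCartan h =>
        act A (cartanIncl h H) - algebraMap A (EnvAlg g A) (wtScalar h A lam H)) ∪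
      {r | ∃ x ∈ affBorel b, ∃ y ∈ affBorel b, r = act A ⁅x, y⁆})

/-- The deformed Verma module `Δ_A(lam) = U(ĝ) ⊗_{U(b̂)} A_lam`, where `A_lam` is `A` with `ĥ` acting
by `lam + τ` and `[b̂, b̂]` acting by zero: it is the module generated by one vector subject to these
relations. -/
def verma (lam : Wt h) : GMod g A :=
  ModuleCat.of (EnvAlg g A) (EnvAlg g A ⧸ vermaIdeal h b A lam)

/-- The quotient of `Δ_A(lam)` by the sum of all its proper submodules. For a field `A`, this is the
simple quotient of the Verma module. -/
def vermaHead (lam : Wt h) : GMod g A :=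
  ModuleCat.of (EnvAlg g A)
    (verma h b A lam ⧸
      sSup {N : Submodule (EnvAlg g A) (verma h b A lam) | N ≠ ⊤})

variable [IsLocalRing A]

variable (g) in
/-- The map `A ⊗ U(ĝ) → 𝕂 ⊗ U(ĝ)` for the residue field `𝕂` of `A`. -/
def resHom (A : Type u) [CommRing A] [Algebra ℂ A] [IsLocalRing A] :
    EnvAlg g A →+* EnvAlg g (IsLocalRing.ResidueField A) :=
  (Algebra.TensorProduct.map (IsScalarTower.toAlgHom ℂ A (IsLocalRing.ResidueField A))
    (AlgHom.id ℂ (UniversalEnvelopingAlgebra ℂ (AffineLie g)))).toRingHom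

/-- The simple module `L_A(lam)`: the simple quotient `L_𝕂(lam)` of the Verma module over the residue
field `𝕂` of `A`, on which `A` acts through `A → 𝕂`. -/
def simpleL (lam : Wt h) : GMod g A :=
  (ModuleCat.restrictScalars (resHom g A)).obj (vermaHead h b (IsLocalRing.ResidueField A) lam)

/-- `L_A(lam)` is a subquotient of `M`: a quotient of a submodule of `M`. -/
def IsSubquotientL (lam : Wt h) (M : GMod g A) : Prop :=
  ∃ (N : Submodule (EnvAlg g A) M) (q : N →ₗ[EnvAlg g A] simpleL h b A lam), Function.Surjective q

end Modules

/-! ### Projective covers and blocks -/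

section Blocks

variable (h : LieSubalgebra ℂ g) [h.IsCartanSubalgebra] (b : LieSubalgebra ℂ g)
variable (A : Type u) [CommRing A] [Algebra ℂ A] [Algebra (SymmetricAlgebra ℂ h) A]
  [IsLocalRing A]

/-- `c : P → L_A(lam)` is a projective cover in `Ô_A^J`. -/
structure IsProjCover (J : Set (Wt h)) (lam : Wt h) (P : (catOTrunc h b A J).FullSubcategory)
    (c : P.obj ⟶ simpleL h b A lam) : Prop where
  projective : Projective P
  surj : Function.Surjective c
  essential : ∀ (M : (catOTrunc h b A J).FullSubcategory) (f : M ⟶ P),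
    Function.Surjective (f.hom ≫ c) → Function.Surjective f.hom

/-- The generating relation: for some open, locally bounded `J` containing `lam` and `μ` there is a
nonzero homomorphism `P_A^J(lam) → P_A^J(μ)` between the projective covers. -/
def BlockRel (lam μ : Wt h) : Prop :=
  ∃ J : Set (Wt h), IsOpenWts h b J ∧ IsLocBddWts h b J ∧ lam ∈ J ∧ μ ∈ J ∧
    ∃ (P Q : (catOTrunc h b A J).FullSubcategory)
      (p : P.obj ⟶ simpleL h b A lam) (q : Q.obj ⟶ simpleL h b A μ),
      IsProjCover h b A J lam P p ∧ IsProjCover h b A J μ Q q ∧ ∃ f : P.obj ⟶ Q.obj, f ≠ 0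

/-- The equivalence relation `∼_A` on `ĥ*`. -/
def blockSetoid : Setoid (Wt h) := Relation.EqvGen.setoid (BlockRel h b A)

/-- The set of equivalence classes. -/
abbrev Block : Type u := Quotient (blockSetoid h b A)

/-- The block `Ô_{A,Λ}`: the objects of `Ô_A` all of whose subquotients of the form `L_A(lam)` have
`lam ∈ Λ`. -/
def catOBlock (Λ : Block h b A) : ObjectProperty (GMod g A) :=
  fun M => catO h b A M ∧
    ∀ lam : Wt h, IsSubquotientL h b A lam M → (Quotient.mk _ lam : Block h b A) = Λ

end Blocks

/-! ### Direct sums -/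

section Sums

variable {h : LieSubalgebra ℂ g} {b : LieSubalgebra ℂ g}
variable {A : Type u} [CommRing A] [Algebra ℂ A] [Algebra (SymmetricAlgebra ℂ h) A]

/-- The direct sum of a family of `ĝ_A`-modules. -/
def gSum {ι : Type u} (M : ι → GMod g A) : GMod g A :=
  ModuleCat.of (EnvAlg g A) (⨁ i, M i)

open Classical in
/-- The inclusion of a summand. -/
def gSumIncl {ι : Type u} (M : ι → GMod g A) (i : ι) : M i →ₗ[EnvAlg g A] gSum M :=
  DirectSum.lof (EnvAlg g A) ι (fun i => M i) i

/-- The projection to a summand. -/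
def gSumProj {ι : Type u} (M : ι → GMod g A) (i : ι) : gSum M →ₗ[EnvAlg g A] M i :=
  DirectSum.component (EnvAlg g A) ι (fun i => M i) i

lemma gSum_induction {ι : Type u} (M : ι → GMod g A) {p : gSum M → Prop} (h0 : p 0)
    (hadd : ∀ x y, p x → p y → p (x + y)) (hincl : ∀ i m, p (gSumIncl M i m)) (x : gSum M) :
    p x := by
  classical
  refine DirectSum.induction_on (motive := fun y => p y) x h0 ?_ hadd
  intro i m
  convert hincl i m
  unfold gSumIncl
  congr!

lemma map_wtSpace_le {M N : GMod g A} (f : M →ₗ[EnvAlg g A] N) (lam : Wt h) :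
    (wtSpace h M lam).map (toBaseLin f) ≤ wtSpace h N lam := by
  rintro _ ⟨m, hm, rfl⟩ H
  have := congrArg f (hm H)
  rw [map_smul] at this
  exact this.trans ((toBaseLin f).map_smul _ m)

lemma isWeightModule_iff (M : GMod g A) :
    IsWeightModule h M ↔ iSupIndep (wtSpace h M) ∧ ⨆ lam, wtSpace h M lam = ⊤ := by
  classical
  unfold IsWeightModule
  rw [← DirectSum.isInternal_submodule_iff_iSupIndep_and_iSup_eq_top]

lemma isWeightModule_gSum {ι : Type u} (M : ι → GMod g A) (hM : ∀ i, IsWeightModule h (M i)) :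
    IsWeightModule h (gSum M) := by
  rw [isWeightModule_iff]
  constructor
  · intro lam
    rw [Submodule.disjoint_def]
    intro x hx hx'
    refine DFinsupp.ext fun i => ?_
    have hi := ((isWeightModule_iff _).1 (hM i)).1 lam
    rw [Submodule.disjoint_def] at hi
    refine hi _ (map_wtSpace_le (gSumProj M i) lam ⟨x, hx, rfl⟩) ?_
    have h1 := Submodule.mem_map_of_mem (f := toBaseLin (gSumProj M i)) hx'
    simp only [Submodule.map_iSup] at h1
    exact (iSup₂_mono fun μ _ => map_wtSpace_le (gSumProj M i) μ) h1
  · rw [eq_top_iff]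
    rintro x -
    induction x using gSum_induction with
    | h0 => exact zero_mem _
    | hadd x y hx hy => exact add_mem hx hy
    | hincl i m =>
      have hi := ((isWeightModule_iff _).1 (hM i)).2
      have hm : m ∈ ⨆ lam, wtSpace h (M i) lam := by rw [hi]; trivial
      have h1 := Submodule.mem_map_of_mem (f := toBaseLin (gSumIncl M i)) hm
      simp only [Submodule.map_iSup] at h1
      exact (iSup_mono fun μ => map_wtSpace_le (gSumIncl M i) μ) h1

lemma isLocBorelFinite_gSum {ι : Type u} (M : ι → GMod g A)
    (hM : ∀ i, IsLocBorelFinite b (M i)) : IsLocBorelFinite b (gSum M) := by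
  intro x
  induction x using gSum_induction with
  | h0 => exact ⟨⊥, zero_mem _, Submodule.fg_bot, by simp⟩
  | hadd x y hx hy =>
    obtain ⟨N, hN, hfg, hst⟩ := hx
    obtain ⟨N', hN', hfg', hst'⟩ := hy
    refine ⟨N ⊔ N', add_mem (Submodule.mem_sup_left hN) (Submodule.mem_sup_right hN'),
      hfg.sup hfg', ?_⟩
    intro z hz n hn
    obtain ⟨n₁, h₁, n₂, h₂, rfl⟩ := Submodule.mem_sup.1 hn
    rw [smul_add]
    exact add_mem (Submodule.mem_sup_left (hst z hz _ h₁)) (Submodule.mem_sup_right (hst' z hz _ h₂))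
  | hincl i m =>
    obtain ⟨N, hN, hfg, hst⟩ := hM i m
    refine ⟨N.map (toBaseLin (gSumIncl M i)), ⟨m, hN, rfl⟩, hfg.map _, ?_⟩
    rintro z hz _ ⟨n, hn, rfl⟩
    exact ⟨_, hst z hz n hn, (gSumIncl M i).map_smul _ n⟩

lemma catO_gSum {ι : Type u} (M : ι → GMod g A) (hM : ∀ i, catO h b A (M i)) :
    catO h b A (gSum M) :=
  ⟨isWeightModule_gSum M fun i => (hM i).1, isLocBorelFinite_gSum M fun i => (hM i).2⟩

end Sums

/-- The functor `∏_Λ Ô_{A,Λ} → Ô_A`, `{M_Λ} ↦ ⨁_Λ M_Λ`. -/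
def blockSum (h : LieSubalgebra ℂ g) [h.IsCartanSubalgebra] (b : LieSubalgebra ℂ g)
    (A : Type u) [CommRing A] [Algebra ℂ A] [Algebra (SymmetricAlgebra ℂ h) A] [IsLocalRing A] :
    (∀ Λ : Block h b A, (catOBlock h b A Λ).FullSubcategory) ⥤ (catO h b A).FullSubcategory where
  obj M := ⟨gSum fun Λ => (M Λ).obj, catO_gSum _ fun Λ => (M Λ).property.1⟩
  map f := ObjectProperty.homMk (ModuleCat.ofHom (DirectSum.lmap fun Λ => (f Λ).hom.hom))
  map_id M := by
    ext x
    exact DFinsupp.ext fun Λ => rfl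
  map_comp f f' := by
    ext x
    exact DFinsupp.ext fun Λ => rfl

end AffineO

end

/-! The blocks split off because simple subquotients are detected by projective covers. Let `L(ν)`
be a subquotient of a module `M` whose weights lie in an open, locally bounded set `J`. Then the
cover `P(ν)` in the category truncated at `J` has a nonzero map to `M`. For `M = P(lam)` this says
that every simple subquotient `L(ν)` of `P(lam)` has `ν` in the class of `lam`
(`block_eq_of_isSubquotientL`).

For any `M` in `Ô_A`, let `M_Λ` consist of the elements that generate submodules with simple
subquotients from `Λ` only (`blockPart`). The sum of the `M_Λ` is direct, since a nonzero submodule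
contains a highest weight vector and therefore has a simple subquotient. The sum is all of `M`:
otherwise the quotient has a subquotient `L(ν)`, a nonzero map from `P(ν)` to the quotient lifts to
`M`, and its image lies in `M_Λ` for the class `Λ` of `ν`, a contradiction
(`iSup_blockPart_of_catOTrunc`). Truncation costs nothing, because every cyclic submodule lies in a
truncated category (`exists_truncation`). Homomorphisms between different blocks vanish, as nonzero
images have simple subquotients. So the functor is fully faithful, and the decomposition makes it
essentially surjective.

Most of the work is the existence of projective covers (`exists_isProjCover`). In the truncated
category the functor `M ↦ M_lam` is represented by a cyclic module `projMod`, which is projective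
because weight vectors lift along surjections. To control it, `ĝ` is given a triangular basis, which
rests on the fact that for each root `α` of `g` one of `α`, `-α` is a root of `b`
(`finPosRoots_or_neg`). The Poincaré-Birkhoff-Witt theorem, proved here by straightening words, then
shows that the weight spaces of `projMod` are finitely generated, and free at maximal weights of
`J`.

The cover of `L(lam)` is the image of an idempotent endomorphism of `projMod`, built by induction on
the number of weights of `J` above `lam`. If `lam` is maximal, the identity works. If a maximal
weight `ν` is added, the idempotent is lifted (`exists_idempotent_of_truncation`). As `A` need not
be complete, general lifting of idempotents is not available; instead the freeness of the weight
space at `ν` and projective covers of finitely generated `A`-modules are used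
(`LocalLift.exists_idempotent`). Nakayama's lemma shows that the new image is still a cover. -/

noncomputable section

set_option linter.unusedSectionVars false

/-! ### The Poincaré-Birkhoff-Witt theorem -/

namespace PBW

variable {k : Type*} [CommRing k] {L : Type*} [LieRing L] [LieAlgebra k L]
variable {ι : Type*} [LinearOrder ι]

/-- The number of inversions of a word. -/
def inv : List ι → ℕ
  | [] => 0
  | i :: l => l.countP (· < i) + inv l

lemma inv_swap (a b : List ι) {i j : ι} (hji : j < i) :
    inv (a ++ j :: i :: b) < inv (a ++ i :: j :: b) := by
  induction a with
  | nil => simp [inv, hji, hji.not_gt]; omega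
  | cons m a ih =>
    have : (a ++ j :: i :: b).countP (· < m) = (a ++ i :: j :: b).countP (· < m) :=
      List.Perm.countP_eq _ ((List.Perm.swap i j b).append_left a)
    simp only [List.cons_append, inv, this]
    omega

variable (e : Module.Basis ι k L)

open Classical in
/-- The normal form of a word in the basis elements: sorted words are normal, and an inverted pair of
neighbours is interchanged at the cost of a shorter word with their bracket. -/
def nf (l : List ι) : Multiset ι →₀ k :=
  if h : ∃ p : List ι × ι × ι × List ι, l = p.1 ++ p.2.1 :: p.2.2.1 :: p.2.2.2 ∧ p.2.2.1 < p.2.1 then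
    nf (h.choose.1 ++ h.choose.2.2.1 :: h.choose.2.1 :: h.choose.2.2.2) +
      (e.repr ⁅e h.choose.2.1, e h.choose.2.2.1⁆).sum
        fun m c => c • nf (h.choose.1 ++ m :: h.choose.2.2.2)
  else Finsupp.single (l : Multiset ι) 1
-- The interchanged word has the same length and fewer inversions; the words from the bracket are
-- shorter by one letter.
termination_by (l.length, inv l)
decreasing_by
  · obtain ⟨h1, h2⟩ := h.choose_spec
    generalize h.choose = p at *
    subst h1
    simp only [List.length_append, List.length_cons]
    exact Prod.Lex.right _ (inv_swap _ _ h2)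
  · obtain ⟨h1, -⟩ := h.choose_spec
    generalize h.choose = p at *
    subst h1
    apply Prod.Lex.left
    simp

/-- The linear extension of the normal form in one letter of the word. -/
def nfL (a b : List ι) : L →ₗ[k] Multiset ι →₀ k := e.constr k fun m => nf e (a ++ m :: b)

@[simp] lemma nfL_basis (a b : List ι) (m : ι) : nfL e a b (e m) = nf e (a ++ m :: b) := by
  simp [nfL]

lemma nf_of_sorted {l : List ι} (h : l.Pairwise (· ≤ ·)) : nf e l = Finsupp.single (l : Multiset ι) 1 := by
  rw [nf, dif_neg]
  rintro ⟨⟨a, i, j, b⟩, rfl, hij⟩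
  have := (List.pairwise_cons.1 (List.pairwise_append.1 h).2.1).1 j (by simp)
  exact absurd hij this.not_gt

lemma sorted_or_descent (l : List ι) : l.Pairwise (· ≤ ·) ∨
    ∃ a i j b, l = a ++ i :: j :: b ∧ j < i := by
  induction l with
  | nil => simp
  | cons i l ih =>
    rcases ih with ih | ⟨a, x, y, b, rfl, h⟩
    · cases l with
      | nil => simp
      | cons j l =>
        rcases le_or_gt i j with hij | hij
        · left
          refine List.pairwise_cons.2 ⟨fun m hm => ?_, ih⟩
          rcases List.mem_cons.1 hm with rfl | hm
          · exact hij
          · exact hij.trans ((List.pairwise_cons.1 ih).1 m hm)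
        · exact Or.inr ⟨[], i, j, l, rfl, hij⟩
    · exact Or.inr ⟨i :: a, x, y, b, rfl, h⟩

/-- The straightening rule holds at every descent of the word `l`. -/
def Straight (l : List ι) : Prop :=
  ∀ a i j b, l = a ++ i :: j :: b → j < i →
    nf e l = nf e (a ++ j :: i :: b) + nfL e a b ⁅e i, e j⁆

/-- The rule is antisymmetric in `i` and `j`, so for an ascent it follows from the rule for the
interchanged word. Without the condition `j < i` it can be extended linearly in a letter, which
`confluence` needs. -/
lemma Straight.exchange {a b : List ι} {i j : ι} (h1 : Straight e (a ++ i :: j :: b))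
    (h2 : Straight e (a ++ j :: i :: b)) :
    nf e (a ++ i :: j :: b) = nf e (a ++ j :: i :: b) + nfL e a b ⁅e i, e j⁆ := by
  rcases lt_trichotomy j i with h | rfl | h
  · exact h1 a i j b rfl h
  · simp
  · rw [h2 a j i b rfl h, ← lie_skew, map_neg]; abel

/-- The diamond lemma. Two descents coincide, share a letter or are disjoint. If they share a
letter, the two results agree by the Jacobi identity; if they are disjoint, the two resolutions
commute. -/
lemma confluence {a b a' b' : List ι} {i j i' j' : ι}
    (h : a ++ i :: j :: b = a' ++ i' :: j' :: b') (hle : a.length ≤ a'.length)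
    (hij : j < i) (hij' : j' < i')
    (hs : ∀ l : List ι, l.length < (a ++ i :: j :: b).length → Straight e l)
    (hi : ∀ l : List ι, l.length = (a ++ i :: j :: b).length → inv l < inv (a ++ i :: j :: b) →
      Straight e l) :
    nf e (a ++ j :: i :: b) + nfL e a b ⁅e i, e j⁆ =
      nf e (a' ++ j' :: i' :: b') + nfL e a' b' ⁅e i', e j'⁆ := by
  obtain ⟨c, rfl⟩ : ∃ c, a' = a ++ c := by
    rcases List.append_eq_append_iff.1 h with ⟨c, h1, -⟩ | ⟨c, h1, -⟩
    · exact ⟨c, h1⟩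
    · have : c = [] := by
        subst h1; simp at hle; exact hle
      exact ⟨[], by simp [h1, this]⟩
  rw [List.append_assoc, List.append_cancel_left_eq] at h
  match c, h with
  | [], h => simp_all
  | [x], h =>
    simp only [List.cons_append, List.nil_append, List.cons.injEq] at h
    obtain ⟨rfl, rfl, rfl⟩ := h
    -- the overlap `i > j > j'`
    have E1 := hi (a ++ j :: i :: j' :: b') (by simp) (inv_swap _ _ hij) (a ++ [j]) i j' b'
      (by simp) (hij'.trans hij)
    have l1 : inv (a ++ j :: j' :: i :: b') < inv (a ++ i :: j :: j' :: b') := by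
      have := inv_swap (a ++ [j]) b' (hij'.trans hij)
      simp only [List.append_assoc, List.cons_append, List.nil_append] at this
      exact this.trans (inv_swap a _ hij)
    have l2 : inv (a ++ i :: j' :: j :: b') < inv (a ++ i :: j :: j' :: b') := by
      have := inv_swap (a ++ [i]) b' hij'
      simpa using this
    have l3 : inv (a ++ j' :: i :: j :: b') < inv (a ++ i :: j :: j' :: b') :=
      (inv_swap a _ (hij'.trans hij)).trans l2
    have E2 := hi _ (by simp) l1 a j j' (i :: b') rfl hij'
    have E3 := hi _ (by simp) l2 a i j' (j :: b') rfl (hij'.trans hij)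
    have E4 := hi _ (by simp) l3 (a ++ [j']) i j b' (by simp) hij
    simp only [List.append_assoc, List.cons_append, List.nil_append] at E1 E2 E3 E4 ⊢
    -- Moving the free letter `x` past `p` costs their bracket. The words have one letter less, so
    -- the rule is known for them.
    have S : ∀ (p : ι) (x : L), nfL e a (p :: b') x - nfL e (a ++ [p]) b' x =
        nfL e a b' ⁅x, e p⁆ := by
      intro p x
      have : nfL e a (p :: b') - nfL e (a ++ [p]) b' =
          nfL e a b' ∘ₗ ((LieModule.toEnd k L L : L →ₗ[k] Module.End k L).flip (e p)) := by
        refine e.ext fun m => ?_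
        have := Straight.exchange e (a := a) (b := b') (i := m) (j := p) (hs _ (by simp))
          (hs _ (by simp))
        simp [this]
      exact LinearMap.congr_fun this x
    rw [E1, E2, E3, E4]
    have J : ⁅⁅e i, e j⁆, e j'⁆ - ⁅⁅e i, e j'⁆, e j⁆ + ⁅⁅e j, e j'⁆, e i⁆ = 0 := by
      have h1 := lie_jacobi (e i) (e j) (e j')
      rw [← lie_skew (e i) ⁅e j, e j'⁆, ← lie_skew (e j) ⁅e j', e i⁆,
        ← lie_skew (e j') ⁅e i, e j⁆, ← lie_skew (e j') (e i)] at h1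
      rw [← neg_eq_zero, ← h1]
      simp only [neg_lie]
      abel
    have J' := congrArg (nfL e a b') J
    rw [map_add, map_sub, map_zero, ← S, ← S, ← S] at J'
    rw [← sub_eq_zero, ← J']
    abel
  | x :: y :: c, h =>
    simp only [List.cons_append, List.cons.injEq] at h
    obtain ⟨rfl, rfl, rfl⟩ := h
    have E1 := hi _ (by simp) (inv_swap a (c ++ i' :: j' :: b') hij) (a ++ j :: i :: c) i' j' b'
      (by simp) hij'
    have l2 : inv (a ++ i :: j :: c ++ j' :: i' :: b') < inv (a ++ i :: j :: (c ++ i' :: j' :: b')) := by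
      have := inv_swap (a ++ i :: j :: c) b' hij'
      simpa using this
    have E2 := hi _ (by simp) l2 a i j (c ++ j' :: i' :: b') (by simp) hij
    -- `B x y` is the normal form of the word in which both pairs are replaced by the single free
    -- letters `x` and `y`.
    let B : L →ₗ[k] L →ₗ[k] Multiset ι →₀ k := e.constr k fun m => nfL e (a ++ m :: c) b'
    have B1 : ∀ x, nfL e a (c ++ i' :: j' :: b') x =
        nfL e a (c ++ j' :: i' :: b') x + B x ⁅e i', e j'⁆ := by
      intro x
      have : nfL e a (c ++ i' :: j' :: b') =
          nfL e a (c ++ j' :: i' :: b') + B.flip ⁅e i', e j'⁆ := by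
        refine e.ext fun m => ?_
        have := Straight.exchange e (a := a ++ m :: c) (b := b') (i := i') (j := j')
          (hs _ (by simp)) (hs _ (by simp))
        simpa [B] using this
      exact LinearMap.congr_fun this x
    have B3 : ∀ n x, B x (e n) = nfL e a (c ++ n :: b') x := by
      intro n x
      have : B.flip (e n) = nfL e a (c ++ n :: b') := e.ext fun m => by simp [B]
      exact LinearMap.congr_fun this x
    have B2 : ∀ x, nfL e (a ++ i :: j :: c) b' x =
        nfL e (a ++ j :: i :: c) b' x + B ⁅e i, e j⁆ x := by
      intro x
      have : nfL e (a ++ i :: j :: c) b' =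
          nfL e (a ++ j :: i :: c) b' + B ⁅e i, e j⁆ := by
        refine e.ext fun m => ?_
        have := Straight.exchange e (a := a) (b := c ++ m :: b') (i := i) (j := j)
          (hs _ (by simp)) (hs _ (by simp))
        simpa [B3] using this
      exact LinearMap.congr_fun this x
    simp only [List.append_assoc, List.cons_append] at E1 E2 ⊢
    rw [E1, E2, B1, B2]
    abel

/-- `nf` resolves one arbitrarily chosen descent; by `confluence` any other descent gives the same
result. -/
theorem straight (l : List ι) : Straight e l := by
  have wf : WellFounded (Prod.Lex (· < · : ℕ → ℕ → Prop) (· < · : ℕ → ℕ → Prop)) :=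
    (Prod.lex ⟨_, Nat.lt_wfRel.wf⟩ ⟨_, Nat.lt_wfRel.wf⟩).wf
  induction l using (InvImage.wf (fun l : List ι => (l.length, inv l)) wf).induction with
  | _ l ih =>
    intro a i j b hl hij
    have h : ∃ p : List ι × ι × ι × List ι,
      l = p.1 ++ p.2.1 :: p.2.2.1 :: p.2.2.2 ∧ p.2.2.1 < p.2.1 := ⟨(a, i, j, b), hl, hij⟩
    obtain ⟨h1, h2⟩ := h.choose_spec
    have h3 : nf e l = nf e (h.choose.1 ++ h.choose.2.2.1 :: h.choose.2.1 :: h.choose.2.2.2) +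
        nfL e h.choose.1 h.choose.2.2.2 ⁅e h.choose.2.1, e h.choose.2.2.1⁆ := by
      rw [nf, dif_pos h, nfL, Module.Basis.constr_apply]
    rw [h3]
    generalize h.choose = p at *
    obtain ⟨a', i', j', b'⟩ := p
    simp only at h1 h2 ⊢
    have hs : ∀ l' : List ι, l'.length < l.length → Straight e l' :=
      fun l' hl' => ih l' (Prod.Lex.left _ _ hl')
    have hi : ∀ l' : List ι, l'.length = l.length → inv l' < inv l → Straight e l' := by
      intro l' h h'
      refine ih l' ?_
      show Prod.Lex _ _ (l'.length, inv l') (l.length, inv l)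
      rw [h]
      exact Prod.Lex.right _ h'
    rcases le_total a.length a'.length with hle | hle
    · exact (confluence e (hl.symm.trans h1) hle hij h2 (hl ▸ hs) (hl ▸ hi)).symm
    · exact confluence e (h1.symm.trans hl) hle h2 hij (h1 ▸ hs) (h1 ▸ hi)

theorem nf_exchange (a b : List ι) (i j : ι) :
    nf e (a ++ i :: j :: b) = nf e (a ++ j :: i :: b) + nfL e a b ⁅e i, e j⁆ :=
  Straight.exchange e (straight e _) (straight e _)

/-- Induction along the straightening algorithm. -/
theorem straight_induction {P : List ι → Prop} (sorted : ∀ l, l.Pairwise (· ≤ ·) → P l)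
    (step : ∀ a i j b, j < i → P (a ++ j :: i :: b) → (∀ m, P (a ++ m :: b)) →
      P (a ++ i :: j :: b)) (l : List ι) : P l := by
  have wf : WellFounded (Prod.Lex (· < · : ℕ → ℕ → Prop) (· < · : ℕ → ℕ → Prop)) :=
    (Prod.lex ⟨_, Nat.lt_wfRel.wf⟩ ⟨_, Nat.lt_wfRel.wf⟩).wf
  induction l using (InvImage.wf (fun l : List ι => (l.length, inv l)) wf).induction with
  | _ l ih =>
    rcases sorted_or_descent l with h | ⟨a, i, j, b, rfl, hij⟩
    · exact sorted l h
    · refine step a i j b hij (ih _ ?_) fun m => ih _ (Prod.Lex.left _ _ (by simp))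
      show Prod.Lex _ _ (_, _) (_, _)
      rw [show (a ++ j :: i :: b).length = (a ++ i :: j :: b).length by simp]
      exact Prod.Lex.right _ (inv_swap a b hij)

lemma linear_in_letter {F : Type*} [AddCommGroup F] [Module k F] (a b : List ι)
    (f : (Multiset ι →₀ k) →ₗ[k] F) (φ : L →ₗ[k] F)
    (h : ∀ m, f (nf e (a ++ m :: b)) = φ (e m)) (x : L) : f (nfL e a b x) = φ x := by
  have : f ∘ₗ nfL e a b = φ := e.ext fun m => by simp [h]
  exact LinearMap.congr_fun this x

/-- The action of `L` on the space of normal forms. -/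
def rho : L →ₗ[k] Module.End k (Multiset ι →₀ k) :=
  e.constr k fun i => Finsupp.linearCombination k fun M => nf e (i :: M.sort (· ≤ ·))

/-- `rho` is defined through sorted words. Prefixing a letter is compatible with straightening the
rest, by the exchange rule for the longer word. -/
lemma rho_basis_nf (i : ι) (l : List ι) : rho e (e i) (nf e l) = nf e (i :: l) := by
  induction l using straight_induction with
  | sorted l h =>
    have hs : (l : Multiset ι).sort (· ≤ ·) = l := by
      rw [Multiset.coe_sort]
      exact List.mergeSort_of_pairwise (by simpa using h)
    simp [nf_of_sorted e h, rho, hs]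
  | step a x y b hxy h1 h2 =>
    rw [nf_exchange, map_add, h1, linear_in_letter e a b (rho e (e i)) (nfL e (i :: a) b)
      (by simp [h2])]
    exact (nf_exchange e (i :: a) b x y).symm

lemma rho_nf (x : L) (l : List ι) : rho e x (nf e l) = nfL e [] l x := by
  have : (rho e).flip (nf e l) = nfL e [] l := e.ext fun m => by simp [rho_basis_nf]
  exact LinearMap.congr_fun this x

lemma nf_sort (M : Multiset ι) : nf e (M.sort (· ≤ ·)) = Finsupp.single M 1 := by
  rw [nf_of_sorted e (Multiset.pairwise_sort _ _), Multiset.sort_eq]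

/-- On a sorted word `l` this is the exchange of the first two letters of `i :: j :: l`; both sides
are bilinear in `x` and `y`. -/
lemma rho_lie (x y : L) : rho e ⁅x, y⁆ = rho e x * rho e y - rho e y * rho e x := by
  have h : ∀ i j, rho e ⁅e i, e j⁆ = rho e (e i) * rho e (e j) - rho e (e j) * rho e (e i) := by
    intro i j
    ext1 M
    ext1
    simp only [LinearMap.coe_comp, Function.comp_apply, Finsupp.lsingle_apply,
      LinearMap.sub_apply, Module.End.mul_apply]
    rw [← nf_sort e M, rho_nf, rho_basis_nf, rho_basis_nf, rho_basis_nf, rho_basis_nf]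
    have := nf_exchange e [] (M.sort (· ≤ ·)) i j
    simp only [List.nil_append] at this
    rw [this]; abel
  let f : L →ₗ[k] L →ₗ[k] Module.End k (Multiset ι →₀ k) :=
    (LieModule.toEnd k L L : L →ₗ[k] Module.End k L).compr₂ (rho e)
  let p : L →ₗ[k] L →ₗ[k] Module.End k (Multiset ι →₀ k) :=
    (LinearMap.mul k (Module.End k (Multiset ι →₀ k))).compl₁₂ (rho e) (rho e)
  have : f + LinearMap.flip p = p := e.ext fun i => e.ext fun j => by
    show rho e ⁅e i, e j⁆ + rho e (e j) * rho e (e i) = rho e (e i) * rho e (e j)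
    rw [h]; abel
  have h2 : rho e ⁅x, y⁆ + rho e y * rho e x = rho e x * rho e y :=
    LinearMap.congr_fun₂ this x y
  exact LinearMap.ext fun f => eq_sub_of_add_eq (LinearMap.congr_fun h2 f)

-- Comparison of normal forms with the enveloping algebra

attribute [local instance] LieRing.ofAssociativeRing

/-- The product of a word in the enveloping algebra. -/
def word (l : List ι) : UniversalEnvelopingAlgebra k L :=
  (l.map fun i => UniversalEnvelopingAlgebra.ι k (e i)).prod

@[simp] lemma word_nil : word e [] = 1 := rfl

lemma word_cons (i : ι) (l : List ι) :
    word e (i :: l) = UniversalEnvelopingAlgebra.ι k (e i) * word e l := by simp [word]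

lemma word_append (l l' : List ι) : word e (l ++ l') = word e l * word e l' := by simp [word]

/-- The sorted monomials in the enveloping algebra. -/
def mono (M : Multiset ι) : UniversalEnvelopingAlgebra k L := word e (M.sort (· ≤ ·))

/-- The linear map sending a normal form to the corresponding sum of sorted monomials. -/
def ofNF : (Multiset ι →₀ k) →ₗ[k] UniversalEnvelopingAlgebra k L :=
  Finsupp.linearCombination k (mono e)

lemma word_exchange (a b : List ι) (i j : ι) : word e (a ++ i :: j :: b) =
    word e (a ++ j :: i :: b) +
      word e a * UniversalEnvelopingAlgebra.ι k ⁅e i, e j⁆ * word e b := by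
  simp only [word_append, word_cons, LieHom.map_lie, LieRing.of_associative_ring_bracket]
  noncomm_ring

lemma ofNF_nf (l : List ι) : ofNF e (nf e l) = word e l := by
  induction l using straight_induction with
  | sorted l h =>
    have hs : (l : Multiset ι).sort (· ≤ ·) = l := by
      rw [Multiset.coe_sort]
      exact List.mergeSort_of_pairwise (by simpa using h)
    simp [nf_of_sorted e h, ofNF, mono, hs]
  | step a x y b hxy h1 h2 =>
    let φ : L →ₗ[k] UniversalEnvelopingAlgebra k L :=
      LinearMap.mulRight k (word e b) ∘ₗ LinearMap.mulLeft k (word e a) ∘ₗ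
        (UniversalEnvelopingAlgebra.ι k : L →ₗ⁅k⁆ UniversalEnvelopingAlgebra k L)
    rw [nf_exchange, map_add, h1, linear_in_letter e a b (ofNF e) φ, word_exchange e a b x y]
    · rfl
    · intro m
      simp [h2, φ, word_append, word_cons, mul_assoc]

/-- The action of the enveloping algebra on the space of normal forms. -/
def envRho : UniversalEnvelopingAlgebra k L →ₐ[k] Module.End k (Multiset ι →₀ k) :=
  UniversalEnvelopingAlgebra.lift k
    { rho e with
      map_lie' := fun {x y} => by
        rw [LieRing.of_associative_ring_bracket]; exact rho_lie e x y }

lemma envRho_ι (x : L) : envRho e (UniversalEnvelopingAlgebra.ι k x) = rho e x := by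
  unfold envRho
  rw [UniversalEnvelopingAlgebra.lift_ι_apply]; rfl

lemma envRho_word (l : List ι) : envRho e (word e l) (Finsupp.single 0 1) = nf e l := by
  induction l with
  | nil => simpa using (nf_of_sorted e (l := []) List.Pairwise.nil).symm
  | cons i l ih => rw [word_cons, map_mul, Module.End.mul_apply, ih, envRho_ι, rho_basis_nf]

/-- The elements that satisfy `P` form a subalgebra through which `ι` factors; the universal
property yields a map into it whose composite with the inclusion is the identity. -/
lemma env_induction {P : UniversalEnvelopingAlgebra k L → Prop}
    (algebraMap : ∀ r, P (algebraMap k _ r)) (ι : ∀ x, P (UniversalEnvelopingAlgebra.ι k x))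
    (mul : ∀ a b, P a → P b → P (a * b)) (add : ∀ a b, P a → P b → P (a + b))
    (a : UniversalEnvelopingAlgebra k L) : P a := by
  let S : Subalgebra k (UniversalEnvelopingAlgebra k L) :=
    { carrier := {a | P a}
      mul_mem' := fun ha hb => mul _ _ ha hb
      add_mem' := fun ha hb => add _ _ ha hb
      algebraMap_mem' := algebraMap }
  let f : L →ₗ⁅k⁆ S :=
    { toFun := fun x => ⟨UniversalEnvelopingAlgebra.ι k x, ι x⟩
      map_add' := fun x y => by ext; simp
      map_smul' := fun c x => by ext; simp
      map_lie' := fun {x y} => by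
        ext
        simp [LieRing.of_associative_ring_bracket] }
  have h : S.val.comp (UniversalEnvelopingAlgebra.lift k f) = AlgHom.id k _ := by
    ext x
    simp only [LieHom.coe_comp, AlgHom.coe_toLieHom, Function.comp_apply, AlgHom.coe_comp,
      UniversalEnvelopingAlgebra.lift_ι_apply]
    rfl
  have := AlgHom.congr_fun h a
  rw [AlgHom.id_apply] at this
  rw [← this]
  exact (UniversalEnvelopingAlgebra.lift k f a).2

/-- Both sides are multiplicative and additive in `a`, so elements of `L` suffice; there it is
`ofNF_nf` for a word with one more letter. -/
lemma ofNF_envRho (a : UniversalEnvelopingAlgebra k L) (f : Multiset ι →₀ k) :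
    ofNF e (envRho e a f) = a * ofNF e f := by
  induction a using env_induction generalizing f with
  | algebraMap r => simp [Algebra.smul_def]
  | ι x =>
    rw [envRho_ι]
    let q : L →ₗ[k] (Multiset ι →₀ k) →ₗ[k] UniversalEnvelopingAlgebra k L :=
      (LinearMap.mul k (UniversalEnvelopingAlgebra k L)).compl₁₂
        (UniversalEnvelopingAlgebra.ι k : L →ₗ⁅k⁆ UniversalEnvelopingAlgebra k L).toLinearMap (ofNF e)
    have : (rho e).compr₂ (ofNF e) = q := by
      refine e.ext fun i => ?_
      ext M
      simp only [LinearMap.coe_comp, Function.comp_apply, Finsupp.lsingle_apply,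
        LinearMap.compr₂_apply, q, LinearMap.compl₁₂_apply, LinearMap.mul_apply']
      rw [← nf_sort e M, rho_basis_nf, ofNF_nf, ofNF_nf, word_cons]
      rfl
    exact LinearMap.congr_fun₂ this x f
  | mul a b ha hb => rw [map_mul, Module.End.mul_apply, ha, hb, mul_assoc]
  | add a b ha hb => rw [map_add, LinearMap.add_apply, map_add, ha, hb, add_mul]

/-- **Poincaré-Birkhoff-Witt**: the sorted monomials form a basis of the enveloping algebra. -/
def basis : Module.Basis (Multiset ι) k (UniversalEnvelopingAlgebra k L) :=
  -- The inverse of `ofNF` is the action on the empty word, `a ↦ a · 1`.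
  .ofRepr <| LinearEquiv.ofLinearMap ((envRho e).toLinearMap.flip (Finsupp.single 0 1)) (ofNF e)
    (by
      ext1 M
      ext1
      simp [ofNF, mono, envRho_word, nf_sort])
    (by
      ext a
      have := ofNF_envRho e a (Finsupp.single 0 1)
      simpa [ofNF, mono] using this)

lemma basis_apply (M : Multiset ι) : basis e M = mono e M := by
  simp [basis, ofNF]

/-- Straightening respects gradings, and does not leave a set of letters that is closed under the
bracket. -/
lemma nf_mem_supported {G : Type*} [AddCommMonoid G] (wt : ι → G) (p : ι → Prop)
    (hp : ∀ i j, p i → p j → ∀ m ∈ (e.repr ⁅e i, e j⁆).support, p m ∧ wt m = wt i + wt j)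
    (l : List ι) (hl : ∀ i ∈ l, p i) : nf e l ∈ Finsupp.supported k k
      {M : Multiset ι | (∀ i ∈ M, p i) ∧ (M.map wt).sum = (l.map wt).sum} := by
  induction l using straight_induction with
  | sorted l h =>
    rw [nf_of_sorted e h]
    exact Finsupp.single_mem_supported _ _ ⟨by simpa using hl, by simp⟩
  | step a x y b hxy h1 h2 =>
    have hperm : (a ++ y :: x :: b).Perm (a ++ x :: y :: b) :=
      (List.Perm.swap x y b).append_left a
    rw [nf_exchange]
    refine add_mem ?_ ?_
    · have := h1 fun i hi => hl i (hperm.mem_iff.1 hi)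
      rwa [(hperm.map wt).sum_eq] at this
    · rw [nfL, Module.Basis.constr_apply]
      refine Submodule.sum_mem _ fun m hm => Submodule.smul_mem _ _ ?_
      obtain ⟨h3, h4⟩ := hp x y (hl x (by simp)) (hl y (by simp)) m hm
      have := h2 m fun i hi => by
        rcases List.mem_append.1 hi with hi | hi
        · exact hl i (by simp [hi])
        · rcases List.mem_cons.1 hi with rfl | hi
          · exact h3
          · exact hl i (by simp [hi])
      convert this using 4
      simp [h4, add_assoc]

end PBW

end

noncomputable section

set_option linter.unusedSectionVars false

namespace AffineO

open LieAlgebra LieModule LieAlgebra.IsKilling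

/-! ### Pointed sets of vectors -/

section Pointed

variable {ι V : Type*} [AddCommGroup V] (wt : ι → V)

/-- A family of vectors is pointed if no nonempty sum of its members vanishes. -/
def Pointed (T : Set ι) : Prop :=
  ∀ s : Multiset ι, (∀ i ∈ s, i ∈ T) → (s.map wt).sum = 0 → s = 0

variable {wt}

/-- If `s ≤ t` have the same sum, then `t - s` has sum zero and is empty. So the multisets form an
antichain in `ℕ^T`, which is finite by Dickson's lemma. -/
lemma Pointed.finite {T : Set ι} (hp : Pointed wt T) (hT : T.Finite) (v : V) :
    {s : Multiset ι | (∀ i ∈ s, i ∈ T) ∧ (s.map wt).sum = v}.Finite := by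
  classical
  have := hT.to_subtype
  let f : Multiset ι → T → ℕ := fun s i => s.count (i : ι)
  set S := {s : Multiset ι | (∀ i ∈ s, i ∈ T) ∧ (s.map wt).sum = v}
  have key : ∀ s ∈ S, ∀ t ∈ S, f s ≤ f t → s = t := by
    intro s hs t ht hst
    have hle : s ≤ t := by
      rw [Multiset.le_iff_count]
      intro i
      by_cases hi : i ∈ T
      · exact hst ⟨i, hi⟩
      · rw [Multiset.count_eq_zero_of_notMem fun h => hi (hs.1 i h)]
        exact Nat.zero_le _
    obtain ⟨w, rfl⟩ := Multiset.le_iff_exists_add.1 hle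
    have hw : w = 0 := by
      refine hp w (fun i hi => ht.1 i (by simp [hi])) ?_
      have h1 := ht.2
      rw [Multiset.map_add, Multiset.sum_add, hs.2] at h1
      simpa using h1
    simp [hw]
  have hanti : IsAntichain (· ≤ ·) (f '' S) := by
    rintro _ ⟨s, hs, rfl⟩ _ ⟨t, ht, rfl⟩ hne hle
    exact hne (by rw [key s hs t ht hle])
  have hfin : (f '' S).Finite := WellQuasiOrderedLE.finite_of_isAntichain hanti
  exact Set.Finite.of_finite_image hfin fun s hs t ht h => key s hs t ht (le_of_eq h)

end Pointed

/-! ### The roots of a Borel subalgebra -/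

section Borel

variable {g : Type u} [LieRing g] [LieAlgebra ℂ g] [FiniteDimensional ℂ g] [LieAlgebra.IsKilling ℂ g]
variable {h : LieSubalgebra ℂ g} [h.IsCartanSubalgebra] {b : LieSubalgebra ℂ g}

/-- A root as a weight. -/
def wtOfRoot {α : Module.Dual ℂ h} (hα : α ∈ finRoots h) : Weight ℂ h g := ⟨α, hα.2⟩

lemma wtOfRoot_isNonZero {α : Module.Dual ℂ h} (hα : α ∈ finRoots h) : (wtOfRoot hα).IsNonZero := by
  intro h0
  apply hα.1
  ext x
  exact congrFun h0 x

lemma mem_finRoots_of_ne_zero {α : Module.Dual ℂ h} (hα : α ≠ 0) {x : g} (hx : x ∈ rootSpace h α)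
    (hx0 : x ≠ 0) : α ∈ finRoots h :=
  ⟨hα, fun h0 => hx0 (by rw [h0] at hx; simpa using hx)⟩

lemma exists_smul_of_mem_rootSpace {α : Module.Dual ℂ h} (hα : α ∈ finRoots h) {x y : g}
    (hx : x ∈ rootSpace h α) (hx0 : x ≠ 0) (hy : y ∈ rootSpace h α) : ∃ c : ℂ, c • x = y := by
  have h1 := finrank_rootSpace_eq_one (wtOfRoot hα) (wtOfRoot_isNonZero hα)
  obtain ⟨c, hc⟩ := (finrank_eq_one_iff_of_nonzero' (⟨x, hx⟩ : rootSpace h α)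
    (by simpa using hx0)).1 h1 ⟨y, hy⟩
  exact ⟨c, congrArg Subtype.val hc⟩

lemma mem_finPosRoots_of_mem {α : Module.Dual ℂ h} (hα : α ≠ 0) {x : g} (hx : x ∈ rootSpace h α)
    (hx0 : x ≠ 0) (hxb : x ∈ b) : α ∈ finPosRoots h b := by
  have hr := mem_finRoots_of_ne_zero hα hx hx0
  refine ⟨hr, fun y hy => ?_⟩
  obtain ⟨c, rfl⟩ := exists_smul_of_mem_rootSpace hr hx hx0 hy
  exact b.smul_mem c hxb

/-- Otherwise `b` contains an `sl₂`-triple, and the triple survives in every term of the derived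
series. -/
lemma neg_notMem_finPosRoots [LieAlgebra.IsSolvable b] {α : Module.Dual ℂ h}
    (hα : α ∈ finPosRoots h b) : -α ∉ finPosRoots h b := by
  intro hα'
  obtain ⟨k, e, f, ht, he, hf⟩ :=
    exists_isSl2Triple_of_weight_isNonZero (wtOfRoot_isNonZero hα.1)
  have he' : e ∈ b := hα.2 e he
  have hf' : f ∈ b := hα'.2 f hf
  have hk' : k ∈ b := ht.lie_e_f ▸ b.lie_mem he' hf'
  have key : ∀ n, (⟨e, he'⟩ : b) ∈ derivedSeries ℂ b n ∧ (⟨f, hf'⟩ : b) ∈ derivedSeries ℂ b n ∧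
      (⟨k, hk'⟩ : b) ∈ derivedSeries ℂ b n := by
    intro n
    induction n with
    | zero => simp
    | succ n ih =>
      obtain ⟨h1, h2, h3⟩ := ih
      have e1 : ⁅(⟨k, hk'⟩ : b), (⟨e, he'⟩ : b)⁆ = (2 : ℂ) • ⟨e, he'⟩ :=
        Subtype.ext (ht.lie_h_e_smul ℂ)
      have e2 : ⁅(⟨k, hk'⟩ : b), (⟨f, hf'⟩ : b)⁆ = -((2 : ℂ) • ⟨f, hf'⟩) :=
        Subtype.ext (ht.lie_lie_smul_f ℂ)
      have e3 : ⁅(⟨e, he'⟩ : b), (⟨f, hf'⟩ : b)⁆ = ⟨k, hk'⟩ := Subtype.ext ht.lie_e_f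
      rw [derivedSeries_def, derivedSeriesOfIdeal_succ, ← derivedSeries_def]
      have m1 := LieSubmodule.lie_mem_lie h3 h1
      have m2 := LieSubmodule.lie_mem_lie h3 h2
      have m3 := LieSubmodule.lie_mem_lie h1 h2
      rw [e1] at m1; rw [e2] at m2; rw [e3] at m3
      refine ⟨?_, ?_, m3⟩
      · simpa using Submodule.smul_mem _ (2⁻¹ : ℂ) m1
      · simpa using Submodule.smul_mem _ (-2⁻¹ : ℂ) m2
  obtain ⟨n, hn⟩ := LieAlgebra.IsSolvable.solvable ℂ (L := b)
  have := (key n).1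
  rw [hn] at this
  exact ht.e_ne_zero (congrArg Subtype.val ((LieSubmodule.mem_bot _).1 this))

/-- Root vectors of `α` and `β` have a nonzero bracket if `α + β` is a weight. -/
lemma exists_lie_ne_zero {α β : Weight ℂ h g} (hα : α.IsNonZero)
    (h1 : rootSpace h ((α : h → ℂ) + β) ≠ ⊥) :
    ∃ x ∈ rootSpace h α, ∃ y ∈ rootSpace h β, ⁅x, y⁆ ≠ 0 := by
  obtain ⟨x, hx, hx0⟩ := (chainTop α β).exists_ne_zero
  obtain ⟨k, e, f, ht, he, hf⟩ := exists_isSl2Triple_of_weight_isNonZero hα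
  obtain rfl := ht.h_eq_coroot hα he hf
  have prim : ht.HasPrimitiveVectorWith x (chainLength α β : ℂ) :=
    have := lie_mem_genWeightSpace_of_mem_genWeightSpace he hx
    ⟨hx0, (chainLength_smul _ _ hx).symm, by rwa [genWeightSpace_add_chainTop _ _ hα] at this⟩
  have htop : 1 ≤ chainTopCoeff α β := by
    have := (rootSpace_zsmul_add_ne_bot_iff α β hα 1).1 (by simpa using h1)
    exact_mod_cast this.1
  obtain ⟨p, hp⟩ := Nat.exists_eq_add_of_le' htop
  have hle := chainTopCoeff_le_chainLength α β
  refine ⟨e, he, ((toEnd ℂ g g f) ^ (p + 1)) x, ?_, ?_⟩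
  · have := toEnd_pow_apply_mem hf hx (p + 1)
    convert this using 2
    rw [coe_chainTop, ← hp]
    ext y
    simp
  · rw [prim.lie_e_pow_succ_toEnd_f]
    refine smul_ne_zero (mul_ne_zero (by exact_mod_cast Nat.succ_ne_zero p) ?_)
      (prim.pow_toEnd_f_ne_zero_of_eq_nat rfl (by omega))
    rw [sub_ne_zero]
    exact_mod_cast (show chainLength α β ≠ p by omega)

/-- Induction on the number of summands: in a vanishing sum some pair `α`, `β` has a sum that is
again a positive root, and replacing the pair by `α + β` gives a shorter vanishing sum. -/
lemma pointed_finPosRoots [LieAlgebra.IsSolvable b] : Pointed id (finPosRoots h b) := by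
  intro s
  induction hn : s.card using Nat.strong_induction_on generalizing s with
  | _ n ih =>
    intro hs hsum
    by_contra hs0
    obtain ⟨α, hαs⟩ := Multiset.exists_mem_of_ne_zero hs0
    obtain ⟨t, rfl⟩ := Multiset.exists_cons_of_mem hαs
    have hα := hs α (by simp)
    set a := wtOfRoot hα.1
    have ha := wtOfRoot_isNonZero hα.1
    have h2 : α (coroot a) = 2 := root_apply_coroot ha
    -- Pairing the vanishing sum with the coroot of `α` gives `2` plus the integer pairings of the
    -- members of `t`; one of them must be negative.
    have hex : ∃ β ∈ t, ∃ z : ℤ, z < 0 ∧ β (coroot a) = z := by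
      by_contra! hcon
      have hnn : ∀ t' : Multiset (Module.Dual ℂ h), t' ≤ t →
          ∃ m : ℕ, t'.sum (coroot a) = m := by
        intro t'
        induction t' using Multiset.induction with
        | empty => exact fun _ => ⟨0, by simp⟩
        | cons β t' ih' =>
          intro hle
          obtain ⟨m, hm⟩ := ih' ((Multiset.le_cons_self _ _).trans hle)
          have hβt : β ∈ t := Multiset.mem_of_le hle (by simp)
          have hβ := (hs β (by simp [hβt])).1
          have hint : β (coroot a) =
              ((chainBotCoeff a (wtOfRoot hβ) - chainTopCoeff a (wtOfRoot hβ) : ℤ) : ℂ) :=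
            apply_coroot_eq_cast a (wtOfRoot hβ)
          have hz : ¬ ((chainBotCoeff a (wtOfRoot hβ) - chainTopCoeff a (wtOfRoot hβ) : ℤ) < 0) :=
            fun hlt => hcon β hβt _ hlt hint
          obtain ⟨z, hz'⟩ := Int.eq_ofNat_of_zero_le (not_lt.1 hz)
          refine ⟨z + m, ?_⟩
          rw [Multiset.sum_cons, LinearMap.add_apply, hm, hint, hz']
          push_cast; rfl
      obtain ⟨m, hm⟩ := hnn t le_rfl
      have := LinearMap.congr_fun hsum (coroot a)
      simp only [Multiset.map_id, Multiset.sum_cons, LinearMap.add_apply, h2, hm,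
        LinearMap.zero_apply] at this
      exact absurd this (by exact_mod_cast (show (2 + m) ≠ 0 by omega))
    obtain ⟨β, hβt, z, hz, hβz⟩ := hex
    obtain ⟨t, rfl⟩ := Multiset.exists_cons_of_mem hβt
    have hβ := hs β (by simp)
    have hint : β (coroot a) = ((chainBotCoeff a (wtOfRoot hβ.1) -
        chainTopCoeff a (wtOfRoot hβ.1) : ℤ) : ℂ) := apply_coroot_eq_cast a (wtOfRoot hβ.1)
    rw [hβz, Int.cast_inj] at hint
    -- A negative pairing means that the `α`-string through `β` reaches further up than down, so `α
    -- + β` is a weight.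
    have hne : rootSpace h ((a : h → ℂ) + wtOfRoot hβ.1) ≠ ⊥ := by
      have := (rootSpace_zsmul_add_ne_bot_iff a (wtOfRoot hβ.1) ha 1).2 (by omega)
      simpa using this
    have hab : α + β ≠ 0 := by
      intro h0
      have : β = -α := (neg_eq_of_add_eq_zero_right h0).symm
      exact neg_notMem_finPosRoots hα (this ▸ hβ)
    obtain ⟨x, hx, y, hy, hxy⟩ := exists_lie_ne_zero ha hne
    have hmem : α + β ∈ finPosRoots h b :=
      mem_finPosRoots_of_mem hab (lie_mem_genWeightSpace_of_mem_genWeightSpace hx hy) hxy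
        (b.lie_mem (hα.2 x hx) (hβ.2 y hy))
    have := ih (t.card + 1) (by simp [← hn]) ((α + β) ::ₘ t) (by simp) ?_ ?_
    · simp at this
    · intro i hi
      rcases Multiset.mem_cons.1 hi with rfl | hi
      · exact hmem
      · exact hs i (by simp [hi])
    · simpa [add_assoc] using hsum

/-- The sum of the root spaces for all sums of at least `n` elements of `T`. -/
def sumSpace (h : LieSubalgebra ℂ g) [h.IsCartanSubalgebra] (T : Set (Module.Dual ℂ h)) (n : ℕ) :
    Submodule ℂ g :=
  ⨆ s : {s : Multiset (Module.Dual ℂ h) // (∀ α ∈ s, α ∈ T) ∧ n ≤ s.card},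
    (rootSpace h (s.1.sum : Module.Dual ℂ h)).toSubmodule

variable {T : Set (Module.Dual ℂ h)}

lemma rootSpace_le_sumSpace {n : ℕ} (s : Multiset (Module.Dual ℂ h)) (hs : ∀ α ∈ s, α ∈ T)
    (hn : n ≤ s.card) {x : g} (hx : x ∈ rootSpace h (s.sum : Module.Dual ℂ h)) :
    x ∈ sumSpace h T n :=
  (le_iSup (fun s : {s : Multiset (Module.Dual ℂ h) // (∀ α ∈ s, α ∈ T) ∧ n ≤ s.card} =>
    (rootSpace h (s.1.sum : Module.Dual ℂ h)).toSubmodule) ⟨s, hs, hn⟩) hx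

lemma sumSpace_anti {m n : ℕ} (hmn : m ≤ n) : sumSpace h T n ≤ sumSpace h T m := by
  refine iSup_le fun s x hx => ?_
  exact rootSpace_le_sumSpace s.1 s.2.1 (hmn.trans s.2.2) hx

lemma sumSpace_lie {P : g → Prop} (hadd : ∀ x y, P x → P y → P (x + y)) (h0 : P 0) {m n : ℕ}
    (hP : ∀ s t : Multiset (Module.Dual ℂ h), (∀ α ∈ s, α ∈ T) → (∀ α ∈ t, α ∈ T) → m ≤ s.card →
      n ≤ t.card → ∀ x ∈ rootSpace h (s.sum : Module.Dual ℂ h),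
      ∀ y ∈ rootSpace h (t.sum : Module.Dual ℂ h), P ⁅x, y⁆)
    {x y : g} (hx : x ∈ sumSpace h T m) (hy : y ∈ sumSpace h T n) : P ⁅x, y⁆ := by
  refine Submodule.iSup_induction (motive := fun x => P ⁅x, y⁆) _ hx ?_ (by simpa using h0) ?_
  · intro s x hx
    refine Submodule.iSup_induction (motive := fun y => P ⁅x, y⁆) _ hy ?_ (by simpa using h0) ?_
    · intro t y hy
      exact hP s.1 t.1 s.2.1 t.2.1 s.2.2 t.2.2 x hx y hy
    · intro y y' h1 h2
      rw [lie_add]; exact hadd _ _ h1 h2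
  · intro y y' h1 h2
    rw [add_lie]; exact hadd _ _ h1 h2

lemma lie_mem_rootSpace_add {α β : Module.Dual ℂ h} {x y : g} (hx : x ∈ rootSpace h α)
    (hy : y ∈ rootSpace h β) : ⁅x, y⁆ ∈ rootSpace h (α + β : Module.Dual ℂ h) :=
  lie_mem_genWeightSpace_of_mem_genWeightSpace hx hy

lemma lie_mem_sumSpace {m n : ℕ} {x y : g} (hx : x ∈ sumSpace h T m) (hy : y ∈ sumSpace h T n) :
    ⁅x, y⁆ ∈ sumSpace h T (m + n) := by
  refine sumSpace_lie (P := fun z => z ∈ sumSpace h T (m + n)) (fun _ _ => add_mem) (zero_mem _)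
    ?_ hx hy
  intro s t hs ht hm hn x hx y hy
  refine rootSpace_le_sumSpace (s + t) ?_ (by simp; omega) ?_
  · intro α hα
    rcases Multiset.mem_add.1 hα with hα | hα
    · exact hs α hα
    · exact ht α hα
  · rw [Multiset.sum_add]
    exact lie_mem_rootSpace_add hx hy

lemma mem_cartan_iff {x : g} : x ∈ h ↔ x ∈ rootSpace h (0 : Module.Dual ℂ h) := by
  have h1 : ((0 : Module.Dual ℂ h) : h → ℂ) = 0 := rfl
  rw [h1, rootSpace_zero_eq]
  rfl

lemma lie_eq_zero_of_mem_cartan {x y : g} (hx : x ∈ h) (hy : y ∈ h) : ⁅x, y⁆ = 0 :=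
  congrArg Subtype.val (trivial_lie_zero h h ⟨x, hx⟩ ⟨y, hy⟩)

/-- Only the contribution of two empty multisets could stay in degree zero, and it vanishes because
the Cartan subalgebra is abelian. -/
lemma lie_mem_sumSpace_one {x y : g} (hx : x ∈ sumSpace h T 0) (hy : y ∈ sumSpace h T 0) :
    ⁅x, y⁆ ∈ sumSpace h T 1 := by
  refine sumSpace_lie (P := fun z => z ∈ sumSpace h T 1) (fun _ _ => add_mem) (zero_mem _)
    ?_ hx hy
  intro s t hs ht hm hn x hx y hy
  by_cases h0 : s = 0 ∧ t = 0
  · obtain ⟨rfl, rfl⟩ := h0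
    rw [lie_eq_zero_of_mem_cartan (mem_cartan_iff.2 hx) (mem_cartan_iff.2 hy)]
    exact zero_mem _
  refine rootSpace_le_sumSpace (s + t) ?_ ?_ ?_
  · intro α hα
    rcases Multiset.mem_add.1 hα with hα | hα
    · exact hs α hα
    · exact ht α hα
  · rw [Nat.one_le_iff_ne_zero, Ne, Multiset.card_eq_zero, add_eq_zero]
    exact h0
  · rw [Multiset.sum_add]
    exact lie_mem_rootSpace_add hx hy

lemma finite_weights : {α : Module.Dual ℂ h | rootSpace h α ≠ ⊥}.Finite :=
  (finite_genWeightSpace_ne_bot ℂ h g).preimage DFunLike.coe_injective.injOn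

lemma finite_finRoots : (finRoots h).Finite := finite_weights.subset fun _ hα => hα.2

/-- There are finitely many weights, and by `Pointed.finite` each is a sum of elements of `T` in
finitely many ways, so the number of summands is bounded. -/
lemma exists_sumSpace_eq_bot (hT : T.Finite) (hp : Pointed id T) : ∃ n, sumSpace h T n = ⊥ := by
  have hfin : (⋃ α ∈ {α : Module.Dual ℂ h | rootSpace h α ≠ ⊥},
      {s : Multiset (Module.Dual ℂ h) | (∀ i ∈ s, i ∈ T) ∧ (s.map id).sum = α}).Finite :=
    finite_weights.biUnion fun α _ => hp.finite hT α
  obtain ⟨n, hn⟩ := (hfin.image Multiset.card).bddAbove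
  refine ⟨n + 1, ?_⟩
  rw [sumSpace, iSup_eq_bot]
  rintro ⟨s, hs, hcard⟩
  by_contra hne
  have : s.card ≤ n := hn ⟨s, by
    simp only [Set.mem_iUnion]
    refine ⟨s.sum, fun h0 => hne ?_, hs, by simp⟩
    simp only [h0]; rfl, rfl⟩
  omega

attribute [irreducible] sumSpace

/-- The subalgebra with the weights `0` and all sums of elements of `T`. -/
def sumAlg (h : LieSubalgebra ℂ g) [h.IsCartanSubalgebra] (T : Set (Module.Dual ℂ h)) :
    LieSubalgebra ℂ g where
  toSubmodule := sumSpace h T 0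
  lie_mem' {x y} hx hy := by
    have hx' : x ∈ sumSpace h T 0 := hx
    have hy' : y ∈ sumSpace h T 0 := hy
    exact lie_mem_sumSpace hx' hy'

/-- The `n`-th derived algebra lies in `sumSpace h T n`: the first step is `lie_mem_sumSpace_one`,
and afterwards `n + n ≥ n + 1`. -/
lemma isSolvable_sumAlg (hT : T.Finite) (hp : Pointed id T) :
    LieAlgebra.IsSolvable (sumAlg h T) := by
  have key : ∀ n, ∀ x ∈ derivedSeries ℂ (sumAlg h T) n, (x : g) ∈ sumSpace h T n := by
    intro n
    induction n with
    | zero => exact fun x _ => x.2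
    | succ n ih =>
      intro x hx
      rw [derivedSeries_def, derivedSeriesOfIdeal_succ, ← derivedSeries_def,
        ← LieSubmodule.mem_toSubmodule, LieSubmodule.lieIdeal_oper_eq_linear_span'] at hx
      induction hx using Submodule.span_induction with
      | mem x hx =>
        obtain ⟨y, hy, z, hz, rfl⟩ := hx
        rcases Nat.eq_zero_or_pos n with rfl | hn
        · exact lie_mem_sumSpace_one y.2 z.2
        · exact sumSpace_anti (by omega) (lie_mem_sumSpace (ih y hy) (ih z hz))
      | zero => exact zero_mem _
      | add x y _ _ hx hy => exact add_mem hx hy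
      | smul c x _ hx => exact Submodule.smul_mem _ c hx
  obtain ⟨n, hn⟩ := exists_sumSpace_eq_bot hT hp
  refine LieAlgebra.IsSolvable.mk (R := ℂ) (k := n) ?_
  rw [LieSubmodule.eq_bot_iff]
  intro x hx
  have := key n x hx
  rw [hn] at this
  exact Subtype.ext ((Submodule.mem_bot ℂ).1 this)

/-- A subalgebra that contains the Cartan subalgebra is the sum of its weight spaces. -/
lemma le_of_cartan_le (hhb : h ≤ b) {S : Submodule ℂ g} (h0 : ∀ x ∈ h, x ∈ S)
    (h1 : ∀ α ∈ finPosRoots h b, ∀ x ∈ rootSpace h α, x ∈ S) : b.toSubmodule ≤ S := by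
  let N : LieSubmodule ℂ h g :=
    { b.toSubmodule with lie_mem := fun {x m} hm => b.lie_mem (hhb x.2) hm }
  have hN := eq_iSup_inf_genWeightSpace ℂ h g N
  have : N.toSubmodule ≤ S := by
    rw [hN, LieSubmodule.iSup_toSubmodule]
    refine iSup_le fun χ x hx => ?_
    obtain ⟨hxb, hx⟩ := (LieSubmodule.mem_inf _ _ _).1 hx
    by_cases hx0 : x = 0
    · rw [hx0]; exact zero_mem _
    have hx' : x ∈ rootSpace h (χ.toLinear : Module.Dual ℂ h) := hx
    by_cases hχ : (χ.toLinear : Module.Dual ℂ h) = 0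
    · rw [hχ] at hx'
      exact h0 x (mem_cartan_iff.2 hx')
    · exact h1 _ (mem_finPosRoots_of_mem hχ hx' hx0 hxb) x hx'
  exact this

/-- If a root `β` can be adjoined to the positive roots without losing pointedness, then `sumAlg` is
a solvable algebra that contains `b` and the root space of `β`, and maximality of `b` makes `β`
positive. This cannot fail for `α` and for `-α` at once. -/
lemma finPosRoots_or_neg (hb : IsBorel b) (hhb : h ≤ b) {α : Module.Dual ℂ h}
    (hα : α ∈ finRoots h) : α ∈ finPosRoots h b ∨ -α ∈ finPosRoots h b := by
  have hsolv : LieAlgebra.IsSolvable b := hb.1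
  have main : ∀ β : Module.Dual ℂ h, Pointed id (insert β (finPosRoots h b)) →
      β ∈ finRoots h → β ∈ finPosRoots h b := by
    intro β hp hβ
    have hfin : (insert β (finPosRoots h b)).Finite :=
      (finite_finRoots.subset fun _ hα => hα.1).insert β
    have hle : b ≤ sumAlg h (insert β (finPosRoots h b)) := by
      refine le_of_cartan_le hhb (S := sumSpace h _ 0) ?_ ?_
      · intro x hx
        exact rootSpace_le_sumSpace 0 (by simp) (by simp)
          (by rw [Multiset.sum_zero]; exact mem_cartan_iff.1 hx)
      · intro γ hγ x hx
        exact rootSpace_le_sumSpace {γ} (by simp [hγ]) (by simp) (by simpa using hx)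
    have heq := hb.eq_of_le (isSolvable_sumAlg hfin hp) hle
    refine ⟨hβ, fun x hx => ?_⟩
    rw [heq]
    exact rootSpace_le_sumSpace {β} (by simp) (by simp) (by simpa using hx)
  have split : ∀ β : Module.Dual ℂ h, ¬ Pointed id (insert β (finPosRoots h b)) →
      ∃ (n : ℕ) (s : Multiset (Module.Dual ℂ h)), 0 < n ∧ (∀ γ ∈ s, γ ∈ finPosRoots h b) ∧
        n • β + s.sum = 0 := by
    intro β hβ
    simp only [Pointed, not_forall] at hβ
    obtain ⟨s, hs, hsum, hs0⟩ := hβ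
    have hcl : ∀ s : Multiset (Module.Dual ℂ h), (∀ i ∈ s, i ∈ insert β (finPosRoots h b)) →
        ∃ (n : ℕ) (t : Multiset (Module.Dual ℂ h)), (∀ γ ∈ t, γ ∈ finPosRoots h b) ∧
          s = Multiset.replicate n β + t := by
      intro s
      induction s using Multiset.induction with
      | empty => exact fun _ => ⟨0, 0, by simp, by simp⟩
      | cons γ s ih =>
        intro hs
        obtain ⟨n, t, ht, rfl⟩ := ih fun i hi => hs i (by simp [hi])
        rcases hs γ (by simp) with rfl | hγ
        · exact ⟨n + 1, t, ht, by simp [Multiset.replicate_succ]⟩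
        · refine ⟨n, γ ::ₘ t, ?_, by simp⟩
          intro i hi
          rcases Multiset.mem_cons.1 hi with rfl | hi
          · exact hγ
          · exact ht i hi
    obtain ⟨n, t, ht, rfl⟩ := hcl s hs
    refine ⟨n, t, Nat.pos_of_ne_zero ?_, ht, by simpa using hsum⟩
    rintro rfl
    exact hs0 (by simpa using pointed_finPosRoots t ht (by simpa using hsum))
  by_cases h1 : Pointed id (insert α (finPosRoots h b))
  · exact Or.inl (main α h1 hα)
  by_cases h2 : Pointed id (insert (-α) (finPosRoots h b))
  · right
    refine main _ h2 ⟨neg_ne_zero.2 hα.1, ?_⟩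
    exact (-(wtOfRoot hα)).genWeightSpace_ne_bot
  exfalso
  obtain ⟨n, s, hn, hs, hns⟩ := split α h1
  obtain ⟨m, t, hm, ht, hmt⟩ := split (-α) h2
  -- Eliminating `α` from `n α + ∑ s = 0` and `-m α + ∑ t = 0` leaves a vanishing sum of positive
  -- roots.
  have hmem : ∀ i ∈ m • s + n • t, i ∈ finPosRoots h b := by
    intro i hi
    rcases Multiset.mem_add.1 hi with hi | hi
    · exact hs i (Multiset.mem_of_mem_nsmul hi)
    · exact ht i (Multiset.mem_of_mem_nsmul hi)
  have hsum : ((m • s + n • t).map id).sum = 0 := by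
    rw [Multiset.map_id, Multiset.sum_add, Multiset.sum_nsmul, Multiset.sum_nsmul]
    have e1 := congrArg (m • ·) hns
    have e2 := congrArg (n • ·) hmt
    simp only [smul_add, smul_neg, smul_zero, smul_smul] at e1 e2
    rw [mul_comm n m] at e2
    have := congrArg₂ (· + ·) e1 e2
    simp only [add_zero] at this
    rw [← this]; abel
  have h0 := pointed_finPosRoots _ hmem hsum
  have hs0 : s = 0 := by
    rw [← Multiset.card_eq_zero] at h0 ⊢
    simp only [Multiset.card_add, Multiset.card_nsmul] at h0
    have := (Nat.add_eq_zero_iff.1 h0).1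
    exact (Nat.mul_eq_zero.1 this).resolve_left hm.ne'
  rw [hs0, Multiset.sum_zero, add_zero] at hns
  exact hα.1 ((smul_eq_zero.1 hns).resolve_left hn.ne')

end Borel

end AffineO

end

noncomputable section

set_option linter.unusedSectionVars false

namespace AffineO

open LieAlgebra LieModule LieAlgebra.IsKilling

/-! ### Positive affine roots -/

section PosRoots

variable {g : Type u} [LieRing g] [LieAlgebra ℂ g] [FiniteDimensional ℂ g] [LieAlgebra.IsKilling ℂ g]
variable {h : LieSubalgebra ℂ g} [h.IsCartanSubalgebra] {b : LieSubalgebra ℂ g}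

lemma finToAff_apply (α : Module.Dual ℂ h) (H : AffCartan h) : finToAff h α H = α H.1 := rfl

lemma delta_apply (H : AffCartan h) : delta h H = H.2.2 := rfl

/-- The degree of a weight: its value at `D`. -/
def deg (γ : Wt h) : ℂ := γ (0, 0, 1)

lemma deg_finToAff (α : Module.Dual ℂ h) : deg (finToAff h α) = 0 := by
  simp [deg, finToAff_apply]

lemma deg_delta : deg (delta h) = 1 := rfl

lemma deg_add (γ γ' : Wt h) : deg (γ + γ') = deg γ + deg γ' := rfl

lemma deg_nsmul (n : ℕ) (γ : Wt h) : deg (n • γ) = n * deg γ := by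
  simp [deg]

lemma affPosRoots_cases {γ : Wt h} (hγ : γ ∈ affPosRoots h b) :
    γ ∈ finToAff h '' finPosRoots h b ∨ ∃ n : ℕ, 0 < n ∧ deg γ = n := by
  rcases hγ with (hγ | ⟨α, hα, n, hn, rfl⟩) | ⟨n, hn, rfl⟩
  · exact Or.inl hγ
  · exact Or.inr ⟨n, hn, by simp [deg_add, deg_finToAff, deg_nsmul, deg_delta]⟩
  · exact Or.inr ⟨n, hn, by simp [deg_nsmul, deg_delta]⟩

lemma exists_deg {γ : Wt h} (hγ : γ ∈ affPosRoots h b) : ∃ n : ℕ, deg γ = n := by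
  rcases affPosRoots_cases hγ with ⟨α, -, rfl⟩ | ⟨n, -, hn⟩
  · exact ⟨0, by simp [deg_finToAff]⟩
  · exact ⟨n, hn⟩

lemma exists_deg_sum (s : Multiset (Wt h)) (hs : ∀ γ ∈ s, γ ∈ affPosRoots h b) :
    ∃ n : ℕ, deg s.sum = n ∧ ∀ γ ∈ s, ∃ m ≤ n, deg γ = m := by
  induction s using Multiset.induction with
  | empty => exact ⟨0, by simp [deg], by simp⟩
  | cons γ s ih =>
    obtain ⟨n, hn, hall⟩ := ih fun γ hγ => hs γ (by simp [hγ])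
    obtain ⟨m, hm⟩ := exists_deg (hs γ (by simp))
    refine ⟨m + n, by simp [deg_add, hn, hm], fun γ' hγ' => ?_⟩
    rcases Multiset.mem_cons.1 hγ' with rfl | hγ'
    · exact ⟨m, by omega, hm⟩
    · obtain ⟨k, hk, hk'⟩ := hall γ' hγ'
      exact ⟨k, by omega, hk'⟩

lemma finToAff_injective : Function.Injective (finToAff h) := by
  intro α β hαβ
  ext x
  exact LinearMap.congr_fun hαβ (x, 0, 0)

lemma finToAff_zero : finToAff h 0 = 0 := rfl

/-- Degrees of positive affine roots are nonnegative, so a vanishing sum has only members of degree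
zero. These come from positive roots of `g`, where `pointed_finPosRoots` applies. -/
lemma pointed_affPosRoots [LieAlgebra.IsSolvable b] : Pointed id (affPosRoots h b) := by
  intro s hs hsum
  rw [Multiset.map_id] at hsum
  obtain ⟨n, hn, hall⟩ := exists_deg_sum s hs
  have hn0 : n = 0 := by
    rw [hsum] at hn
    have : (n : ℂ) = 0 := by rw [← hn]; rfl
    exact_mod_cast this
  have hfin : ∀ γ ∈ s, γ ∈ finToAff h '' finPosRoots h b := by
    intro γ hγ
    obtain ⟨m, hm, hm'⟩ := hall γ hγ
    rcases affPosRoots_cases (hs γ hγ) with hγ' | ⟨k, hk, hk'⟩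
    · exact hγ'
    · rw [hm', Nat.cast_inj] at hk'
      omega
  have hlift : ∃ t : Multiset (Module.Dual ℂ h), (∀ α ∈ t, α ∈ finPosRoots h b) ∧
      t.map (finToAff h) = s := by
    clear hsum hall hn hs
    induction s using Multiset.induction with
    | empty => exact ⟨0, by simp, by simp⟩
    | cons γ s ih =>
      obtain ⟨t, ht, rfl⟩ := ih fun γ hγ => hfin γ (by simp [hγ])
      obtain ⟨α, hα, rfl⟩ := hfin γ (by simp)
      refine ⟨α ::ₘ t, ?_, by simp⟩
      intro i hi
      rcases Multiset.mem_cons.1 hi with rfl | hi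
      · exact hα
      · exact ht i hi
  obtain ⟨t, ht, rfl⟩ := hlift
  have : finToAff h t.sum = 0 := by
    rw [← hsum]
    exact map_multiset_sum (AddMonoidHom.mk' (finToAff h) fun _ _ => rfl) t
  have h0 : t.sum = 0 := finToAff_injective this
  rw [pointed_finPosRoots t ht (by rw [Multiset.map_id, h0])]
  rfl

lemma finite_affPosRoots_deg (d : ℕ) :
    {γ | γ ∈ affPosRoots h b ∧ ∃ m ≤ d, deg γ = (m : ℂ)}.Finite := by
  have hP : (finToAff h '' finPosRoots h b).Finite :=
    (finite_finRoots.subset fun _ hα => hα.1).image _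
  have h1 : (Set.image2 (fun (α : Module.Dual ℂ h) (n : ℕ) => finToAff h α + n • delta h)
    (finRoots h) (Set.Iic d)).Finite := finite_finRoots.image2 _ (Set.finite_Iic d)
  have h2 : ((fun n : ℕ => n • delta h) '' (Set.Iic d)).Finite := (Set.finite_Iic d).image _
  refine ((hP.union h1).union h2).subset ?_
  rintro γ ⟨(hγ | ⟨α, hα, n, hn, rfl⟩) | ⟨n, hn, rfl⟩, m, hm, hdeg⟩
  · exact Or.inl (Or.inl hγ)
  · refine Or.inl (Or.inr ⟨α, hα, n, ?_, rfl⟩)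
    simp only [deg_add, deg_finToAff, deg_nsmul, deg_delta, zero_add, mul_one, Nat.cast_inj] at hdeg
    exact hdeg ▸ hm
  · refine Or.inr ⟨n, ?_, rfl⟩
    simp only [deg_nsmul, deg_delta, mul_one, Nat.cast_inj] at hdeg
    exact hdeg ▸ hm

/-- There are finitely many ways to write a weight as a sum of positive affine roots. -/
lemma finite_sums [LieAlgebra.IsSolvable b] {ι : Type*} (w : ι → Wt h) (T : Set ι)
    (hT : ∀ i ∈ T, w i ∈ affPosRoots h b) (hf : ∀ γ, {i | i ∈ T ∧ w i = γ}.Finite) (v : Wt h) :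
    {s : Multiset ι | (∀ i ∈ s, i ∈ T) ∧ (s.map w).sum = v}.Finite := by
  rcases Set.eq_empty_or_nonempty {s : Multiset ι | (∀ i ∈ s, i ∈ T) ∧ (s.map w).sum = v}
    with h0 | ⟨s₀, hs₀, hv⟩
  · rw [h0]; exact Set.finite_empty
  have hw : ∀ s : Multiset ι, (∀ i ∈ s, i ∈ T) → ∀ γ ∈ s.map w, γ ∈ affPosRoots h b := by
    intro s hs γ hγ
    obtain ⟨i, hi, rfl⟩ := Multiset.mem_map.1 hγ
    exact hT i (hs i hi)
  obtain ⟨d, hd, -⟩ := exists_deg_sum _ (hw s₀ hs₀)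
  rw [hv] at hd
  -- No member of a sum has larger degree than the total `v`, so only the finitely many indices of
  -- degree at most `d` can occur.
  set T' : Set ι := {i | i ∈ T ∧ w i ∈ {γ | γ ∈ affPosRoots h b ∧ ∃ m ≤ d, deg γ = (m : ℂ)}}
  have hT' : T'.Finite := by
    refine ((finite_affPosRoots_deg (h := h) (b := b) d).biUnion fun γ _ => hf γ).subset ?_
    rintro i ⟨hi, hi'⟩
    exact Set.mem_biUnion hi' ⟨hi, rfl⟩
  have hp : Pointed w T' := by
    intro s hs hsum
    have := pointed_affPosRoots (s.map w) (hw s fun i hi => (hs i hi).1) (by simpa using hsum)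
    simpa using this
  refine (hp.finite hT' v).subset ?_
  rintro s ⟨hs, hsv⟩
  refine ⟨fun i hi => ⟨hs i hi, hT i (hs i hi), ?_⟩, hsv⟩
  obtain ⟨n, hn, hall⟩ := exists_deg_sum _ (hw s hs)
  rw [hsv, hd, Nat.cast_inj] at hn
  subst hn
  exact hall _ (Multiset.mem_map_of_mem _ hi)

lemma WtLE.refl (μ : Wt h) : WtLE h b μ μ := by simp [WtLE]

lemma WtLE.trans {μ ν γ : Wt h} (h1 : WtLE h b μ ν) (h2 : WtLE h b ν γ) : WtLE h b μ γ := by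
  unfold WtLE at *
  have := add_mem h2 h1
  rwa [sub_add_sub_cancel] at this

lemma exists_multiset_of_wtLE {μ ν : Wt h} (h1 : WtLE h b μ ν) :
    ∃ s : Multiset (Wt h), (∀ γ ∈ s, γ ∈ affPosRoots h b) ∧ s.sum = ν - μ :=
  AddSubmonoid.exists_multiset_of_mem_closure h1

lemma WtLE.antisymm [LieAlgebra.IsSolvable b] {μ ν : Wt h} (h1 : WtLE h b μ ν)
    (h2 : WtLE h b ν μ) : μ = ν := by
  obtain ⟨s, hs, hs'⟩ := exists_multiset_of_wtLE h1
  obtain ⟨t, ht, ht'⟩ := exists_multiset_of_wtLE h2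
  have := pointed_affPosRoots (s + t) (fun γ hγ => (Multiset.mem_add.1 hγ).elim (hs γ) (ht γ))
    (by simp [hs', ht'])
  rw [add_eq_zero] at this
  rw [this.1, Multiset.sum_zero] at hs'
  exact (sub_eq_zero.1 hs'.symm).symm

/-- A weight between `μ` and `ν` is `μ` plus the sum of a submultiset of one of the finitely many
multisets of positive roots with sum `ν - μ`. -/
lemma finite_interval [LieAlgebra.IsSolvable b] (μ ν : Wt h) :
    {γ | WtLE h b μ γ ∧ WtLE h b γ ν}.Finite := by
  classical
  have hfin := finite_sums (b := b) (id : Wt h → Wt h) (affPosRoots h b) (fun _ hi => hi)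
    (fun γ => (Set.finite_singleton γ).subset fun _ hi => hi.2) (ν - μ)
  refine (hfin.biUnion fun s _ => (s.powerset.toFinset.finite_toSet.image fun t => μ + t.sum)).subset
    ?_
  rintro γ ⟨h1, h2⟩
  obtain ⟨s, hs, hs'⟩ := exists_multiset_of_wtLE h1
  obtain ⟨t, ht, ht'⟩ := exists_multiset_of_wtLE h2
  refine Set.mem_biUnion (x := s + t)
    ⟨fun γ hγ => (Multiset.mem_add.1 hγ).elim (hs γ) (ht γ), by simp [hs', ht']⟩ ⟨s, ?_, ?_⟩
  · simp
  · simp [hs']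

end PosRoots

/-! ### A triangular basis of the affine Kac-Moody algebra -/

section TriBasis

variable {g : Type u} [LieRing g] [LieAlgebra ℂ g]

/-- A totally ordered basis of `ĝ` by root vectors in which the negative root vectors precede the
basis of the Cartan subalgebra and this precedes the positive root vectors. -/
structure TriBasis (h : LieSubalgebra ℂ g) [h.IsCartanSubalgebra] (b : LieSubalgebra ℂ g) where
  /-- the index type -/
  ι : Type u
  /-- its order -/
  order : LinearOrder ι
  /-- the basis -/
  e : Module.Basis ι ℂ (AffineLie g)
  /-- the weights of the basis vectors -/
  wt : ι → Wt h
  /-- the signs of the basis vectors -/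
  sgn : ι → SignType
  sgn_mono : ∀ i j, i ≤ j → sgn i ≤ sgn j
  lie_cartan : ∀ H i, ⁅cartanIncl h H, e i⁆ = wt i H • e i
  wt_pos : ∀ i, sgn i = 1 → wt i ∈ affPosRoots h b
  wt_neg : ∀ i, sgn i = -1 → -wt i ∈ affPosRoots h b
  wt_zero : ∀ i, sgn i = 0 → wt i = 0
  finite_fiber : ∀ γ ≠ 0, {i | wt i = γ}.Finite
  cartan_repr : ∀ H i, sgn i ≠ 0 → e.repr (cartanIncl h H) i = 0
  exists_cartan : ∀ i, sgn i = 0 → ∃ H, e i = cartanIncl h H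
  borel_repr : ∀ x ∈ affBorel b, ∀ i, sgn i = -1 → e.repr x i = 0
  mem_borel : ∀ i, sgn i ≠ -1 → e i ∈ affBorel b

attribute [instance] TriBasis.order

/-- `ĝ` as a product of vector spaces. -/
def AffineLie.linProd : AffineLie g ≃ₗ[ℂ] Loop g × ℂ × ℂ :=
  { AffineLie.toProd with
    map_add' := fun _ _ => rfl
    map_smul' := fun _ _ => rfl }

variable [FiniteDimensional ℂ g] [LieAlgebra.IsKilling ℂ g]
variable (h : LieSubalgebra ℂ g) [h.IsCartanSubalgebra] (b : LieSubalgebra ℂ g)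

lemma exists_weight_basis : ∃ (κ : Type u) (_ : Finite κ) (v : Module.Basis κ ℂ g)
    (α : κ → Module.Dual ℂ h), ∀ i, rootSpace h (α i) ≠ ⊥ ∧ v i ∈ rootSpace h (α i) := by
  classical
  let A : Weight ℂ h g → Submodule ℂ g := fun χ => (rootSpace h χ).toSubmodule
  have hA : DirectSum.IsInternal A := by
    rw [DirectSum.isInternal_submodule_iff_iSupIndep_and_iSup_eq_top]
    refine ⟨LieSubmodule.iSupIndep_toSubmodule.2 (iSupIndep_genWeightSpace' ℂ h g), ?_⟩
    rw [← LieSubmodule.iSup_toSubmodule, iSup_genWeightSpace_eq_top' ℂ h g]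
    rfl
  let v := hA.collectedBasis fun χ => Module.finBasis ℂ (A χ)
  let e : (Σ χ : Weight ℂ h g, Fin (Module.finrank ℂ (A χ))) ≃ ULift.{u} (Fin (Fintype.card
    (Σ χ : Weight ℂ h g, Fin (Module.finrank ℂ (A χ))))) := (Fintype.equivFin _).trans Equiv.ulift.symm
  refine ⟨_, inferInstance, v.reindex e, fun i => (e.symm i).1.toLinear, fun i => ?_⟩
  refine ⟨(e.symm i).1.genWeightSpace_ne_bot, ?_⟩
  rw [Module.Basis.reindex_apply]
  exact hA.collectedBasis_mem _ (e.symm i)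

variable {h}

/-- The coordinate functional at `i` is an eigenvector for the Cartan action with eigenvalue `α i`,
so it vanishes on vectors of any other weight. -/
lemma repr_eq_zero_of_mem_rootSpace {κ : Type u} (v : Module.Basis κ ℂ g)
    (α : κ → Module.Dual ℂ h) (hv : ∀ i, v i ∈ rootSpace h (α i)) {β : Module.Dual ℂ h} {x : g}
    (hx : x ∈ rootSpace h β) {i : κ} (hi : α i ≠ β) : v.repr x i = 0 := by
  obtain ⟨H, hH⟩ : ∃ H, α i H ≠ β H := by
    by_contra! hcon
    exact hi (LinearMap.ext hcon)
  have h1 : v.coord i ∘ₗ (LieModule.toEnd ℂ h g H) = (α i H) • v.coord i := by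
    refine v.ext fun j => ?_
    have := lie_eq_smul_of_mem_rootSpace (hv j) H
    simp only [LinearMap.coe_comp, Function.comp_apply, toEnd_apply_apply, LinearMap.smul_apply, this, map_smul]
    by_cases hij : j = i
    · subst hij; rfl
    · simp [Finsupp.single_eq_of_ne (Ne.symm hij)]
  have h2 := LinearMap.congr_fun h1 x
  have := lie_eq_smul_of_mem_rootSpace hx H
  simp only [LinearMap.coe_comp, Function.comp_apply, toEnd_apply_apply, LinearMap.smul_apply, this, map_smul, smul_eq_mul, Module.Basis.coord_apply] at h2
  have h3 : (β H - α i H) * v.repr x i = 0 := by rw [sub_mul, h2, sub_self]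
  exact (mul_eq_zero.1 h3).resolve_left (sub_ne_zero.2 hH.symm)

open Classical in
-- The basis consists of `v i ⊗ tⁿ`, for root vectors and Cartan elements `v i`, together with `K`
-- and `D`.
theorem exists_triBasis (hb : IsBorel b) (hhb : h ≤ b) : Nonempty (TriBasis h b) := by
  obtain ⟨κ, hκ, v, α, hv⟩ := exists_weight_basis h
  let e : Module.Basis ((Σ _ : ℤ, κ) ⊕ (PUnit.{u+1} ⊕ PUnit.{u+1})) ℂ (AffineLie g) :=
    (((Finsupp.basis fun _ : ℤ => v).prod ((Module.Basis.singleton PUnit ℂ).prod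
      (Module.Basis.singleton PUnit ℂ)))).map AffineLie.linProd.symm
  have e1 : ∀ n i, e (Sum.inl ⟨n, i⟩) = ⟨mon n (v i), 0, 0⟩ := by
    intro n i
    simp [e, AffineLie.linProd, AffineLie.toProd]
  have e2 : ∀ i, e (Sum.inr (Sum.inl i)) = ⟨0, 1, 0⟩ := by
    intro i
    simp [e, AffineLie.linProd, AffineLie.toProd]
  have e3 : ∀ i, e (Sum.inr (Sum.inr i)) = ⟨0, 0, 1⟩ := by
    intro i
    simp [e, AffineLie.linProd, AffineLie.toProd]
  have er : ∀ x n i, e.repr x (Sum.inl ⟨n, i⟩) = v.repr (x.loop n) i := by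
    intro x n i
    simp [e, AffineLie.linProd, AffineLie.toProd]
  let wt : ((Σ _ : ℤ, κ) ⊕ (PUnit.{u+1} ⊕ PUnit.{u+1})) → Wt h :=
    Sum.elim (fun p => finToAff h (α p.2) + p.1 • delta h) fun _ => 0
  -- The power of `t` decides the sign, and for `t⁰` the position of the finite root relative to
  -- `b`.
  let sgn : ((Σ _ : ℤ, κ) ⊕ (PUnit.{u+1} ⊕ PUnit.{u+1})) → SignType :=
    Sum.elim (fun p => if p.1 = 0 then (if α p.2 = 0 then 0 else
      if α p.2 ∈ finPosRoots h b then 1 else -1) else SignType.sign p.1) fun _ => 0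
  have cinl : ∀ (H : AffCartan h) n i, e.repr (cartanIncl h H) (Sum.inl ⟨n, i⟩) =
      if n = 0 then v.repr (H.1 : g) i else 0 := by
    intro H n i
    rw [er]
    split_ifs with hn
    · simp [cartanIncl, hn]
    · simp [cartanIncl, Finsupp.single_eq_of_ne hn]
  have hroot : ∀ i, α i ≠ 0 → α i ∈ finRoots h := fun i hi => ⟨hi, (hv i).1⟩
  have sgn_cases : ∀ n i, (sgn (Sum.inl ⟨n, i⟩) = 1 ∧ (n = 0 ∧ α i ∈ finPosRoots h b ∨ 0 < n)) ∨
      (sgn (Sum.inl ⟨n, i⟩) = 0 ∧ n = 0 ∧ α i = 0) ∨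
      (sgn (Sum.inl ⟨n, i⟩) = -1 ∧ (n = 0 ∧ α i ≠ 0 ∧ α i ∉ finPosRoots h b ∨ n < 0)) := by
    intro n i
    rcases lt_trichotomy n 0 with hn | hn | hn
    · exact Or.inr (Or.inr ⟨by simp [sgn, hn.ne, hn], Or.inr hn⟩)
    · by_cases h1 : α i = 0
      · exact Or.inr (Or.inl ⟨by simp [sgn, hn, h1], hn, h1⟩)
      · by_cases h2 : α i ∈ finPosRoots h b
        · exact Or.inl ⟨by simp [sgn, hn, h1, h2], Or.inl ⟨hn, h2⟩⟩
        · exact Or.inr (Or.inr ⟨by simp [sgn, hn, h1, h2], Or.inl ⟨hn, h1, h2⟩⟩)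
    · exact Or.inl ⟨by simp [sgn, hn.ne', hn], Or.inr hn⟩
  have sgn_inr : ∀ i, sgn (Sum.inr i) = 0 := fun _ => rfl
  have ne1 : (0 : SignType) ≠ 1 := by decide
  have ne2 : (0 : SignType) ≠ -1 := by decide
  have ne3 : (1 : SignType) ≠ -1 := by decide
  -- The sign is compared first; ties are broken by an arbitrary total order.
  let lo₀ : LinearOrder ((Σ _ : ℤ, κ) ⊕ (PUnit.{u+1} ⊕ PUnit.{u+1})) :=
    linearOrderOfSTO WellOrderingRel
  let f : ((Σ _ : ℤ, κ) ⊕ (PUnit.{u+1} ⊕ PUnit.{u+1})) →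
      SignType ×ₗ ((Σ _ : ℤ, κ) ⊕ (PUnit.{u+1} ⊕ PUnit.{u+1})) := fun i => toLex (sgn i, i)
  have hf : Function.Injective f := fun i j hij => congrArg (fun p => (ofLex p).2) hij
  have hmono : ∀ i j, f i ≤ f j → sgn i ≤ sgn j := by
    intro i j hij
    rcases Prod.Lex.le_iff.1 hij with h1 | ⟨h1, -⟩
    · exact h1.le
    · exact h1.le
  let lo : LinearOrder ((Σ _ : ℤ, κ) ⊕ (PUnit.{u+1} ⊕ PUnit.{u+1})) := LinearOrder.lift' f hf
  refine ⟨⟨_, lo, e, wt, sgn, ?_, ?_, ?_, ?_, ?_, ?_, ?_, ?_, ?_, ?_⟩⟩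
  · exact fun i j hij => hmono i j hij
  · rintro H (⟨n, i⟩ | i | i)
    · rw [e1]
      have := lie_eq_smul_of_mem_rootSpace (hv i).2 H.1
      ext1
      · simp only [cartanIncl, AffineLie.loop_lie, loopBr_mon, loopDer_mon, zero_add, zero_smul,
          sub_zero, AffineLie.loop_smul, wt, Sum.elim_inl, LinearMap.add_apply, finToAff_apply,
          LinearMap.smul_apply, delta_apply]
        rw [Finsupp.smul_single, Finsupp.smul_single, ← Finsupp.single_add]
        have this' : ⁅(H.1 : g), v i⁆ = α i H.1 • v i := this
        rw [this', smul_smul, ← add_smul]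
        congr 3
        rw [zsmul_eq_mul, mul_comm]
      · simp only [cartanIncl, AffineLie.cK_lie, loopForm_mon, AffineLie.cK_smul]
        simp
      · simp
    · rw [e2]
      ext1 <;> simp [cartanIncl, wt]
    · rw [e3]
      ext1
      · simp [cartanIncl, wt]
      · simp [cartanIncl, wt]
      · simp [wt]
  · rintro (⟨n, i⟩ | i) hs
    · simp only [wt, Sum.elim_inl]
      rcases sgn_cases n i with ⟨-, ⟨rfl, h3⟩ | hn⟩ | ⟨h0, -⟩ | ⟨h0, -⟩
      · exact Or.inl (Or.inl ⟨_, h3, by simp⟩)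
      · obtain ⟨m, rfl⟩ := Int.eq_ofNat_of_zero_le hn.le
        by_cases hα : α i = 0
        · exact Or.inr ⟨m, by omega, by simp [hα, finToAff_zero]⟩
        · exact Or.inl (Or.inr ⟨_, hroot i hα, m, by omega, by simp⟩)
      · exact absurd (h0.symm.trans hs) ne1
      · exact absurd (hs.symm.trans h0) ne3
    · exact absurd hs ne1
  · rintro (⟨n, i⟩ | i) hs
    · simp only [wt, Sum.elim_inl]
      have hneg : ∀ γ : Module.Dual ℂ h, finToAff h (-γ) = -finToAff h γ := fun _ => rfl
      rcases sgn_cases n i with ⟨h0, -⟩ | ⟨h0, -⟩ | ⟨-, ⟨rfl, h2, h3⟩ | hn⟩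
      · exact absurd (h0.symm.trans hs) ne3
      · exact absurd (h0.symm.trans hs) ne2
      -- The maximality of `b` enters here: a nonzero root that is not positive has a positive
      -- negative.
      · refine Or.inl (Or.inl ⟨_, (finPosRoots_or_neg hb hhb (hroot i h2)).resolve_left h3, ?_⟩)
        simp [hneg]
      · obtain ⟨m, hm⟩ := Int.eq_ofNat_of_zero_le (Int.neg_nonneg_of_nonpos hn.le)
        obtain rfl : n = -(m : ℤ) := by omega
        by_cases hα : α i = 0
        · exact Or.inr ⟨m, by omega, by simp [hα, finToAff_zero]⟩
        · refine Or.inl (Or.inr ⟨-α i, ⟨neg_ne_zero.2 hα, ?_⟩, m, by omega, ?_⟩)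
          · exact (-(wtOfRoot (hroot i hα))).genWeightSpace_ne_bot
          · simp [hneg, add_comm]
    · exact absurd hs ne2
  · rintro (⟨n, i⟩ | i) hs
    · simp only [wt, Sum.elim_inl]
      rcases sgn_cases n i with ⟨h0, -⟩ | ⟨-, h1, h2⟩ | ⟨h0, -⟩
      · exact absurd (hs.symm.trans h0) ne1
      · simp [h1, h2, finToAff_zero]
      · exact absurd (hs.symm.trans h0) ne2
    · rfl
  · intro γ hγ
    rcases Set.eq_empty_or_nonempty {i | wt i = γ} with h0 | ⟨⟨n, i⟩ | i, hi⟩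
    · rw [h0]; exact Set.finite_empty
    · have hd : ∀ (m : ℤ) (j : κ), deg (wt (Sum.inl ⟨m, j⟩)) = m := by
        intro m j
        simp [wt, deg, finToAff_apply, delta_apply]
      refine (Set.finite_range fun j : κ =>
        (Sum.inl ⟨n, j⟩ : (Σ _ : ℤ, κ) ⊕ (PUnit.{u+1} ⊕ PUnit.{u+1}))).subset ?_
      rintro (⟨m, j⟩ | j) hj
      · have := congrArg deg ((show wt _ = γ from hj).trans (show wt _ = γ from hi).symm)
        rw [hd, hd, Int.cast_inj] at this
        exact ⟨j, by rw [this]⟩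
      · exact absurd (show wt _ = γ from hj).symm hγ
    · exact absurd (show wt _ = γ from hi).symm hγ
  · rintro H (⟨n, i⟩ | i) hs
    · rw [cinl]
      split_ifs with hn
      · refine repr_eq_zero_of_mem_rootSpace v α (fun i => (hv i).2) (β := 0)
          (mem_cartan_iff.1 H.1.2) fun h0 => hs ?_
        simp [sgn, hn, h0]
      · rfl
    · exact absurd rfl hs
  · rintro (⟨n, i⟩ | i | i) hs
    · rcases sgn_cases n i with ⟨h0, -⟩ | ⟨-, h1, h2⟩ | ⟨h0, -⟩
      · exact absurd (hs.symm.trans h0) ne1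
      · refine ⟨(⟨v i, mem_cartan_iff.2 ?_⟩, 0, 0), ?_⟩
        · have := (hv i).2
          rwa [h2] at this
        · rw [e1, h1]; rfl
      · exact absurd (hs.symm.trans h0) ne2
    · exact ⟨(0, 1, 0), by rw [e2]; simp [cartanIncl]⟩
    · exact ⟨(0, 0, 1), by rw [e3]; simp [cartanIncl]⟩
  · rintro x ⟨hx, hx0⟩ (⟨n, i⟩ | i) hs
    · rw [er]
      rcases sgn_cases n i with ⟨h0, -⟩ | ⟨h0, -⟩ | ⟨-, ⟨rfl, h2, h3⟩ | hn⟩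
      · exact absurd (h0.symm.trans hs) ne3
      · exact absurd (h0.symm.trans hs) ne2
      · have : b.toSubmodule ≤ LinearMap.ker (v.coord i) := by
          refine le_of_cartan_le hhb (fun x hx => ?_) fun β hβ x hx => ?_
          · exact repr_eq_zero_of_mem_rootSpace v α (fun i => (hv i).2) (β := 0)
              (mem_cartan_iff.1 hx) h2
          · exact repr_eq_zero_of_mem_rootSpace v α (fun i => (hv i).2) hx
              fun h0 => h3 (h0 ▸ hβ)
        exact this hx0
      · rw [hx n hn]; simp
    · exact absurd hs ne2
  · rintro (⟨n, i⟩ | i | i) hs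
    · rw [e1]
      rcases sgn_cases n i with ⟨-, ⟨rfl, h3⟩ | hn⟩ | ⟨-, rfl, h2⟩ | ⟨h0, -⟩
      · refine ⟨fun m hm => by simp [Finsupp.single_eq_of_ne hm.ne], ?_⟩
        simp only [Finsupp.single_eq_same]
        exact h3.2 _ (hv i).2
      · refine ⟨fun m hm => ?_, ?_⟩
        · simp [Finsupp.single_eq_of_ne (show m ≠ n by omega)]
        · simp [Finsupp.single_eq_of_ne (show (0 : ℤ) ≠ n by omega), b.zero_mem]
      · refine ⟨fun m hm => by simp [Finsupp.single_eq_of_ne hm.ne], ?_⟩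
        simp only [Finsupp.single_eq_same]
        refine hhb (mem_cartan_iff.2 ?_)
        have := (hv i).2
        rwa [h2] at this
      · exact absurd h0 hs
    · rw [e2]; exact ⟨by simp, by simp [b.zero_mem]⟩
    · rw [e3]; exact ⟨by simp, by simp [b.zero_mem]⟩

end TriBasis

end AffineO

end

noncomputable section

set_option linter.unusedSectionVars false

namespace AffineO

/-! ### Weight spaces -/

section Weights

variable {g : Type u} [LieRing g] [LieAlgebra ℂ g] {h : LieSubalgebra ℂ g}
variable {A : Type u} [CommRing A] [Algebra ℂ A]

/-- The inclusion of the enveloping algebra of `ĝ`. -/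
def envIncl (A : Type u) [CommRing A] [Algebra ℂ A] :
    UniversalEnvelopingAlgebra ℂ (AffineLie g) →ₐ[ℂ] EnvAlg g A :=
  Algebra.TensorProduct.includeRight

lemma act_eq (x : AffineLie g) : act A x = envIncl A (UniversalEnvelopingAlgebra.ι ℂ x) := rfl

lemma act_smul (c : ℂ) (x : AffineLie g) : act A (c • x) = c • act A x := by
  simp [act_eq]

lemma act_smul' (c : ℂ) (x : AffineLie g) :
    act A (c • x) = algebraMap A (EnvAlg g A) (algebraMap ℂ A c) * act A x := by
  rw [act_smul, Algebra.smul_def, IsScalarTower.algebraMap_apply ℂ A (EnvAlg g A)]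

lemma act_sum {ι : Type*} (s : Finset ι) (x : ι → AffineLie g) :
    act A (∑ i ∈ s, x i) = ∑ i ∈ s, act A (x i) := by
  simp [act_eq]

attribute [local instance] LieRing.ofAssociativeRing in
lemma act_lie (x y : AffineLie g) : act A ⁅x, y⁆ = act A x * act A y - act A y * act A x := by
  have : UniversalEnvelopingAlgebra.ι ℂ ⁅x, y⁆ =
      UniversalEnvelopingAlgebra.ι ℂ x * UniversalEnvelopingAlgebra.ι ℂ y -
        UniversalEnvelopingAlgebra.ι ℂ y * UniversalEnvelopingAlgebra.ι ℂ x := by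
    rw [LieHom.map_lie, LieRing.of_associative_ring_bracket]
  rw [act_eq, act_eq, act_eq, this, map_sub, map_mul, map_mul]

lemma smul_tmul_one (a : A) (u : UniversalEnvelopingAlgebra ℂ (AffineLie g)) :
    (a ⊗ₜ[ℂ] u : EnvAlg g A) = algebraMap A (EnvAlg g A) a * envIncl A u := by
  simp [envIncl, Algebra.TensorProduct.algebraMap_apply]

/-- An `A`-submodule that is stable under `ĝ` is stable under `A ⊗ U(ĝ)`. -/
lemma env_smul_mem {M : GMod g A} {N : Submodule A M} (hN : ∀ x : AffineLie g, ∀ n ∈ N, act A x • n ∈ N)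
    (r : EnvAlg g A) {n : M} (hn : n ∈ N) : r • n ∈ N := by
  induction r using TensorProduct.induction_on generalizing n with
  | zero => rw [zero_smul]; exact zero_mem _
  | add x y hx hy => rw [add_smul]; exact add_mem (hx hn) (hy hn)
  | tmul a u =>
    rw [smul_tmul_one, mul_smul, ← base_smul_def]
    refine N.smul_mem a ?_
    induction u using PBW.env_induction generalizing n with
    | algebraMap c =>
      rw [AlgHom.commutes, IsScalarTower.algebraMap_apply ℂ A (EnvAlg g A), ← base_smul_def]
      exact N.smul_mem _ hn
    | ι x => exact hN x n hn
    | mul a b ha hb => rw [map_mul, mul_smul]; exact ha (hb hn)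
    | add a b ha hb => rw [map_add, add_smul]; exact add_mem (ha hn) (hb hn)

variable [Algebra (SymmetricAlgebra ℂ h) A]

lemma wtScalar_add (lam μ : Wt h) (H : AffCartan h) :
    wtScalar h A (lam + μ) H = wtScalar h A lam H + algebraMap ℂ A (μ H) := by
  simp only [wtScalar, LinearMap.add_apply, map_add]; ring

lemma wtScalar_sub_wtScalar (lam μ : Wt h) (H : AffCartan h) :
    wtScalar h A lam H - wtScalar h A μ H = algebraMap ℂ A (lam H - μ H) := by
  simp only [wtScalar, map_sub]; ring

lemma map_mem_wtSpace {M N : GMod g A} (f : M →ₗ[EnvAlg g A] N) {lam : Wt h} {m : M}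
    (hm : m ∈ wtSpace h M lam) : f m ∈ wtSpace h N lam :=
  map_wtSpace_le f lam ⟨m, hm, rfl⟩

lemma mem_wtSpace_of_injective {M N : GMod g A} (f : M →ₗ[EnvAlg g A] N)
    (hf : Function.Injective f) {lam : Wt h} {m : M} (hm : f m ∈ wtSpace h N lam) :
    m ∈ wtSpace h M lam := by
  intro H
  apply hf
  rw [map_smul, hm H]
  exact ((toBaseLin f).map_smul _ m).symm

/-- The weight projections are given by elements of `A ⊗ U(ĥ)`. -/
lemma exists_wtProj (F : Finset (Wt h)) (lam : Wt h) : ∃ r : EnvAlg g A, ∀ M : GMod g A,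
    (∀ μ ∈ F, μ ≠ lam → ∀ m ∈ wtSpace h M μ, r • m = 0) ∧
    (∀ m ∈ wtSpace h M lam, r • m = m) ∧
    (∀ N : Submodule A M, (∀ H, ∀ n ∈ N, act A (cartanIncl h H) • n ∈ N) → ∀ n ∈ N, r • n ∈ N) := by
  classical
  induction F using Finset.induction with
  | empty => exact ⟨1, fun M => ⟨by simp, by simp, by simp⟩⟩
  | insert ν F hν ih =>
    obtain ⟨r, hr⟩ := ih
    by_cases hνl : ν = lam
    · refine ⟨r, fun M => ⟨fun μ hμ hne => ?_, (hr M).2⟩⟩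
      rcases Finset.mem_insert.1 hμ with rfl | hμ
      · exact absurd hνl hne
      · exact (hr M).1 μ hμ hne
    obtain ⟨H, hH⟩ : ∃ H, lam H ≠ ν H := by
      by_contra! hcon
      exact hνl (LinearMap.ext hcon).symm
    -- The factor `s` of Lagrange interpolation kills weight `ν` and fixes weight `lam`. As `τ`
    -- cancels in differences of weights, the denominator is a nonzero complex number and thus
    -- invertible in `A`.
    set c : A := algebraMap ℂ A (lam H - ν H)⁻¹
    let s : EnvAlg g A := algebraMap A (EnvAlg g A) c *
      (act A (cartanIncl h H) - algebraMap A (EnvAlg g A) (wtScalar h A ν H))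
    have hs : ∀ (M : GMod g A) (μ : Wt h), ∀ m ∈ wtSpace h M μ,
        s • m = algebraMap ℂ A ((lam H - ν H)⁻¹ * (μ H - ν H)) • m := by
      intro M μ m hm
      have : s • m = c • (act A (cartanIncl h H) • m - wtScalar h A ν H • m) := by
        simp only [s, mul_smul, sub_smul, base_smul_def]
      rw [this, hm H, ← sub_smul, wtScalar_sub_wtScalar, smul_smul, ← map_mul]
    have comm : ∀ (a : A) (M : GMod g A) (m : M), r • a • m = a • r • m := by
      intro a M m
      rw [base_smul_def, base_smul_def, ← mul_smul, ← mul_smul, Algebra.commutes]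
    refine ⟨r * s, fun M => ⟨fun μ hμ hne m hm => ?_, fun m hm => ?_, fun N hN n hn => ?_⟩⟩
    · rw [mul_smul, hs M μ m hm]
      rcases Finset.mem_insert.1 hμ with rfl | hμ
      · rw [sub_self, mul_zero, map_zero, zero_smul, smul_zero]
      · rw [comm, (hr M).1 μ hμ hne m hm, smul_zero]
    · rw [mul_smul, hs M lam m hm, inv_mul_cancel₀ (sub_ne_zero.2 hH), map_one, one_smul]
      exact (hr M).2.1 m hm
    · rw [mul_smul]
      refine (hr M).2.2 N hN _ ?_
      have : s • n = c • (act A (cartanIncl h H) • n - wtScalar h A ν H • n) := by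
        simp only [s, mul_smul, sub_smul, base_smul_def]
      rw [this]
      exact N.smul_mem _ (N.sub_mem (hN H n hn) (N.smul_mem _ hn))

/-- A finite decomposition into weight vectors. -/
lemma exists_finset_sum {M : GMod g A} {m : M} (hm : m ∈ ⨆ lam, wtSpace h M lam) :
    ∃ (F : Finset (Wt h)) (f : Wt h → M), (∀ μ, f μ ∈ wtSpace h M μ) ∧ (∀ μ ∉ F, f μ = 0) ∧
      ∑ μ ∈ F, f μ = m := by
  obtain ⟨f, hf, rfl⟩ := (Submodule.mem_iSup_iff_exists_finsupp _ _).1 hm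
  exact ⟨f.support, f, hf, fun μ hμ => Finsupp.notMem_support_iff.1 hμ, rfl⟩

/-- A weight projection fixes `x` and kills the finitely many components of other weights, whose sum
is also `x`. No condition on `M` is needed. -/
lemma iSupIndep_wtSpace (M : GMod g A) : iSupIndep (wtSpace h M) := by
  classical
  intro lam
  rw [Submodule.disjoint_def]
  intro x hx hx'
  -- Allowing all larger finite sets `G` lets one projection serve both summands of a sum.
  have key : ∀ y ∈ ⨆ μ, ⨆ (_ : μ ≠ lam), wtSpace h M μ, ∃ F : Finset (Wt h), ∀ G, F ⊆ G →
      ∀ r : EnvAlg g A, (∀ μ ∈ G, μ ≠ lam → ∀ m ∈ wtSpace h M μ, r • m = 0) → r • y = 0 := by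
    intro y hy
    refine Submodule.iSup_induction (motive := fun y => ∃ F : Finset (Wt h), ∀ G, F ⊆ G →
      ∀ r : EnvAlg g A, (∀ μ ∈ G, μ ≠ lam → ∀ m ∈ wtSpace h M μ, r • m = 0) → r • y = 0) _ hy ?_
      ⟨∅, by simp⟩ ?_
    · intro μ z hz
      by_cases hne : μ = lam
      · simp [hne] at hz
        exact ⟨∅, by simp [hz]⟩
      · simp only [ne_eq, hne, not_false_eq_true, iSup_pos] at hz
        exact ⟨{μ}, fun G hG r hr => hr μ (hG (by simp)) hne z hz⟩
    · rintro y z ⟨F, hF⟩ ⟨F', hF'⟩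
      refine ⟨F ∪ F', fun G hG r hr => ?_⟩
      rw [smul_add, hF G (Finset.union_subset_left hG) r hr,
        hF' G (Finset.union_subset_right hG) r hr, add_zero]
  obtain ⟨F, hF⟩ := key x hx'
  obtain ⟨r, hr⟩ := exists_wtProj (A := A) F lam
  rw [← (hr M).2.1 x hx]
  exact hF F subset_rfl r (hr M).1

lemma isWeightModule_of_iSup {M : GMod g A} (hM : ⨆ lam, wtSpace h M lam = ⊤) :
    IsWeightModule h M := (isWeightModule_iff M).2 ⟨iSupIndep_wtSpace M, hM⟩

lemma IsWeightModule.iSup_eq {M : GMod g A} (hM : IsWeightModule h M) :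
    ⨆ lam, wtSpace h M lam = ⊤ := ((isWeightModule_iff M).1 hM).2

lemma IsWeightModule.exists_sum {M : GMod g A} (hM : IsWeightModule h M) (m : M) :
    ∃ (F : Finset (Wt h)) (f : Wt h → M), (∀ μ, f μ ∈ wtSpace h M μ) ∧ (∀ μ ∉ F, f μ = 0) ∧
      ∑ μ ∈ F, f μ = m :=
  exists_finset_sum (by rw [hM.iSup_eq]; trivial)

/-- The action of a weight projection on a sum of weight vectors. -/
lemma wtProj_sum {M : GMod g A} {F G : Finset (Wt h)} (hFG : F ⊆ G) {lam : Wt h} {f : Wt h → M}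
    (hf : ∀ μ, f μ ∈ wtSpace h M μ) (hF : ∀ μ ∉ F, f μ = 0) {r : EnvAlg g A}
    (h1 : ∀ μ ∈ G, μ ≠ lam → ∀ m ∈ wtSpace h M μ, r • m = 0)
    (h2 : ∀ m ∈ wtSpace h M lam, r • m = m) : r • ∑ μ ∈ F, f μ = f lam := by
  classical
  rw [Finset.smul_sum]
  by_cases hl : lam ∈ F
  · rw [Finset.sum_eq_single lam]
    · exact h2 _ (hf lam)
    · exact fun μ hμ hne => h1 μ (hFG hμ) hne _ (hf μ)
    · exact fun h => absurd hl h
  · rw [hF lam hl]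
    refine Finset.sum_eq_zero fun μ hμ => h1 μ (hFG hμ) ?_ _ (hf μ)
    rintro rfl
    exact hl hμ

/-- Submodules that are stable under the Cartan algebra contain the weight components of their
elements. -/
lemma component_mem {M : GMod g A} (N : Submodule A M)
    (hN : ∀ H, ∀ n ∈ N, act A (cartanIncl h H) • n ∈ N) {F : Finset (Wt h)} {f : Wt h → M}
    (hf : ∀ μ, f μ ∈ wtSpace h M μ) (hF : ∀ μ ∉ F, f μ = 0) (hsum : ∑ μ ∈ F, f μ ∈ N) (lam : Wt h) :
    f lam ∈ N := by
  obtain ⟨r, hr⟩ := exists_wtProj (A := A) F lam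
  rw [← wtProj_sum subset_rfl hf hF (hr M).1 (hr M).2.1]
  exact (hr M).2.2 N hN _ hsum

lemma isWeightModule_of_injective {M N : GMod g A} (f : N →ₗ[EnvAlg g A] M)
    (hf : Function.Injective f) (hM : IsWeightModule h M) : IsWeightModule h N := by
  refine isWeightModule_of_iSup (eq_top_iff.2 fun n _ => ?_)
  obtain ⟨F, c, hc, hF, hsum⟩ := hM.exists_sum (f n)
  choose r hr using fun lam => exists_wtProj (A := A) F lam
  have h1 : ∀ lam, f (r lam • n) = c lam := fun lam => by
    rw [map_smul, ← hsum, wtProj_sum subset_rfl hc hF (hr lam M).1 (hr lam M).2.1]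
  have : n = ∑ μ ∈ F, r μ • n := hf (by rw [map_sum, ← hsum]; simp [h1])
  rw [this]
  refine Submodule.sum_mem _ fun μ _ => Submodule.mem_iSup_of_mem μ ?_
  exact mem_wtSpace_of_injective f hf (by rw [h1]; exact hc μ)

lemma isWeightModule_of_surjective {M N : GMod g A} (f : M →ₗ[EnvAlg g A] N)
    (hf : Function.Surjective f) (hM : IsWeightModule h M) : IsWeightModule h N := by
  refine isWeightModule_of_iSup (eq_top_iff.2 fun n _ => ?_)
  obtain ⟨m, rfl⟩ := hf n
  obtain ⟨F, c, hc, hF, rfl⟩ := hM.exists_sum m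
  rw [map_sum]
  exact Submodule.sum_mem _ fun μ _ => Submodule.mem_iSup_of_mem μ (map_mem_wtSpace f (hc μ))

/-- Weight vectors lift along surjections of weight modules. -/
lemma exists_lift_wtSpace {M N : GMod g A} (f : M →ₗ[EnvAlg g A] N)
    (hf : Function.Surjective f) (hM : IsWeightModule h M) {lam : Wt h} {n : N}
    (hn : n ∈ wtSpace h N lam) : ∃ m ∈ wtSpace h M lam, f m = n := by
  obtain ⟨m, rfl⟩ := hf n
  obtain ⟨F, c, hc, hF, rfl⟩ := hM.exists_sum m
  obtain ⟨r, hr⟩ := exists_wtProj (A := A) F lam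
  refine ⟨c lam, hc lam, ?_⟩
  rw [← wtProj_sum subset_rfl hc hF (hr M).1 (hr M).2.1, map_smul]
  exact (hr N).2.1 _ hn

variable {b : LieSubalgebra ℂ g}

/-- The preimage of a finitely generated stable submodule is again finitely generated because `A` is
Noetherian. -/
lemma catO_of_injective [IsNoetherianRing A] {M N : GMod g A} (f : N →ₗ[EnvAlg g A] M)
    (hf : Function.Injective f) (hM : catO h b A M) : catO h b A N := by
  refine ⟨isWeightModule_of_injective f hf hM.1, fun n => ?_⟩
  obtain ⟨V, hV, hfg, hst⟩ := hM.2 (f n)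
  refine ⟨V.comap (toBaseLin f), hV, ?_, fun x hx m hm => ?_⟩
  · have : IsNoetherian A V := isNoetherian_of_fg_of_noetherian V hfg
    let φ : V.comap (toBaseLin f) →ₗ[A] V :=
      ((toBaseLin f).comp (Submodule.subtype _)).codRestrict V fun m => m.2
    have hφ : Function.Injective φ := fun m m' hmm =>
      Subtype.ext (hf (congrArg Subtype.val hmm))
    have : IsNoetherian A (V.comap (toBaseLin f)) := isNoetherian_of_injective φ hφ
    exact (Submodule.fg_top _).1 (IsNoetherian.noetherian ⊤)
  · show f (act A x • m) ∈ V
    rw [map_smul]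
    exact hst x hx _ hm

lemma catO_of_surjective {M N : GMod g A} (f : M →ₗ[EnvAlg g A] N)
    (hf : Function.Surjective f) (hM : catO h b A M) : catO h b A N := by
  refine ⟨isWeightModule_of_surjective f hf hM.1, fun n => ?_⟩
  obtain ⟨m, rfl⟩ := hf n
  obtain ⟨V, hV, hfg, hst⟩ := hM.2 m
  refine ⟨V.map (toBaseLin f), ⟨m, hV, rfl⟩, hfg.map _, ?_⟩
  rintro x hx _ ⟨n, hn, rfl⟩
  exact ⟨_, hst x hx n hn, f.map_smul _ n⟩

variable {J : Set (Wt h)}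

lemma catOTrunc_of_injective [IsNoetherianRing A] {M N : GMod g A} (f : N →ₗ[EnvAlg g A] M)
    (hf : Function.Injective f) (hM : catOTrunc h b A J M) : catOTrunc h b A J N := by
  refine ⟨catO_of_injective f hf hM.1, fun lam hlam => hM.2 lam fun h0 => hlam ?_⟩
  rw [Submodule.eq_bot_iff] at h0 ⊢
  intro n hn
  exact hf ((h0 _ (map_mem_wtSpace f hn)).trans (map_zero f).symm)

lemma catOTrunc_of_surjective {M N : GMod g A} (f : M →ₗ[EnvAlg g A] N)
    (hf : Function.Surjective f) (hM : catOTrunc h b A J M) : catOTrunc h b A J N := by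
  refine ⟨catO_of_surjective f hf hM.1, fun lam hlam => hM.2 lam fun h0 => hlam ?_⟩
  rw [Submodule.eq_bot_iff] at h0 ⊢
  intro n hn
  obtain ⟨m, hm, rfl⟩ := exists_lift_wtSpace f hf hM.1.1 hn
  rw [h0 m hm, map_zero]

end Weights

end AffineO

end

noncomputable section

set_option linter.unusedSectionVars false

/-! ### Monomials -/

namespace PBW

variable {k : Type*} [CommRing k] {L : Type*} [LieRing L] [LieAlgebra k L]
variable {ι : Type*} [LinearOrder ι] (e : Module.Basis ι k L)

attribute [local instance] LieRing.ofAssociativeRing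

lemma mono_add {s s' : Multiset ι} (hs : ∀ i ∈ s, ∀ j ∈ s', i ≤ j) :
    mono e (s + s') = mono e s * mono e s' := by
  have : (s + s').sort (· ≤ ·) = s.sort (· ≤ ·) ++ s'.sort (· ≤ ·) := by
    refine List.Perm.eq_of_pairwise' (r := (· ≤ ·)) (Multiset.pairwise_sort _ _) ?_ ?_
    · rw [List.pairwise_append]
      refine ⟨Multiset.pairwise_sort _ _, Multiset.pairwise_sort _ _, fun i hi j hj => ?_⟩
      exact hs i (by simpa using hi) j (by simpa using hj)
    · rw [← Multiset.coe_eq_coe, ← Multiset.coe_add]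
      simp
  rw [mono, this, word_append]
  rfl

lemma word_perm {l l' : List ι} (hl : l.Perm l') (hc : ∀ i ∈ l, ∀ j ∈ l, ⁅e i, e j⁆ = 0) :
    word e l = word e l' := by
  induction hl with
  | nil => rfl
  | cons i _ ih =>
    rw [word_cons, word_cons, ih fun i hi j hj => hc i (by simp [hi]) j (by simp [hj])]
  | swap i j l =>
    have := word_exchange e [] l j i
    simp only [List.nil_append] at this
    rw [this, hc j (by simp) i (by simp)]
    simp
  | trans h1 _ ih1 ih2 =>
    rw [ih1 hc, ih2 fun i hi j hj => hc i (h1.mem_iff.2 hi) j (h1.mem_iff.2 hj)]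

end PBW

namespace AffineO

namespace TriBasis

variable {g : Type u} [LieRing g] [LieAlgebra ℂ g] [FiniteDimensional ℂ g] [LieAlgebra.IsKilling ℂ g]
variable {h : LieSubalgebra ℂ g} [h.IsCartanSubalgebra] {b : LieSubalgebra ℂ g}
variable [LieAlgebra.IsSolvable b]
variable (t : TriBasis h b)

lemma repr_lie_cartan (H : AffCartan h) (x : AffineLie g) (m : t.ι) :
    t.e.repr ⁅cartanIncl h H, x⁆ m = t.wt m H * t.e.repr x m := by
  have : t.e.coord m ∘ₗ LieModule.toEnd ℂ (AffineLie g) (AffineLie g) (cartanIncl h H) =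
      t.wt m H • t.e.coord m := by
    refine t.e.ext fun j => ?_
    simp only [LinearMap.coe_comp, Function.comp_apply, LieModule.toEnd_apply_apply, t.lie_cartan,
      map_smul, LinearMap.smul_apply]
    by_cases hj : j = m
    · rw [hj]
    · simp [Finsupp.single_eq_of_ne (Ne.symm hj)]
  exact LinearMap.congr_fun this x

lemma wt_of_mem_support {i j m : t.ι} (hm : m ∈ (t.e.repr ⁅t.e i, t.e j⁆).support) :
    t.wt m = t.wt i + t.wt j := by
  refine LinearMap.ext fun H => ?_
  have h1 := t.repr_lie_cartan H ⁅t.e i, t.e j⁆ m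
  rw [leibniz_lie, t.lie_cartan, t.lie_cartan, smul_lie, lie_smul, ← add_smul, map_smul,
    Finsupp.smul_apply, smul_eq_mul] at h1
  exact (mul_right_cancel₀ (Finsupp.mem_support_iff.1 hm) h1).symm

/-- A basis vector in the bracket has weight `wt i + wt j`; if it were not positive, a nonempty sum
of positive roots would vanish. So straightening a positive word produces positive monomials only.
-/
lemma sgn_of_mem_support {i j m : t.ι} (hi : t.sgn i = 1) (hj : t.sgn j = 1)
    (hm : m ∈ (t.e.repr ⁅t.e i, t.e j⁆).support) : t.sgn m = 1 := by
  have hw := t.wt_of_mem_support hm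
  have hi' := t.wt_pos i hi
  have hj' := t.wt_pos j hj
  rcases SignType.trichotomy (t.sgn m) with h0 | h0 | h0
  · have := pointed_affPosRoots (b := b) {t.wt i, t.wt j, -t.wt m} (by
      intro γ hγ
      simp only [Multiset.insert_eq_cons, Multiset.mem_cons, Multiset.mem_singleton] at hγ
      rcases hγ with rfl | rfl | rfl
      exacts [hi', hj', t.wt_neg m h0]) (by simp [hw])
    simp at this
  · have := pointed_affPosRoots (b := b) {t.wt i, t.wt j} (by
      intro γ hγ
      simp only [Multiset.insert_eq_cons, Multiset.mem_cons, Multiset.mem_singleton] at hγ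
      rcases hγ with rfl | rfl
      exacts [hi', hj']) (by simpa [t.wt_zero m h0] using hw.symm)
    simp at this
  · exact h0

/-- The total weight of a multiset of basis vectors. -/
def wts (s : Multiset t.ι) : Wt h := (s.map t.wt).sum

@[simp] lemma wts_zero : t.wts 0 = 0 := by simp [wts]

@[simp] lemma wts_cons (i : t.ι) (s : Multiset t.ι) : t.wts (i ::ₘ s) = t.wt i + t.wts s := by
  simp [wts]

@[simp] lemma wts_add (s s' : Multiset t.ι) : t.wts (s + s') = t.wts s + t.wts s' := by
  simp [wts]

/-- The part of a multiset of basis vectors of a given sign. -/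
def part (ε : SignType) (s : Multiset t.ι) : Multiset t.ι := s.filter fun i => t.sgn i = ε

lemma part_add (ε : SignType) (s s' : Multiset t.ι) : t.part ε (s + s') = t.part ε s + t.part ε s' :=
  Multiset.filter_add _ _ _

lemma sgn_of_mem_part {ε : SignType} {s : Multiset t.ι} {i : t.ι} (hi : i ∈ t.part ε s) :
    t.sgn i = ε := (Multiset.mem_filter.1 hi).2

lemma part_eq_self {ε : SignType} {s : Multiset t.ι} (hs : ∀ i ∈ s, t.sgn i = ε) :
    t.part ε s = s := Multiset.filter_eq_self.2 hs

lemma part_eq_zero {ε ε' : SignType} {s : Multiset t.ι} (hs : ∀ i ∈ s, t.sgn i = ε) (hε : ε ≠ ε') :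
    t.part ε' s = 0 :=
  Multiset.filter_eq_nil.2 fun i hi hi' => hε ((hs i hi).symm.trans hi')

lemma part_add_part (s : Multiset t.ι) : t.part (-1) s + (t.part 0 s + t.part 1 s) = s := by
  induction s using Multiset.induction with
  | empty => rfl
  | cons i s ih =>
    conv_rhs => rw [← ih]
    rcases SignType.trichotomy (t.sgn i) with h0 | h0 | h0 <;>
      simp [part, h0, add_comm]

lemma wts_part_zero {s : Multiset t.ι} (hs : ∀ i ∈ s, t.sgn i = 0) : t.wts s = 0 := by
  refine Multiset.sum_eq_zero fun γ hγ => ?_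
  obtain ⟨i, hi, rfl⟩ := Multiset.mem_map.1 hγ
  exact t.wt_zero i (hs i hi)

lemma le_of_sgn_lt {i j : t.ι} (hij : t.sgn i < t.sgn j) : i ≤ j :=
  le_of_not_ge fun hji => absurd (t.sgn_mono j i hji) (not_le_of_gt hij)

lemma wts_neg (s : Multiset t.ι) : (s.map fun i => -t.wt i).sum = -t.wts s := by
  induction s using Multiset.induction with
  | empty => simp
  | cons i s ih => rw [Multiset.map_cons, Multiset.sum_cons, ih, wts_cons, neg_add]

lemma wtLE_add_wts {s : Multiset t.ι} (hs : ∀ i ∈ s, t.sgn i = 1) (lam : Wt h) :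
    WtLE h b lam (lam + t.wts s) := by
  unfold WtLE
  rw [add_sub_cancel_left]
  refine AddSubmonoid.multiset_sum_mem _ _ fun γ hγ => ?_
  obtain ⟨i, hi, rfl⟩ := Multiset.mem_map.1 hγ
  exact AddSubmonoid.subset_closure (t.wt_pos i (hs i hi))

lemma wtLE_wts_add {s : Multiset t.ι} (hs : ∀ i ∈ s, t.sgn i = -1) (lam : Wt h) :
    WtLE h b (lam + t.wts s) lam := by
  unfold WtLE
  rw [sub_add_cancel_left, ← wts_neg]
  refine AddSubmonoid.multiset_sum_mem _ _ fun γ hγ => ?_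
  obtain ⟨i, hi, rfl⟩ := Multiset.mem_map.1 hγ
  exact AddSubmonoid.subset_closure (t.wt_neg i (hs i hi))

lemma eq_zero_of_wts_eq_zero {s : Multiset t.ι} (hs : ∀ i ∈ s, t.sgn i = -1) (h0 : t.wts s = 0) :
    s = 0 := by
  have := pointed_affPosRoots (b := b) (s.map fun i => -t.wt i) (by
    intro γ hγ
    obtain ⟨i, hi, rfl⟩ := Multiset.mem_map.1 hγ
    exact t.wt_neg i (hs i hi)) (by
    rw [Multiset.map_id, wts_neg, h0, neg_zero])
  simpa using this

lemma eq_zero_of_wts_eq_zero_of_pos {s : Multiset t.ι} (hs : ∀ i ∈ s, t.sgn i = 1)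
    (h0 : t.wts s = 0) : s = 0 := by
  have := pointed_affPosRoots (b := b) (s.map t.wt) (by
    intro γ hγ
    obtain ⟨i, hi, rfl⟩ := Multiset.mem_map.1 hγ
    exact t.wt_pos i (hs i hi)) (by rw [Multiset.map_id]; exact h0)
  simpa using this

lemma finite_wts_pos (γ : Wt h) : {s | (∀ i ∈ s, t.sgn i = 1) ∧ t.wts s = γ}.Finite := by
  refine finite_sums (b := b) t.wt {i | t.sgn i = 1} (fun i hi => t.wt_pos i hi) (fun γ => ?_) γ
  by_cases hγ : γ = 0
  · convert Set.finite_empty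
    refine Set.eq_empty_of_forall_notMem fun i hi => ?_
    have := pointed_affPosRoots (b := b) {t.wt i} (by
      intro γ' hγ'
      rw [Multiset.mem_singleton.1 hγ']
      exact t.wt_pos i hi.1) (by simp [hi.2, hγ])
    simp at this
  · exact (t.finite_fiber γ hγ).subset fun i hi => hi.2

lemma finite_wts_neg (γ : Wt h) : {s | (∀ i ∈ s, t.sgn i = -1) ∧ t.wts s = γ}.Finite := by
  have : {s | (∀ i ∈ s, t.sgn i = -1) ∧ t.wts s = γ} =
      {s | (∀ i ∈ s, i ∈ {i | t.sgn i = -1}) ∧ (s.map fun i => -t.wt i).sum = -γ} := by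
    ext s
    rw [Set.mem_ofPred, Set.mem_ofPred, wts_neg, neg_inj]
    rfl
  rw [this]
  refine finite_sums (b := b) (fun i => -t.wt i) _ (fun i hi => t.wt_neg i hi) (fun γ => ?_) _
  by_cases hγ : γ = 0
  · convert Set.finite_empty
    refine Set.eq_empty_of_forall_notMem fun i hi => ?_
    have := t.eq_zero_of_wts_eq_zero (s := {i})
      (fun j hj => by rw [Multiset.mem_singleton.1 hj]; exact hi.1) (by simpa [wts, hγ] using hi.2)
    simp at this
  · refine (t.finite_fiber (-γ) (neg_ne_zero.2 hγ)).subset fun i hi => ?_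
    exact neg_eq_iff_eq_neg.1 hi.2

/-! ### Monomials in the basis vectors and their action on weight vectors -/

section Monomials

variable (A : Type u) [CommRing A] [Algebra ℂ A]

/-- The product of a list of basis vectors. -/
def wd (l : List t.ι) : EnvAlg g A := envIncl A (PBW.word t.e l)

/-- The sorted product of a multiset of basis vectors. -/
def mon (s : Multiset t.ι) : EnvAlg g A := envIncl A (PBW.mono t.e s)

@[simp] lemma wd_nil : t.wd A [] = 1 := by simp [wd]

lemma wd_cons (i : t.ι) (l : List t.ι) : t.wd A (i :: l) = act A (t.e i) * t.wd A l := by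
  rw [wd, PBW.word_cons, map_mul]; rfl

lemma wd_append (l l' : List t.ι) : t.wd A (l ++ l') = t.wd A l * t.wd A l' := by
  rw [wd, PBW.word_append, map_mul]; rfl

lemma mon_eq_wd (s : Multiset t.ι) : t.mon A s = t.wd A (s.sort (· ≤ ·)) := rfl

@[simp] lemma mon_zero : t.mon A 0 = 1 := by simp [mon_eq_wd]

/-- The monomials form an `A`-basis of `A ⊗ U(ĝ)`. -/
def monBasis : Module.Basis (Multiset t.ι) A (EnvAlg g A) :=
  Algebra.TensorProduct.basis A (PBW.basis t.e)

lemma monBasis_apply (s : Multiset t.ι) : t.monBasis A s = t.mon A s := by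
  rw [monBasis, Algebra.TensorProduct.basis_apply, PBW.basis_apply]
  rfl

lemma mon_add {s s' : Multiset t.ι} (hs : ∀ i ∈ s, ∀ j ∈ s', t.sgn i < t.sgn j) :
    t.mon A (s + s') = t.mon A s * t.mon A s' := by
  rw [mon, PBW.mono_add t.e fun i hi j hj => t.le_of_sgn_lt (hs i hi j hj), map_mul]
  rfl

lemma mon_add_add {s₁ s₂ s₃ : Multiset t.ι} (h₁ : ∀ i ∈ s₁, t.sgn i = -1)
    (h₂ : ∀ i ∈ s₂, t.sgn i = 0) (h₃ : ∀ i ∈ s₃, t.sgn i = 1) :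
    t.mon A (s₁ + (s₂ + s₃)) = t.mon A s₁ * (t.mon A s₂ * t.mon A s₃) := by
  rw [mon_add, mon_add]
  · intro i hi j hj
    rw [h₂ i hi, h₃ j hj]; decide
  · intro i hi j hj
    rcases Multiset.mem_add.1 hj with hj | hj
    · rw [h₁ i hi, h₂ j hj]; decide
    · rw [h₁ i hi, h₃ j hj]; decide

lemma mon_eq_mul (s : Multiset t.ι) :
    t.mon A s = t.mon A (t.part (-1) s) * (t.mon A (t.part 0 s) * t.mon A (t.part 1 s)) := by
  conv_lhs => rw [← t.part_add_part s]
  exact t.mon_add_add A (fun _ => t.sgn_of_mem_part) (fun _ => t.sgn_of_mem_part)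
    fun _ => t.sgn_of_mem_part

/-- Elements of the Cartan algebra with `e i` as image, for `e i` in the Cartan algebra. -/
def cart (i : t.ι) : AffCartan h :=
  open Classical in if hi : t.sgn i = 0 then (t.exists_cartan i hi).choose else 0

variable {t} in
lemma cartanIncl_cart {i : t.ι} (hi : t.sgn i = 0) : cartanIncl h (t.cart i) = t.e i := by
  rw [cart, dif_pos hi]
  exact (t.exists_cartan i hi).choose_spec.symm

lemma lie_zero {i j : t.ι} (hi : t.sgn i = 0) (hj : t.sgn j = 0) : ⁅t.e i, t.e j⁆ = 0 := by
  rw [← cartanIncl_cart hi, t.lie_cartan, t.wt_zero j hj]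
  simp

/-- Cartan elements commute, so the position of the new factor in the sorted word does not matter.
-/
lemma mon_cons_zero {s : Multiset t.ι} (hs : ∀ i ∈ s, t.sgn i = 0) {i : t.ι} (hi : t.sgn i = 0) :
    t.mon A (i ::ₘ s) = t.mon A s * act A (t.e i) := by
  have : PBW.mono t.e (i ::ₘ s) = PBW.word t.e (s.sort (· ≤ ·) ++ [i]) := by
    refine PBW.word_perm t.e ?_ fun j hj k hk => ?_
    · rw [← Multiset.coe_eq_coe, ← Multiset.coe_add]
      rw [Multiset.sort_eq, Multiset.sort_eq, Multiset.coe_singleton, add_comm]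
      rfl
    · simp only [Multiset.mem_sort, Multiset.mem_cons] at hj hk
      refine t.lie_zero ?_ ?_
      · rcases hj with rfl | hj
        exacts [hi, hs _ hj]
      · rcases hk with rfl | hk
        exacts [hi, hs _ hk]
  rw [mon, this]
  change t.wd A _ = _
  rw [wd_append, wd_cons, wd_nil, mul_one]
  rfl

lemma act_cartan_mul_wd (H : AffCartan h) (l : List t.ι) :
    act A (cartanIncl h H) * t.wd A l = t.wd A l * act A (cartanIncl h H) +
      algebraMap A (EnvAlg g A) (algebraMap ℂ A (t.wts l H)) * t.wd A l := by
  induction l with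
  | nil => simp
  | cons i l ih =>
    have h1 : act A (cartanIncl h H) * act A (t.e i) = act A (t.e i) * act A (cartanIncl h H) +
        algebraMap A (EnvAlg g A) (algebraMap ℂ A (t.wt i H)) * act A (t.e i) := by
      rw [← act_smul', ← t.lie_cartan, act_lie]; abel
    rw [wd_cons, ← mul_assoc, h1, add_mul, mul_assoc, ih, ← Multiset.cons_coe, wts_cons,
      LinearMap.add_apply, map_add, map_add, add_mul, mul_add, mul_assoc, mul_assoc,
      ← mul_assoc (act A (t.e i)) (algebraMap A _ _), ← Algebra.commutes, mul_assoc]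
    abel

lemma wts_sort (s : Multiset t.ι) : t.wts (s.sort (· ≤ ·) : List t.ι) = t.wts s := by
  rw [Multiset.sort_eq]

variable {A}

lemma exists_mon_sum (r : EnvAlg g A) : ∃ c : Multiset t.ι →₀ A,
    r = c.sum fun s a => algebraMap A (EnvAlg g A) a * t.mon A s := by
  refine ⟨(t.monBasis A).repr r, ?_⟩
  conv_lhs => rw [← (t.monBasis A).linearCombination_repr r]
  rw [Finsupp.linearCombination_apply]
  simp only [monBasis_apply, Algebra.smul_def]

lemma act_eq_sum (x : AffineLie g) : act A x = (t.e.repr x).sum fun i c =>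
    algebraMap A (EnvAlg g A) (algebraMap ℂ A c) * act A (t.e i) := by
  conv_lhs => rw [← t.e.linearCombination_repr x]
  rw [Finsupp.linearCombination_apply, Finsupp.sum, act_sum]
  simp only [act_smul']
  rfl

variable [Algebra (SymmetricAlgebra ℂ h) A] {M : GMod g A}

lemma act_smul_mem {μ : Wt h} {m : M} (hm : m ∈ wtSpace h M μ) (i : t.ι) :
    act A (t.e i) • m ∈ wtSpace h M (μ + t.wt i) := by
  intro H
  have h1 : act A (cartanIncl h H) * act A (t.e i) = act A (t.e i) * act A (cartanIncl h H) +
      algebraMap A (EnvAlg g A) (algebraMap ℂ A (t.wt i H)) * act A (t.e i) := by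
    rw [← act_smul', ← t.lie_cartan, act_lie]; abel
  rw [← mul_smul, h1, add_smul, mul_smul, mul_smul, hm H, act_smul_comm, wtScalar_add, add_smul]
  rfl

lemma wd_smul_mem {μ : Wt h} {m : M} (hm : m ∈ wtSpace h M μ) (l : List t.ι) :
    t.wd A l • m ∈ wtSpace h M (μ + t.wts l) := by
  induction l with
  | nil => simpa using hm
  | cons i l ih =>
    rw [wd_cons, mul_smul, ← Multiset.cons_coe, wts_cons, add_comm (t.wt i), ← add_assoc]
    exact t.act_smul_mem ih i

lemma mon_smul_mem {μ : Wt h} {m : M} (hm : m ∈ wtSpace h M μ) (s : Multiset t.ι) :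
    t.mon A s • m ∈ wtSpace h M (μ + t.wts s) := by
  rw [← t.wts_sort]
  exact t.wd_smul_mem hm _

lemma smul_mem_iSup (t : TriBasis h b) (r : EnvAlg g A) {m : M} (hm : m ∈ ⨆ μ, wtSpace h M μ) :
    r • m ∈ ⨆ μ, wtSpace h M μ := by
  refine env_smul_mem (fun x n hn => ?_) r hm
  refine Submodule.iSup_induction (motive := fun n => act A x • n ∈ ⨆ μ, wtSpace h M μ) _ hn
    (fun μ m hm => ?_) (by simp) fun y z hy hz => by rw [smul_add]; exact add_mem hy hz
  rw [t.act_eq_sum, Finsupp.sum, Finset.sum_smul]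
  refine Submodule.sum_mem _ fun i _ => ?_
  rw [mul_smul, ← base_smul_def]
  exact Submodule.smul_mem _ _ (Submodule.mem_iSup_of_mem _ (t.act_smul_mem hm i))

/-- A module that is generated by weight vectors is a weight module. -/
lemma isWeightModule_of_span (t : TriBasis h b) {S : Set M} (hS : ∀ m ∈ S, ∃ μ, m ∈ wtSpace h M μ)
    (hspan : Submodule.span (EnvAlg g A) S = ⊤) : IsWeightModule h M := by
  refine isWeightModule_of_iSup (eq_top_iff.2 fun m _ => ?_)
  have hm : m ∈ Submodule.span (EnvAlg g A) S := by rw [hspan]; trivial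
  induction hm using Submodule.span_induction with
  | mem x hx =>
    obtain ⟨μ, hμ⟩ := hS x hx
    exact Submodule.mem_iSup_of_mem μ hμ
  | zero => exact zero_mem _
  | add x y _ _ hx hy => exact add_mem (hx trivial) (hy trivial)
  | smul r x _ hx => exact t.smul_mem_iSup r (hx trivial)

/-- The weight vectors in the submodule generated by a weight vector. -/
lemma mem_span_mon {lam ν : Wt h} {m : M} (hm : m ∈ wtSpace h M lam) {r : EnvAlg g A}
    (hr : r • m ∈ wtSpace h M ν) :
    r • m ∈ Submodule.span A {x | ∃ s, lam + t.wts s = ν ∧ x = t.mon A s • m} := by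
  classical
  obtain ⟨c, hc⟩ := t.exists_mon_sum r
  let f : Wt h → M := fun μ =>
    ∑ s ∈ c.support.filter fun s => lam + t.wts s = μ, c s • t.mon A s • m
  let F : Finset (Wt h) := c.support.image fun s => lam + t.wts s
  have hsum : r • m = ∑ μ ∈ F, f μ := by
    rw [hc, Finsupp.sum, Finset.sum_smul]
    simp only [mul_smul, ← base_smul_def, f]
    exact (Finset.sum_fiberwise_of_maps_to
      (fun s hs => Finset.mem_image_of_mem _ hs) _).symm
  have hf : ∀ μ, f μ ∈ wtSpace h M μ := fun μ => Submodule.sum_mem _ fun s hs => by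
    rw [← (Finset.mem_filter.1 hs).2]
    exact Submodule.smul_mem _ _ (t.mon_smul_mem hm s)
  have hF : ∀ μ ∉ F, f μ = 0 := fun μ hμ => Finset.sum_eq_zero fun s hs => by
    refine absurd (Finset.mem_image.2 ⟨s, (Finset.mem_filter.1 hs).1, ?_⟩) hμ
    exact (Finset.mem_filter.1 hs).2
  obtain ⟨p, hp⟩ := exists_wtProj (A := A) F ν
  have h1 : r • m = f ν := by
    rw [← (hp M).2.1 _ hr, hsum]
    exact wtProj_sum subset_rfl hf hF (hp M).1 (hp M).2.1
  rw [h1]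
  refine Submodule.sum_mem _ fun s hs => Submodule.smul_mem _ _ (Submodule.subset_span ?_)
  exact ⟨s, (Finset.mem_filter.1 hs).2, rfl⟩

/-- A weight module with finitely generated weight spaces and weights in a locally bounded set lies
in the category `Ô`. -/
lemma catO_of_fg (t : TriBasis h b) {J : Set (Wt h)} (hJ : IsLocBddWts h b J) (hM : IsWeightModule h M)
    (hw : ∀ μ, wtSpace h M μ ≠ ⊥ → μ ∈ J) (hfg : ∀ μ, (wtSpace h M μ).FG) :
    catO h b A M := by
  refine ⟨hM, fun m => ?_⟩
  obtain ⟨F, f, hf, hF, rfl⟩ := hM.exists_sum m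
  let G : Set (Wt h) := ⋃ μ ∈ F, {γ | γ ∈ J ∧ WtLE h b μ γ}
  have hG : G.Finite := F.finite_toSet.biUnion fun μ _ => hJ μ
  -- The Borel subalgebra only raises weights, and by local boundedness finitely many weights of `J`
  -- lie above those of the given vector.
  refine ⟨⨆ γ ∈ G, wtSpace h M γ, ?_, ?_, ?_⟩
  · refine Submodule.sum_mem _ fun μ hμ => ?_
    by_cases h0 : f μ = 0
    · rw [h0]; exact zero_mem _
    have hμJ : μ ∈ J := hw μ fun hbot => h0 ((Submodule.eq_bot_iff _).1 hbot _ (hf μ))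
    refine Submodule.mem_iSup_of_mem μ (Submodule.mem_iSup_of_mem ?_ (hf μ))
    exact Set.mem_biUnion hμ ⟨hμJ, WtLE.refl μ⟩
  · have : Finite G := hG
    rw [iSup_subtype']
    exact Submodule.fg_iSup _ fun γ => hfg γ
  · intro x hx n hn
    rw [iSup_subtype'] at hn ⊢
    refine Submodule.iSup_induction
      (motive := fun n => act A x • n ∈ ⨆ γ : G, wtSpace h M (γ : Wt h)) _ hn
      (fun γ m hm => ?_) (by simp) fun y z hy hz => by rw [smul_add]; exact add_mem hy hz
    rw [t.act_eq_sum, Finsupp.sum, Finset.sum_smul]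
    refine Submodule.sum_mem _ fun i hi => ?_
    rw [mul_smul, ← base_smul_def]
    refine Submodule.smul_mem _ _ ?_
    have h1 := t.act_smul_mem hm i
    by_cases h0 : act A (t.e i) • m = 0
    · rw [h0]; exact zero_mem _
    have hJ' : (γ : Wt h) + t.wt i ∈ J :=
      hw _ fun hbot => h0 ((Submodule.eq_bot_iff _).1 hbot _ h1)
    have hle : WtLE h b γ (γ + t.wt i) := by
      rcases SignType.trichotomy (t.sgn i) with hs | hs | hs
      · exact absurd (t.borel_repr x hx i hs) (Finsupp.mem_support_iff.1 hi)
      · rw [t.wt_zero i hs, add_zero]; exact WtLE.refl _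
      · have := t.wtLE_add_wts (s := {i}) (by simpa using hs) γ
        simpa [wts] using this
    obtain ⟨μ, hμ, -, hμγ⟩ : ∃ μ ∈ F, (γ : Wt h) ∈ J ∧ WtLE h b μ γ := by
      have := γ.2
      simp only [G, Set.mem_iUnion] at this
      obtain ⟨μ, hμ, h2⟩ := this
      exact ⟨μ, hμ, h2⟩
    exact Submodule.mem_iSup_of_mem (⟨_, Set.mem_biUnion hμ ⟨hJ', hμγ.trans hle⟩⟩ : G) h1

end Monomials

end TriBasis

end AffineO

end

noncomputable section

set_option linter.unusedSectionVars false

namespace AffineO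

/-! ### The modules that represent weight spaces -/

section WtScalar

variable {g : Type u} [LieRing g] [LieAlgebra ℂ g] (h : LieSubalgebra ℂ g)
variable (A : Type u) [CommRing A] [Algebra ℂ A] [Algebra (SymmetricAlgebra ℂ h) A]
  [IsScalarTower ℂ (SymmetricAlgebra ℂ h) A]

/-- The map `lam + τ` as a linear map. -/
def wtScalarLin (lam : Wt h) : AffCartan h →ₗ[ℂ] A :=
  Algebra.linearMap ℂ A ∘ₗ lam + (IsScalarTower.toAlgHom ℂ (SymmetricAlgebra ℂ h) A).toLinearMap ∘ₗ
    SymmetricAlgebra.ι ℂ h ∘ₗ LinearMap.fst ℂ h (ℂ × ℂ)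

lemma wtScalarLin_apply (lam : Wt h) (H : AffCartan h) :
    wtScalarLin h A lam H = wtScalar h A lam H := rfl

/-- The inclusion of the Cartan algebra as a linear map. -/
def cartanInclLin : AffCartan h →ₗ[ℂ] AffineLie g where
  toFun := cartanIncl h
  map_add' H H' := by ext1 <;> simp [cartanIncl]
  map_smul' c H := by ext1 <;> simp [cartanIncl]

lemma cartanInclLin_apply (H : AffCartan h) : cartanInclLin h H = cartanIncl h H := rfl

lemma cartanIncl_injective : Function.Injective (cartanIncl h) := by
  intro H H' hH
  refine Prod.ext (Subtype.ext ?_) (Prod.ext ?_ ?_)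
  · exact Finsupp.single_injective 0 (congrArg AffineLie.loop hH)
  · exact congrArg AffineLie.cK hH
  · exact congrArg AffineLie.cD hH

end WtScalar

namespace TriBasis

variable {g : Type u} [LieRing g] [LieAlgebra ℂ g] [FiniteDimensional ℂ g] [LieAlgebra.IsKilling ℂ g]
variable {h : LieSubalgebra ℂ g} [h.IsCartanSubalgebra] {b : LieSubalgebra ℂ g}
variable [LieAlgebra.IsSolvable b]
variable (t : TriBasis h b)
variable (A : Type u) [CommRing A] [Algebra ℂ A] [Algebra (SymmetricAlgebra ℂ h) A]

lemma eq_sum_cart (H : AffCartan h) :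
    H = (t.e.repr (cartanIncl h H)).sum fun i c => c • t.cart i := by
  apply cartanIncl_injective
  conv_lhs => rw [← t.e.linearCombination_repr (cartanIncl h H)]
  rw [Finsupp.linearCombination_apply, ← cartanInclLin_apply h (Finsupp.sum _ _), Finsupp.sum,
    Finsupp.sum, map_sum]
  refine Finset.sum_congr rfl fun i hi => ?_
  rw [map_smul, cartanInclLin_apply, cartanIncl_cart]
  by_contra hs
  exact Finsupp.mem_support_iff.1 hi (t.cartan_repr H i hs)

/-- The left ideal generated by the elements `H - (lam + τ)(H)`, for `H ∈ ĥ`, and the products of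
positive root vectors that raise the weight `lam` to a weight outside `J`. -/
def projIdeal (J : Set (Wt h)) (lam : Wt h) : Submodule (EnvAlg g A) (EnvAlg g A) :=
  Submodule.span (EnvAlg g A)
    (Set.range (fun H : AffCartan h =>
        act A (cartanIncl h H) - algebraMap A (EnvAlg g A) (wtScalar h A lam H)) ∪
      {r | ∃ l : List t.ι, (∀ i ∈ l, t.sgn i = 1) ∧ lam + t.wts l ∉ J ∧ r = t.wd A l})

/-- The module that represents the functor of vectors of weight `lam`. -/
def projMod (J : Set (Wt h)) (lam : Wt h) : GMod g A :=
  ModuleCat.of (EnvAlg g A) (EnvAlg g A ⧸ t.projIdeal A J lam)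

/-- The generator. -/
def gen (J : Set (Wt h)) (lam : Wt h) : t.projMod A J lam :=
  Submodule.Quotient.mk (p := t.projIdeal A J lam) 1

variable {A} {J : Set (Wt h)} {lam : Wt h}

lemma smul_gen (r : EnvAlg g A) :
    r • t.gen A J lam = Submodule.Quotient.mk (p := t.projIdeal A J lam) r := by
  change Submodule.Quotient.mk (p := t.projIdeal A J lam) (r • 1) = _
  rw [smul_eq_mul, mul_one]

lemma exists_smul_gen (x : t.projMod A J lam) : ∃ r : EnvAlg g A, r • t.gen A J lam = x := by
  obtain ⟨r, rfl⟩ := Submodule.Quotient.mk_surjective _ x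
  exact ⟨r, t.smul_gen r⟩

lemma smul_gen_eq_zero {r : EnvAlg g A} : r • t.gen A J lam = 0 ↔ r ∈ t.projIdeal A J lam := by
  rw [smul_gen]
  exact Submodule.Quotient.mk_eq_zero _

lemma gen_mem : t.gen A J lam ∈ wtSpace h (t.projMod A J lam) lam := by
  intro H
  rw [base_smul_def, ← sub_eq_zero, ← sub_smul, smul_gen_eq_zero]
  exact Submodule.subset_span (Or.inl ⟨H, rfl⟩)

lemma wd_smul_gen {l : List t.ι} (hl : ∀ i ∈ l, t.sgn i = 1) (hJ : lam + t.wts l ∉ J) :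
    t.wd A l • t.gen A J lam = 0 :=
  t.smul_gen_eq_zero.2 (Submodule.subset_span (Or.inr ⟨l, hl, hJ, rfl⟩))

lemma projMod_ext {M : GMod g A} {f f' : t.projMod A J lam →ₗ[EnvAlg g A] M}
    (hf : f (t.gen A J lam) = f' (t.gen A J lam)) : f = f' := by
  ext x
  obtain ⟨r, rfl⟩ := t.exists_smul_gen x
  rw [map_smul, map_smul, hf]

/-- The relations of `projMod` hold for every vector of weight `lam` in a module with weights in
`J`: a positive word that leaves `J` must kill it. -/
lemma exists_projMod_hom {M : GMod g A} (hM : ∀ μ, wtSpace h M μ ≠ ⊥ → μ ∈ J) {m : M}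
    (hm : m ∈ wtSpace h M lam) :
    ∃ f : t.projMod A J lam →ₗ[EnvAlg g A] M, f (t.gen A J lam) = m := by
  have hle : t.projIdeal A J lam ≤ LinearMap.ker (LinearMap.toSpanSingleton (EnvAlg g A) M m) := by
    refine Submodule.span_le.2 ?_
    rintro _ (⟨H, rfl⟩ | ⟨l, hl, hJ, rfl⟩)
    · rw [SetLike.mem_coe, LinearMap.mem_ker, LinearMap.toSpanSingleton_apply, sub_smul, hm H,
        ← base_smul_def, sub_self]
    · rw [SetLike.mem_coe, LinearMap.mem_ker, LinearMap.toSpanSingleton_apply]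
      by_contra hne
      exact hJ (hM _ fun hbot => hne ((Submodule.eq_bot_iff _).1 hbot _ (t.wd_smul_mem hm l)))
  refine ⟨(t.projIdeal A J lam).liftQ _ hle, ?_⟩
  exact ((t.projIdeal A J lam).liftQ_apply _ 1).trans (one_smul _ m)

lemma isWeightModule_projMod : IsWeightModule h (t.projMod A J lam) := by
  refine t.isWeightModule_of_span (S := {t.gen A J lam}) ?_ (eq_top_iff.2 fun x _ => ?_)
  · rintro m rfl
    exact ⟨lam, t.gen_mem⟩
  · obtain ⟨r, rfl⟩ := t.exists_smul_gen x
    exact Submodule.smul_mem _ r (Submodule.mem_span_singleton_self _)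

/-- Monomials in the Cartan algebra act on weight vectors by scalars. -/
lemma exists_mon_zero_smul (μ : Wt h) {s : Multiset t.ι} (hs : ∀ i ∈ s, t.sgn i = 0) :
    ∃ a : A, ∀ (M : GMod g A), ∀ m ∈ wtSpace h M μ, t.mon A s • m = a • m := by
  induction s using Multiset.induction with
  | empty => exact ⟨1, by simp⟩
  | cons i s ih =>
    obtain ⟨a, ha⟩ := ih fun i hi => hs i (by simp [hi])
    have hi := hs i (by simp)
    refine ⟨wtScalar h A μ (t.cart i) * a, fun M m hm => ?_⟩
    rw [t.mon_cons_zero A (fun i hi => hs i (by simp [hi])) hi, mul_smul, ← cartanIncl_cart hi, hm,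
      base_smul_def, ← mul_smul, ← Algebra.commutes, mul_smul, ha M m hm, ← base_smul_def, smul_smul]

/-- The pairs of multisets of negative and positive root vectors whose monomials span a weight
space. -/
def weightPairs (J : Set (Wt h)) (lam ν : Wt h) : Set (Multiset t.ι × Multiset t.ι) :=
  {p | (∀ i ∈ p.1, t.sgn i = -1) ∧ (∀ i ∈ p.2, t.sgn i = 1) ∧ lam + t.wts p.2 ∈ J ∧
    lam + t.wts p.2 + t.wts p.1 = ν}

lemma finite_weightPairs (hJ : IsLocBddWts h b J) (ν : Wt h) :
    (t.weightPairs J lam ν).Finite := by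
  refine ((hJ ν).biUnion fun γ _ =>
    (t.finite_wts_neg (ν - γ)).prod (t.finite_wts_pos (γ - lam))).subset ?_
  rintro ⟨s, s'⟩ ⟨h1, h2, h3, h4⟩
  refine Set.mem_biUnion (x := lam + t.wts s') ⟨h3, ?_⟩ ⟨⟨h1, ?_⟩, h2, ?_⟩
  · rw [← h4]; exact t.wtLE_wts_add h1 _
  · rw [← h4]; abel
  · simp

/-- In a sorted monomial the positive factors act first and give zero if they leave `J`; the Cartan
factors then act by a scalar, and the negative factors remain. -/
lemma mem_span_weightPairs {ν : Wt h} {x : t.projMod A J lam}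
    (hx : x ∈ wtSpace h (t.projMod A J lam) ν) :
    x ∈ Submodule.span A ((fun p : Multiset t.ι × Multiset t.ι =>
      t.mon A p.1 • t.mon A p.2 • t.gen A J lam) '' t.weightPairs J lam ν) := by
  obtain ⟨r, rfl⟩ := t.exists_smul_gen x
  refine Submodule.span_le.2 ?_ (t.mem_span_mon t.gen_mem hx)
  rintro _ ⟨s, hs, rfl⟩
  rw [t.mon_eq_mul A s, mul_smul, mul_smul]
  by_cases hJ : lam + t.wts (t.part 1 s) ∈ J
  · obtain ⟨a, ha⟩ := t.exists_mon_zero_smul (A := A) (lam + t.wts (t.part 1 s))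
      (s := t.part 0 s) fun i => t.sgn_of_mem_part
    rw [ha _ _ (t.mon_smul_mem t.gen_mem _), base_smul_def, ← mul_smul, ← Algebra.commutes, mul_smul, ← base_smul_def]
    refine Submodule.smul_mem _ _ (Submodule.subset_span ⟨(t.part (-1) s, t.part 1 s), ?_, rfl⟩)
    refine ⟨fun i => t.sgn_of_mem_part, fun i => t.sgn_of_mem_part, hJ, ?_⟩
    rw [← hs]
    conv_rhs => rw [← t.part_add_part s]
    rw [wts_add, wts_add, t.wts_part_zero (s := t.part 0 s) fun i => t.sgn_of_mem_part]
    abel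
  · have : t.mon A (t.part 1 s) • t.gen A J lam = 0 := by
      rw [mon_eq_wd]
      refine t.wd_smul_gen (fun i hi => ?_) (by rwa [t.wts_sort])
      exact t.sgn_of_mem_part (s := s) (by simpa using hi)
    rw [this, smul_zero, smul_zero]
    exact zero_mem _

lemma fg_wtSpace_projMod [IsNoetherianRing A] (hJ : IsLocBddWts h b J) (ν : Wt h) :
    (wtSpace h (t.projMod A J lam) ν).FG := by
  refine Submodule.FG.of_le (Submodule.fg_span ((t.finite_weightPairs (lam := lam) hJ ν).image
    fun p => t.mon A p.1 • t.mon A p.2 • t.gen A J lam)) fun x hx => ?_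
  exact t.mem_span_weightPairs hx

lemma mem_of_wtSpace_projMod_ne_bot (hJo : IsOpenWts h b J) {ν : Wt h}
    (hν : wtSpace h (t.projMod A J lam) ν ≠ ⊥) : ν ∈ J := by
  obtain ⟨x, hx, hx0⟩ := Submodule.exists_mem_ne_zero_of_ne_bot hν
  have h1 := t.mem_span_weightPairs hx
  rcases Set.eq_empty_or_nonempty (t.weightPairs J lam ν) with h0 | ⟨p, hp1, -, h3, h4⟩
  · rw [h0, Set.image_empty, Submodule.span_empty, Submodule.mem_bot] at h1
    exact absurd h1 hx0
  · rw [← h4]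
    exact hJo _ h3 _ (t.wtLE_wts_add hp1 _)

lemma catOTrunc_projMod [IsNoetherianRing A] (hJo : IsOpenWts h b J) (hJ : IsLocBddWts h b J) :
    catOTrunc h b A J (t.projMod A J lam) :=
  have hw := fun _ => t.mem_of_wtSpace_projMod_ne_bot (A := A) (lam := lam) hJo
  ⟨t.catO_of_fg hJ t.isWeightModule_projMod hw (t.fg_wtSpace_projMod hJ), hw⟩

/-- Projectivity: maps from `projMod` are vectors of weight `lam`, and these lift along surjections
of weight modules. -/
lemma exists_projMod_lift {M N : GMod g A} (hM : catOTrunc h b A J M)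
    {f : M →ₗ[EnvAlg g A] N} (hf : Function.Surjective f) (f' : t.projMod A J lam →ₗ[EnvAlg g A] N) :
    ∃ f'' : t.projMod A J lam →ₗ[EnvAlg g A] M, f ∘ₗ f'' = f' := by
  obtain ⟨m, hm, hm'⟩ := exists_lift_wtSpace f hf hM.1.1 (map_mem_wtSpace f' t.gen_mem)
  obtain ⟨f'', hf''⟩ := t.exists_projMod_hom hM.2 hm
  exact ⟨f'', t.projMod_ext (by rw [LinearMap.comp_apply, hf'', hm'])⟩

/-! ### Linear independence of the spanning monomials -/

section Independence

variable (A J lam)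

/-- The projection onto the span of the monomials without factors in the Cartan algebra and without
positive part that raises `lam` to a weight outside `J`. -/
def reduced : EnvAlg g A →ₗ[A] (Multiset t.ι →₀ A) :=
  open Classical in (t.monBasis A).constr A fun s =>
    -- The Cartan factors act after the positive ones, hence on a vector of weight `lam + wts (part
    -- 1 s)`; this determines the scalar.
    if lam + t.wts (t.part 1 s) ∈ J then
      Finsupp.single (t.part (-1) s + t.part 1 s)
        ((t.part 0 s).map fun i => wtScalar h A (lam + t.wts (t.part 1 s)) (t.cart i)).prod
    else 0

variable {A J lam}

lemma reduced_mon_of_notMem {s : Multiset t.ι} (hs : lam + t.wts (t.part 1 s) ∉ J) :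
    t.reduced A J lam (t.mon A s) = 0 := by
  rw [← monBasis_apply, reduced, Module.Basis.constr_basis, if_neg hs]

lemma reduced_mon_of_mem {s : Multiset t.ι} (hs : lam + t.wts (t.part 1 s) ∈ J) :
    t.reduced A J lam (t.mon A s) = Finsupp.single (t.part (-1) s + t.part 1 s)
        ((t.part 0 s).map fun i => wtScalar h A (lam + t.wts (t.part 1 s)) (t.cart i)).prod := by
  rw [← monBasis_apply, reduced, Module.Basis.constr_basis, if_pos hs]

lemma reduced_algebraMap_mul (a : A) (x : EnvAlg g A) :
    t.reduced A J lam (algebraMap A (EnvAlg g A) a * x) = a • t.reduced A J lam x := by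
  rw [← Algebra.smul_def, map_smul]

lemma wd_mem_span {l : List t.ι} (hl : ∀ i ∈ l, t.sgn i = 1) : t.wd A l ∈ Submodule.span A
    {x | ∃ s : Multiset t.ι, (∀ i ∈ s, t.sgn i = 1) ∧ t.wts s = t.wts l ∧ x = t.mon A s} := by
  have h1 := PBW.nf_mem_supported t.e t.wt (fun i => t.sgn i = 1) (fun i j hi hj m hm =>
    ⟨t.sgn_of_mem_support hi hj hm, t.wt_of_mem_support hm⟩) l hl
  rw [wd, ← PBW.ofNF_nf, PBW.ofNF, Finsupp.linearCombination_apply, Finsupp.sum, map_sum]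
  refine Submodule.sum_mem _ fun s hs => ?_
  obtain ⟨h2, h3⟩ := (Finsupp.mem_supported _ _).1 h1 hs
  rw [map_smul, ← algebraMap_smul A]
  exact Submodule.smul_mem _ _ (Submodule.subset_span ⟨s, h2, h3, rfl⟩)

lemma mon_mul_act_zero (s : Multiset t.ι) {i : t.ι} (hi : t.sgn i = 0) :
    t.mon A s * act A (t.e i) = t.mon A (i ::ₘ s) -
      algebraMap A (EnvAlg g A) (algebraMap ℂ A (t.wts (t.part 1 s) (t.cart i))) * t.mon A s := by
  have h1 : t.mon A (t.part 1 s) * act A (t.e i) = act A (t.e i) * t.mon A (t.part 1 s) -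
      algebraMap A (EnvAlg g A) (algebraMap ℂ A (t.wts (t.part 1 s) (t.cart i))) *
        t.mon A (t.part 1 s) := by
    rw [mon_eq_wd, ← cartanIncl_cart hi, act_cartan_mul_wd, wts_sort]
    abel
  have h2 : i ::ₘ s = t.part (-1) s + (i ::ₘ t.part 0 s + t.part 1 s) := by
    conv_lhs => rw [← t.part_add_part s]
    rw [Multiset.cons_add, Multiset.add_cons]
  have h3 : ∀ j ∈ i ::ₘ t.part 0 s, t.sgn j = 0 := by
    intro j hj
    rcases Multiset.mem_cons.1 hj with rfl | hj
    exacts [hi, t.sgn_of_mem_part hj]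
  rw [h2, t.mon_add_add A (fun _ => t.sgn_of_mem_part) h3 fun _ => t.sgn_of_mem_part,
    t.mon_cons_zero A (fun _ => t.sgn_of_mem_part) hi]
  conv_lhs => rw [t.mon_eq_mul A s]
  conv_rhs => rw [t.mon_eq_mul A s]
  rw [mul_assoc, mul_assoc, h1, mul_sub, mul_sub]
  simp only [mul_assoc, Algebra.left_comm]

/-- Moving a Cartan element from the right end to the Cartan part of the monomial changes the scalar
from `lam` to `lam + wts (part 1 s)`, which is the scalar used by `reduced`. -/
lemma reduced_mon_mul_cartan [IsScalarTower ℂ (SymmetricAlgebra ℂ h) A] (s : Multiset t.ι)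
    (H : AffCartan h) : t.reduced A J lam (t.mon A s *
      (act A (cartanIncl h H) - algebraMap A (EnvAlg g A) (wtScalar h A lam H))) = 0 := by
  have key : ∀ i, t.sgn i = 0 → t.reduced A J lam (t.mon A s *
      (act A (t.e i) - algebraMap A (EnvAlg g A) (wtScalar h A lam (t.cart i)))) = 0 := by
    intro i hi
    have h1 : t.mon A s * (act A (t.e i) - algebraMap A (EnvAlg g A) (wtScalar h A lam (t.cart i))) =
        t.mon A (i ::ₘ s) - algebraMap A (EnvAlg g A)
          (wtScalar h A (lam + t.wts (t.part 1 s)) (t.cart i)) * t.mon A s := by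
      rw [mul_sub, mon_mul_act_zero t s hi, wtScalar_add, map_add, add_mul, ← Algebra.commutes]
      abel
    have e1 : t.part 1 (i ::ₘ s) = t.part 1 s := by simp [part, hi]
    have e2 : t.part (-1) (i ::ₘ s) = t.part (-1) s := by simp [part, hi]
    have e3 : t.part 0 (i ::ₘ s) = i ::ₘ t.part 0 s := by simp [part, hi]
    rw [h1, map_sub, reduced_algebraMap_mul]
    by_cases hs : lam + t.wts (t.part 1 s) ∈ J
    · rw [t.reduced_mon_of_mem hs, t.reduced_mon_of_mem (by rwa [e1]), e1, e2, e3, Multiset.map_cons,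
        Multiset.prod_cons, Finsupp.smul_single, smul_eq_mul, sub_self]
    · rw [t.reduced_mon_of_notMem hs, t.reduced_mon_of_notMem (by rwa [e1]), smul_zero, sub_zero]
  have h2 : act A (cartanIncl h H) - algebraMap A (EnvAlg g A) (wtScalar h A lam H) =
      ∑ i ∈ (t.e.repr (cartanIncl h H)).support, algebraMap A (EnvAlg g A)
        (algebraMap ℂ A (t.e.repr (cartanIncl h H) i)) *
          (act A (t.e i) - algebraMap A (EnvAlg g A) (wtScalar h A lam (t.cart i))) := by
    simp only [mul_sub, Finset.sum_sub_distrib]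
    congr 1
    · exact t.act_eq_sum _
    · conv_lhs => rw [← wtScalarLin_apply, t.eq_sum_cart H, Finsupp.sum, map_sum, map_sum]
      refine Finset.sum_congr rfl fun i _ => ?_
      rw [map_smul, wtScalarLin_apply, ← map_mul, Algebra.smul_def]
  rw [h2, Finset.mul_sum, map_sum]
  refine Finset.sum_eq_zero fun i hi => ?_
  rw [Algebra.left_comm, reduced_algebraMap_mul, key i, smul_zero]
  by_contra hs
  exact Finsupp.mem_support_iff.1 hi (t.cartan_repr H i hs)

/-- The positive part of `s` followed by `l` straightens to positive monomials of the same total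
weight. If that weight led from `lam` into `J`, so would the smaller weight of `l`, since `J` is
open. -/
lemma reduced_mon_mul_wd (hJo : IsOpenWts h b J) (s : Multiset t.ι) {l : List t.ι}
    (hl : ∀ i ∈ l, t.sgn i = 1) (hlJ : lam + t.wts l ∉ J) :
    t.reduced A J lam (t.mon A s * t.wd A l) = 0 := by
  have h1 : ∀ i ∈ (t.part 1 s).sort (· ≤ ·) ++ l, t.sgn i = 1 := by
    intro i hi
    rcases List.mem_append.1 hi with hi | hi
    · exact t.sgn_of_mem_part (s := s) (by simpa using hi)
    · exact hl i hi
  have h2 := t.wd_mem_span (A := A) h1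
  rw [t.mon_eq_mul A s, mul_assoc, mul_assoc, t.mon_eq_wd A (t.part 1 s), ← wd_append]
  refine Submodule.span_induction (p := fun y _ => t.reduced A J lam (t.mon A (t.part (-1) s) *
    (t.mon A (t.part 0 s) * y)) = 0) ?_ (by simp) ?_ ?_ h2
  · rintro _ ⟨s', hs', hw, rfl⟩
    rw [← t.mon_add_add A (fun _ => t.sgn_of_mem_part) (fun _ => t.sgn_of_mem_part) hs',
      reduced_mon_of_notMem]
    rw [part_add, part_add, t.part_eq_zero (s := t.part (-1) s) (fun _ => t.sgn_of_mem_part)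
      (by decide), t.part_eq_zero (s := t.part 0 s) (fun _ => t.sgn_of_mem_part) (by decide),
      t.part_eq_self hs', zero_add, zero_add, hw, ← Multiset.coe_add, wts_add, wts_sort,
      add_comm (t.wts (t.part 1 s)), ← add_assoc]
    exact fun hJ => hlJ (hJo _ hJ _ (t.wtLE_add_wts (fun _ => t.sgn_of_mem_part) _))
  · intro x y _ _ hx hy
    rw [mul_add, mul_add, map_add, hx, hy, add_zero]
  · intro a x _ hx
    rw [mul_smul_comm, mul_smul_comm, map_smul, hx, smul_zero]

lemma reduced_eq_zero [IsScalarTower ℂ (SymmetricAlgebra ℂ h) A] (hJo : IsOpenWts h b J)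
    {x : EnvAlg g A} (hx : x ∈ t.projIdeal A J lam) : t.reduced A J lam x = 0 := by
  have ext : ∀ y : EnvAlg g A, (∀ s, t.reduced A J lam (t.mon A s * y) = 0) →
      ∀ r, t.reduced A J lam (r * y) = 0 := by
    intro y hy r
    obtain ⟨c, rfl⟩ := t.exists_mon_sum r
    rw [Finsupp.sum, Finset.sum_mul, map_sum]
    refine Finset.sum_eq_zero fun s _ => ?_
    rw [mul_assoc, reduced_algebraMap_mul, hy, smul_zero]
  have : ∀ r, t.reduced A J lam (r * x) = 0 := by
    induction hx using Submodule.span_induction with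
    | mem y hy =>
      refine ext y fun s => ?_
      rcases hy with ⟨H, rfl⟩ | ⟨l, hl, hlJ, rfl⟩
      · exact t.reduced_mon_mul_cartan s H
      · exact t.reduced_mon_mul_wd hJo s hl hlJ
    | zero => simp
    | add y z _ _ hy hz => intro r; rw [mul_add, map_add, hy, hz, add_zero]
    | smul r' y _ hy => intro r; rw [smul_eq_mul, ← mul_assoc, hy]
  simpa using this 1

variable (A lam) in
/-- The map on the module that is induced by `reduced`. -/
def reducedMod [IsScalarTower ℂ (SymmetricAlgebra ℂ h) A] (hJo : IsOpenWts h b J) :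
    t.projMod A J lam →ₗ[A] (Multiset t.ι →₀ A) where
  toFun := QuotientAddGroup.lift (t.projIdeal A J lam).toAddSubgroup
    (t.reduced A J lam).toAddMonoidHom fun _ hx => t.reduced_eq_zero hJo hx
  map_add' := map_add _
  map_smul' a x := by
    obtain ⟨r, rfl⟩ := Submodule.Quotient.mk_surjective _ x
    exact t.reduced_algebraMap_mul a r

lemma reducedMod_smul_gen [IsScalarTower ℂ (SymmetricAlgebra ℂ h) A] (hJo : IsOpenWts h b J)
    (r : EnvAlg g A) : t.reducedMod A lam hJo (r • t.gen A J lam) = t.reduced A J lam r := by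
  rw [smul_gen]; rfl

lemma reduced_mon_pos {s : Multiset t.ι} (hs : ∀ i ∈ s, t.sgn i = 1) (hJ : lam + t.wts s ∈ J) :
    t.reduced A J lam (t.mon A s) = Finsupp.single s 1 := by
  rw [t.reduced_mon_of_mem (by rwa [t.part_eq_self hs]), t.part_eq_self hs,
    t.part_eq_zero hs (by decide), t.part_eq_zero hs (by decide)]
  simp

/-- The map `reducedMod` sends the generator to the basis vector of the empty monomial. -/
lemma eq_zero_of_smul_gen_eq_zero [IsScalarTower ℂ (SymmetricAlgebra ℂ h) A]
    (hJo : IsOpenWts h b J) (hlam : lam ∈ J) {a : A} (ha : a • t.gen A J lam = 0) : a = 0 := by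
  have h1 := t.reducedMod_smul_gen (A := A) (lam := lam) hJo (t.mon A 0)
  rw [t.reduced_mon_pos (by simp) (by simpa using hlam), mon_zero, one_smul] at h1
  have h2 := congrArg (t.reducedMod A lam hJo) ha
  rw [map_smul, h1, map_zero, Finsupp.smul_single, smul_eq_mul, mul_one] at h2
  exact Finsupp.single_eq_zero.1 h2

/-- The positive monomials that raise `lam` to a maximal weight of `J` form a basis of the weight
space. -/
lemma exists_basis_of_maximal [IsScalarTower ℂ (SymmetricAlgebra ℂ h) A] (hJo : IsOpenWts h b J)
    {ν : Wt h} (hν : ν ∈ J) (hmax : ∀ γ ∈ J, WtLE h b ν γ → γ = ν) :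
    ∃ v : Module.Basis {s : Multiset t.ι // (∀ i ∈ s, t.sgn i = 1) ∧ lam + t.wts s = ν} A
      (wtSpace h (t.projMod A J lam) ν), ∀ s, (v s : t.projMod A J lam) = t.mon A s • t.gen A J lam := by
  let w : {s : Multiset t.ι // (∀ i ∈ s, t.sgn i = 1) ∧ lam + t.wts s = ν} →
      wtSpace h (t.projMod A J lam) ν := fun s =>
    ⟨t.mon A s • t.gen A J lam, by
      have := t.mon_smul_mem (A := A) (t.gen_mem (J := J) (lam := lam)) s.1
      rwa [s.2.2] at this⟩
  have hli : LinearIndependent A w := by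
    refine LinearIndependent.of_comp
      (t.reducedMod A lam hJo ∘ₗ (wtSpace h (t.projMod A J lam) ν).subtype) ?_
    have : (t.reducedMod A lam hJo ∘ₗ (wtSpace h (t.projMod A J lam) ν).subtype) ∘ w =
        (fun s : Multiset t.ι => Finsupp.single s (1 : A)) ∘ Subtype.val := by
      funext s
      simp only [Function.comp_apply, LinearMap.comp_apply, Submodule.subtype_apply, w]
      rw [reducedMod_smul_gen, t.reduced_mon_pos s.2.1 (by rw [s.2.2]; exact hν)]
    rw [this]
    have h1 : LinearIndependent A fun s : Multiset t.ι => Finsupp.single s (1 : A) := by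
      simpa using (Finsupp.basisSingleOne (R := A) (ι := Multiset t.ι)).linearIndependent
    exact h1.comp _ Subtype.val_injective
  have hspan : ⊤ ≤ Submodule.span A (Set.range w) := by
    rintro ⟨x, hx⟩ -
    have h1 := t.mem_span_weightPairs hx
    have h2 : (wtSpace h (t.projMod A J lam) ν).subtype ⟨x, hx⟩ ∈
        (Submodule.span A (Set.range w)).map (wtSpace h (t.projMod A J lam) ν).subtype := by
      rw [Submodule.map_span]
      refine Submodule.span_mono ?_ h1
      rintro _ ⟨⟨s', s⟩, ⟨h3, h4, h5, h6⟩, rfl⟩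
      -- The positive part reaches a weight of `J` above `ν`, thus `ν` itself by maximality, which
      -- leaves no room for negative factors.
      have h7 : lam + t.wts s = ν := by
        refine hmax _ h5 ?_
        rw [← h6]
        exact t.wtLE_wts_add h3 _
      have h8 : s' = 0 := by
        refine t.eq_zero_of_wts_eq_zero h3 ?_
        dsimp only at h6
        rw [h7] at h6
        exact add_eq_left.1 h6
      subst h8
      refine ⟨w ⟨s, h4, h7⟩, ⟨_, rfl⟩, ?_⟩
      simp [w]
    obtain ⟨y, hy, hy'⟩ := h2
    obtain rfl : y = ⟨x, hx⟩ := Subtype.ext hy'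
    exact hy
  exact ⟨Module.Basis.mk hli hspan, fun s => by rw [Module.Basis.mk_apply]⟩

lemma finite_basis_index {ν : Wt h} :
    Finite {s : Multiset t.ι // (∀ i ∈ s, t.sgn i = 1) ∧ lam + t.wts s = ν} := by
  refine ((t.finite_wts_pos (ν - lam)).subset ?_).to_subtype
  rintro s ⟨h1, h2⟩
  exact ⟨h1, by rw [← h2]; abel⟩

lemma free_wtSpace_projMod [IsScalarTower ℂ (SymmetricAlgebra ℂ h) A] (hJo : IsOpenWts h b J)
    {ν : Wt h} (hν : ν ∈ J) (hmax : ∀ γ ∈ J, WtLE h b ν γ → γ = ν) :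
    Module.Free A (wtSpace h (t.projMod A J lam) ν) ∧
      Module.Finite A (wtSpace h (t.projMod A J lam) ν) := by
  obtain ⟨v, -⟩ := t.exists_basis_of_maximal (A := A) (lam := lam) hJo hν hmax
  have := t.finite_basis_index (lam := lam) (ν := ν)
  exact ⟨Module.Free.of_basis v, Module.Finite.of_basis v⟩

/-- For maximal `lam` no positive monomial stays in `J`, and without positive factors no negative
ones can preserve the weight. -/
lemma exists_smul_gen_of_maximal (hmax : ∀ γ ∈ J, WtLE h b lam γ → γ = lam)
    {x : t.projMod A J lam} (hx : x ∈ wtSpace h (t.projMod A J lam) lam) :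
    ∃ a : A, x = a • t.gen A J lam := by
  have h1 := t.mem_span_weightPairs hx
  have h2 : x ∈ Submodule.span A {t.gen A J lam} := by
    refine Submodule.span_mono ?_ h1
    rintro _ ⟨⟨s', s⟩, ⟨h3, h4, h5, h6⟩, rfl⟩
    dsimp only at h3 h4 h5 h6
    have h7 : lam + t.wts s = lam := hmax _ h5 (t.wtLE_add_wts h4 _)
    rw [h7, add_eq_left] at h6
    have h8 : s' = 0 := t.eq_zero_of_wts_eq_zero h3 h6
    have h9 : s = 0 := t.eq_zero_of_wts_eq_zero_of_pos h4 (add_eq_left.1 h7)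
    simp [h8, h9]
  obtain ⟨a, ha⟩ := Submodule.mem_span_singleton.1 h2
  exact ⟨a, ha.symm⟩

end Independence

end TriBasis

end AffineO

end

noncomputable section

set_option linter.unusedSectionVars false

namespace AffineO

/-! ### Highest weight vectors -/

section Order

variable {g : Type u} [LieRing g] [LieAlgebra ℂ g] [FiniteDimensional ℂ g] [LieAlgebra.IsKilling ℂ g]
variable {h : LieSubalgebra ℂ g} [h.IsCartanSubalgebra] {b : LieSubalgebra ℂ g}
variable [LieAlgebra.IsSolvable b]

variable (b) in
lemma exists_maximal_wt {W : Set (Wt h)} (hW : W.Finite) (hne : W.Nonempty) :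
    ∃ ν ∈ W, ∀ γ ∈ W, WtLE h b ν γ → γ = ν := by
  let po : PartialOrder (Wt h) :=
    { le := WtLE h b
      le_refl := WtLE.refl
      le_trans := fun _ _ _ => WtLE.trans
      le_antisymm := fun _ _ => WtLE.antisymm }
  obtain ⟨ν, hν⟩ := hW.exists_maximal hne
  exact ⟨ν, hν.1, fun γ hγ hle => WtLE.antisymm (hν.2 hγ hle) hle⟩

end Order

namespace TriBasis

variable {g : Type u} [LieRing g] [LieAlgebra ℂ g] [FiniteDimensional ℂ g] [LieAlgebra.IsKilling ℂ g]
variable {h : LieSubalgebra ℂ g} [h.IsCartanSubalgebra] {b : LieSubalgebra ℂ g}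
variable [LieAlgebra.IsSolvable b]
variable (t : TriBasis h b)
variable {A : Type u} [CommRing A] [Algebra ℂ A] [Algebra (SymmetricAlgebra ℂ h) A]

/-- Vectors of weight `ν` that are killed by the positive root vectors. -/
def IsHighest {M : GMod g A} (ν : Wt h) (n : M) : Prop :=
  n ∈ wtSpace h M ν ∧ ∀ i, t.sgn i = 1 → act A (t.e i) • n = 0

variable {t} in
lemma IsHighest.map {M N : GMod g A} {ν : Wt h} {n : M} (hn : t.IsHighest ν n)
    (f : M →ₗ[EnvAlg g A] N) : t.IsHighest ν (f n) :=
  ⟨map_mem_wtSpace f hn.1, fun i hi => by rw [← map_smul, hn.2 i hi, map_zero]⟩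

variable {t} in
lemma IsHighest.mon_smul {M : GMod g A} {ν : Wt h} {n : M} (hn : t.IsHighest ν n)
    {s : Multiset t.ι} (hs : t.part 1 s ≠ 0) : t.mon A s • n = 0 := by
  have : ∀ l : List t.ι, l ≠ [] → (∀ i ∈ l, t.sgn i = 1) → t.wd A l • n = 0 := by
    intro l hl hl1
    induction l with
    | nil => exact absurd rfl hl
    | cons i l ih =>
      rw [wd_cons, mul_smul]
      by_cases h0 : l = []
      · rw [h0, wd_nil, one_smul, hn.2 i (hl1 i (by simp))]
      · rw [ih h0 fun j hj => hl1 j (by simp [hj]), smul_zero]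
  rw [mon_eq_mul, mul_smul, mul_smul, mon_eq_wd t A (t.part 1 s), this, smul_zero, smul_zero]
  · intro h0
    apply hs
    rw [← Multiset.sort_eq (t.part 1 s) (· ≤ ·), h0]
    rfl
  · intro i hi
    exact t.sgn_of_mem_part (s := s) (by simpa using hi)

/-- Up to vectors of other weights, the elements of `A ⊗ U(ĝ)` act on highest weight vectors of
weight `ν` by scalars, which do not depend on the vector. -/
lemma exists_character (ν : Wt h) (r : EnvAlg g A) : ∃ a : A, ∀ (M : GMod g A) (n : M),
    t.IsHighest ν n → r • n - a • n ∈ ⨆ μ, ⨆ (_ : μ ≠ ν), wtSpace h M μ := by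
  -- Positive factors kill the vector and negative ones change its weight, so only monomials in the
  -- Cartan algebra contribute.
  have key : ∀ s : Multiset t.ι, ∃ a : A, ∀ (M : GMod g A) (n : M),
      t.IsHighest ν n → t.mon A s • n - a • n ∈ ⨆ μ, ⨆ (_ : μ ≠ ν), wtSpace h M μ := by
    intro s
    by_cases h1 : t.part 1 s = 0
    · by_cases h2 : t.part (-1) s = 0
      · have hs := t.part_add_part s
        rw [h1, h2, zero_add, add_zero] at hs
        obtain ⟨a, ha⟩ := t.exists_mon_zero_smul (A := A) ν (s := s)
          fun i hi => t.sgn_of_mem_part (s := s) (by rwa [hs])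
        exact ⟨a, fun M n hn => by rw [ha M n hn.1, sub_self]; exact zero_mem _⟩
      · refine ⟨0, fun M n hn => ?_⟩
        rw [zero_smul, sub_zero]
        refine Submodule.mem_iSup_of_mem (ν + t.wts s) (Submodule.mem_iSup_of_mem ?_
          (t.mon_smul_mem hn.1 s))
        intro h3
        apply h2
        refine t.eq_zero_of_wts_eq_zero (fun i => t.sgn_of_mem_part) ?_
        rw [add_eq_left] at h3
        rw [← t.part_add_part s, h1, add_zero, wts_add,
          t.wts_part_zero (s := t.part 0 s) (fun i => t.sgn_of_mem_part), add_zero] at h3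
        exact h3
    · exact ⟨0, fun M n hn => by rw [hn.mon_smul h1, zero_smul, sub_zero]; exact zero_mem _⟩
  choose a ha using key
  obtain ⟨c, rfl⟩ := t.exists_mon_sum r
  refine ⟨c.sum fun s x => x * a s, fun M n hn => ?_⟩
  rw [Finsupp.sum, Finsupp.sum, Finset.sum_smul, Finset.sum_smul, ← Finset.sum_sub_distrib]
  refine Submodule.sum_mem _ fun s _ => ?_
  rw [mul_smul, mul_smul, ← base_smul_def, ← smul_sub]
  exact Submodule.smul_mem _ _ (ha s M n hn)

lemma eq_zero_of_mem_iSup_ne {M : GMod g A} {ν : Wt h} {x : M} (hx : x ∈ wtSpace h M ν)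
    (hx' : x ∈ ⨆ μ, ⨆ (_ : μ ≠ ν), wtSpace h M μ) : x = 0 :=
  (Submodule.disjoint_def.1 (iSupIndep_wtSpace M ν)) x hx hx'

variable {t} in
lemma IsHighest.exists_eq_smul {M : GMod g A} {ν : Wt h} {n : M} (hn : t.IsHighest ν n)
    {r : EnvAlg g A} (hr : r • n ∈ wtSpace h M ν) : ∃ a : A, r • n = a • n := by
  obtain ⟨a, ha⟩ := t.exists_character ν r
  exact ⟨a, sub_eq_zero.1 (eq_zero_of_mem_iSup_ne (Submodule.sub_mem _ hr (Submodule.smul_mem _ _ hn.1))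
    (ha M n hn))⟩

variable {t} in
lemma IsHighest.smul_mem_iSup_le {M : GMod g A} {ν : Wt h} {n : M} (hn : t.IsHighest ν n)
    (r : EnvAlg g A) : r • n ∈ ⨆ μ, ⨆ (_ : WtLE h b μ ν), wtSpace h M μ := by
  obtain ⟨c, rfl⟩ := t.exists_mon_sum r
  rw [Finsupp.sum, Finset.sum_smul]
  refine Submodule.sum_mem _ fun s _ => ?_
  rw [mul_smul, ← base_smul_def]
  refine Submodule.smul_mem _ _ ?_
  by_cases h1 : t.part 1 s = 0
  · refine Submodule.mem_iSup_of_mem (ν + t.wts s) (Submodule.mem_iSup_of_mem ?_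
          (t.mon_smul_mem hn.1 s))
    rw [← t.part_add_part s, h1, add_zero, wts_add,
      t.wts_part_zero (s := t.part 0 s) (fun i => t.sgn_of_mem_part), add_zero]
    exact t.wtLE_wts_add (fun _ => t.sgn_of_mem_part) ν
  · rw [hn.mon_smul h1]; exact zero_mem _

variable {t} in
/-- The weights of a module that is generated by a highest weight vector. -/
lemma IsHighest.wtLE {M : GMod g A} {ν : Wt h} {n : M} (hn : t.IsHighest ν n)
    (hgen : ∀ x : M, ∃ r : EnvAlg g A, r • n = x) {μ : Wt h} (hμ : wtSpace h M μ ≠ ⊥) :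
    WtLE h b μ ν := by
  obtain ⟨x, hx, hx0⟩ := Submodule.exists_mem_ne_zero_of_ne_bot hμ
  by_contra hle
  obtain ⟨r, rfl⟩ := hgen x
  have h1 : Disjoint (wtSpace h M μ) (⨆ i ∈ {μ | WtLE h b μ ν}, wtSpace h M i) :=
    (iSupIndep_wtSpace M).disjoint_biSup hle
  exact hx0 (Submodule.disjoint_def.1 h1 _ hx (hn.smul_mem_iSup_le r))

variable {t} in
lemma IsHighest.isWeightModule {M : GMod g A} {ν : Wt h} {n : M} (hn : t.IsHighest ν n)
    (hgen : ∀ x : M, ∃ r : EnvAlg g A, r • n = x) : IsWeightModule h M := by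
  refine t.isWeightModule_of_span (S := {n}) ?_ (eq_top_iff.2 fun x _ => ?_)
  · rintro m rfl
    exact ⟨ν, hn.1⟩
  · obtain ⟨r, rfl⟩ := hgen x
    exact Submodule.smul_mem _ r (Submodule.mem_span_singleton_self _)

lemma wt_ne_zero {i : t.ι} (hi : t.sgn i = 1) : t.wt i ≠ 0 := by
  intro h0
  have := t.eq_zero_of_wts_eq_zero_of_pos (s := {i})
    (fun j hj => by rw [Multiset.mem_singleton.1 hj]; exact hi) (by simpa [wts] using h0)
  simp at this

lemma wtLE_add_wt {i : t.ι} (hi : t.sgn i = 1) (ν : Wt h) : WtLE h b ν (ν + t.wt i) := by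
  have := t.wtLE_add_wts (s := {i})
    (fun j hj => by rw [Multiset.mem_singleton.1 hj]; exact hi) ν
  simpa [wts] using this

lemma cartanIncl_mem_affBorel (t : TriBasis h b) (H : AffCartan h) :
    cartanIncl h H ∈ affBorel b := by
  rw [← t.e.linearCombination_repr (cartanIncl h H), Finsupp.linearCombination_apply]
  refine Submodule.sum_mem _ fun i hi => Submodule.smul_mem _ _ (t.mem_borel i fun hs => ?_)
  refine Finsupp.mem_support_iff.1 hi (t.cartan_repr H i ?_)
  rw [hs]; decide

/-- Nonzero submodules of modules in the category `Ô` contain highest weight vectors. -/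
lemma exists_isHighest {M : GMod g A} (hM : catO h b A M) {m : M} (hm : m ≠ 0) :
    ∃ (r : EnvAlg g A) (ν : Wt h), r • m ≠ 0 ∧ t.IsHighest ν (r • m) := by
  obtain ⟨N, hmN, hfg, hst⟩ := hM.2 m
  -- The submodule generated by `m` need not be finitely generated over `A`; intersecting it with
  -- `N` leaves finitely many weights, and a vector of maximal weight among them is killed by the
  -- positive root vectors.
  let N' : Submodule A M := N ⊓ (Submodule.span (EnvAlg g A) {m}).restrictScalars A
  have hst' : ∀ x ∈ affBorel b, ∀ n ∈ N', act A x • n ∈ N' := fun x hx n hn =>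
    ⟨hst x hx n hn.1, (Submodule.span (EnvAlg g A) {m}).smul_mem (act A x) hn.2⟩
  have hmN' : m ∈ N' := ⟨hmN, Submodule.mem_span_singleton_self m⟩
  let W : Set (Wt h) := {μ | ∃ n ∈ N', n ∈ wtSpace h M μ ∧ n ≠ 0}
  have hW : W.Finite := by
    obtain ⟨S, hS⟩ := hfg
    choose F f hf hF hsum using fun x : M => hM.1.exists_sum x
    refine (S.finite_toSet.biUnion fun x _ => (F x).finite_toSet).subset ?_
    rintro μ ⟨n, ⟨hnN, -⟩, hn, hn0⟩
    by_contra hμ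
    refine hn0 (Submodule.disjoint_def.1 ((iSupIndep_wtSpace M).disjoint_biSup hμ) n hn ?_)
    rw [← hS] at hnN
    refine Submodule.span_le.2 (fun x hx => ?_) hnN
    rw [← hsum x]
    refine Submodule.sum_mem _ fun ν hν => ?_
    exact Submodule.mem_iSup_of_mem ν (Submodule.mem_iSup_of_mem (Set.mem_biUnion hx hν) (hf x ν))
  have hne : W.Nonempty := by
    obtain ⟨F, f, hf, hF, hsum⟩ := hM.1.exists_sum m
    obtain ⟨μ, -, hμ⟩ : ∃ μ ∈ F, f μ ≠ 0 := by
      by_contra! hcon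
      exact hm (by rw [← hsum, Finset.sum_eq_zero hcon])
    refine ⟨μ, f μ, component_mem N' (fun H => hst' _ (t.cartanIncl_mem_affBorel H)) hf hF ?_ μ,
      hf μ, hμ⟩
    rwa [hsum]
  obtain ⟨ν, ⟨n, hnN, hn, hn0⟩, hmax⟩ := exists_maximal_wt b hW hne
  obtain ⟨r, rfl⟩ := Submodule.mem_span_singleton.1 hnN.2
  refine ⟨r, ν, hn0, hn, fun i hi => ?_⟩
  by_contra h0
  refine t.wt_ne_zero hi (add_eq_left.1 (hmax (ν + t.wt i) ?_ (t.wtLE_add_wt hi ν)))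
  refine ⟨_, hst' _ (t.mem_borel i (by rw [hi]; decide)) _ hnN, t.act_smul_mem hn i, h0⟩

/-! ### Simple modules -/

section Verma

/-- The canonical generator of the Verma module. -/
def vermaGen (h b : LieSubalgebra ℂ g) (A : Type u) [CommRing A] [Algebra ℂ A]
    [Algebra (SymmetricAlgebra ℂ h) A] (lam : Wt h) : verma h b A lam :=
  Submodule.Quotient.mk (p := vermaIdeal h b A lam) 1

lemma smul_vermaGen {lam : Wt h} (r : EnvAlg g A) :
    r • vermaGen h b A lam = Submodule.Quotient.mk (p := vermaIdeal h b A lam) r := by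
  change Submodule.Quotient.mk (p := vermaIdeal h b A lam) (r • 1) = _
  rw [smul_eq_mul, mul_one]

lemma exists_smul_vermaGen {lam : Wt h} (x : verma h b A lam) :
    ∃ r : EnvAlg g A, r • vermaGen h b A lam = x := by
  obtain ⟨r, rfl⟩ := Submodule.Quotient.mk_surjective _ x
  exact ⟨r, smul_vermaGen r⟩

lemma smul_vermaGen_eq_zero {lam : Wt h} {r : EnvAlg g A} :
    r • vermaGen h b A lam = 0 ↔ r ∈ vermaIdeal h b A lam := by
  rw [smul_vermaGen]
  exact Submodule.Quotient.mk_eq_zero _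

/-- Positive root vectors have nonzero weight, so they lie in `[ĥ, b̂]` and hence act by zero on the
generator. -/
lemma isHighest_vermaGen (lam : Wt h) : t.IsHighest lam (vermaGen h b A lam) := by
  refine ⟨fun H => ?_, fun i hi => ?_⟩
  · rw [base_smul_def, ← sub_eq_zero, ← sub_smul, smul_vermaGen_eq_zero]
    exact Submodule.subset_span (Or.inl ⟨H, rfl⟩)
  · obtain ⟨H, hH⟩ : ∃ H, t.wt i H ≠ 0 := by
      by_contra! hcon
      exact t.wt_ne_zero hi (LinearMap.ext hcon)
    have h1 : t.e i = (t.wt i H)⁻¹ • ⁅cartanIncl h H, t.e i⁆ := by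
      rw [t.lie_cartan, smul_smul, inv_mul_cancel₀ hH, one_smul]
    rw [h1, act_smul', mul_smul, smul_vermaGen_eq_zero.2, smul_zero]
    exact Submodule.subset_span (Or.inr ⟨_, t.cartanIncl_mem_affBorel H, _,
      t.mem_borel i (by rw [hi]; decide), rfl⟩)

variable {t} in
/-- The Borel subalgebra acts on highest weight vectors by scalars. -/
lemma IsHighest.exists_borel_smul {M : GMod g A} {ν : Wt h} {n : M} (hn : t.IsHighest ν n)
    {x : AffineLie g} (hx : x ∈ affBorel b) : ∃ a : A, act A x • n = a • n := by
  rw [t.act_eq_sum, Finsupp.sum, Finset.sum_smul]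
  have : ∀ i ∈ (t.e.repr x).support, ∃ a : A,
      (algebraMap A (EnvAlg g A) (algebraMap ℂ A (t.e.repr x i)) * act A (t.e i)) • n = a • n := by
    intro i hi
    rw [mul_smul]
    rcases SignType.trichotomy (t.sgn i) with hs | hs | hs
    · exact absurd (t.borel_repr x hx i hs) (Finsupp.mem_support_iff.1 hi)
    · rw [← cartanIncl_cart hs, hn.1, ← base_smul_def, smul_smul]
      exact ⟨_, rfl⟩
    · exact ⟨0, by rw [hn.2 i hs, smul_zero, zero_smul]⟩
  choose! a ha using this
  exact ⟨∑ i ∈ (t.e.repr x).support, a i, by rw [Finset.sum_congr rfl ha, Finset.sum_smul]⟩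

/-- For `J = {μ | μ ≤ lam}` the generator of `projMod` is a highest weight vector, so it satisfies
the relations of the Verma module; it is nonzero by the independence of monomials. -/
lemma vermaGen_ne_zero [IsScalarTower ℂ (SymmetricAlgebra ℂ h) A] [Nontrivial A]
    (t : TriBasis h b) (lam : Wt h) : vermaGen h b A lam ≠ 0 := by
  let J : Set (Wt h) := {μ | WtLE h b μ lam}
  have hJ : IsOpenWts h b J := fun γ hγ μ hμ => hμ.trans hγ
  have hgen : t.IsHighest lam (t.gen A J lam) := by
    refine ⟨t.gen_mem, fun i hi => ?_⟩
    have := t.wd_smul_gen (A := A) (J := J) (lam := lam) (l := [i]) (by simpa using hi) (by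
      simp only [wts, Multiset.coe_singleton, Multiset.map_singleton, Multiset.sum_singleton]
      intro hle
      exact t.wt_ne_zero hi (add_eq_left.1 (WtLE.antisymm hle (t.wtLE_add_wt hi lam))))
    rwa [wd_cons, wd_nil, mul_one] at this
  have hle : vermaIdeal h b A lam ≤ t.projIdeal A J lam := by
    refine Submodule.span_le.2 ?_
    rintro _ (⟨H, rfl⟩ | ⟨x, hx, y, hy, rfl⟩)
    · exact Submodule.subset_span (Or.inl ⟨H, rfl⟩)
    · rw [SetLike.mem_coe, ← smul_gen_eq_zero, act_lie, sub_smul, mul_smul, mul_smul]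
      obtain ⟨a, ha⟩ := hgen.exists_borel_smul hx
      obtain ⟨c, hc⟩ := hgen.exists_borel_smul hy
      rw [ha, hc, act_smul_comm, act_smul_comm, ha, hc, smul_comm, sub_self]
  intro h0
  have h1 := t.smul_gen_eq_zero.2 (hle (smul_vermaGen_eq_zero.1 ((one_smul _ _).trans h0)))
  have h2 : (1 : A) • t.gen A J lam = 0 := by rw [one_smul]; exact (one_smul _ _).symm.trans h1
  exact one_ne_zero (t.eq_zero_of_smul_gen_eq_zero hJ (WtLE.refl lam) h2)

end Verma

/-! ### The simple quotient of the Verma module over a field -/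

section VermaHead

variable {K : Type u} [Field K] [Algebra ℂ K] [Algebra (SymmetricAlgebra ℂ h) K]
  [IsScalarTower ℂ (SymmetricAlgebra ℂ h) K]

/-- Over a field the weight space of `lam` is a line spanned by the generator. So a proper submodule
has no component of weight `lam`, and neither has a sum of proper submodules. -/
lemma vermaGen_notMem_sSup (t : TriBasis h b) (lam : Wt h) : vermaGen h b K lam ∉
    sSup {N : Submodule (EnvAlg g K) (verma h b K lam) | N ≠ ⊤} := by
  intro hmem
  have hv := t.isHighest_vermaGen (A := K) lam
  have hw : IsWeightModule h (verma h b K lam) := hv.isWeightModule exists_smul_vermaGen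
  refine t.vermaGen_ne_zero (A := K) lam (eq_zero_of_mem_iSup_ne hv.1 ?_)
  rw [sSup_eq_iSup'] at hmem
  refine Submodule.iSup_induction (motive := fun x => x ∈ ⨆ μ, ⨆ (_ : μ ≠ lam),
    wtSpace h (verma h b K lam) μ) _ hmem ?_ (zero_mem _) fun _ _ => add_mem
  rintro ⟨N, hN⟩ x hx
  obtain ⟨F, f, hf, hF, rfl⟩ := hw.exists_sum x
  refine Submodule.sum_mem _ fun μ hμ => ?_
  have hfN : f μ ∈ N := component_mem (N.restrictScalars K)
    (fun H n hn => N.smul_mem _ hn) hf hF hx μ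
  by_cases hne : μ = lam
  · subst hne
    obtain ⟨r, hr⟩ := exists_smul_vermaGen (f μ)
    obtain ⟨a, ha⟩ := hv.exists_eq_smul (by rw [hr]; exact hf μ)
    have h0 : f μ = 0 := by
      by_contra h0
      have ha0 : a ≠ 0 := by
        rintro rfl
        rw [hr, zero_smul] at ha
        exact h0 ha
      refine hN (eq_top_iff.2 fun y _ => ?_)
      obtain ⟨r', rfl⟩ := exists_smul_vermaGen y
      refine N.smul_mem r' ?_
      have : vermaGen h b K μ = a⁻¹ • f μ := by
        rw [← hr, ha, smul_smul, inv_mul_cancel₀ ha0, one_smul]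
      rw [this]
      exact N.smul_mem _ hfN
    rw [h0]
    exact zero_mem _
  · exact Submodule.mem_iSup_of_mem μ (Submodule.mem_iSup_of_mem hne (hf μ))

/-- The canonical generator of the simple quotient of the Verma module. -/
def headGen (h b : LieSubalgebra ℂ g) (K : Type u) [CommRing K] [Algebra ℂ K]
    [Algebra (SymmetricAlgebra ℂ h) K] (lam : Wt h) : vermaHead h b K lam :=
  Submodule.mkQ (sSup {N : Submodule (EnvAlg g K) (verma h b K lam) | N ≠ ⊤}) (vermaGen h b K lam)

lemma isHighest_headGen (lam : Wt h) : t.IsHighest lam (headGen h b K lam) :=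
  (t.isHighest_vermaGen lam).map (N := vermaHead h b K lam) (Submodule.mkQ _)

lemma headGen_ne_zero (t : TriBasis h b) (lam : Wt h) : headGen h b K lam ≠ 0 := fun h0 =>
  t.vermaGen_notMem_sSup lam ((Submodule.Quotient.mk_eq_zero _).1 h0)

lemma vermaHead_simple {lam : Wt h} {x : vermaHead h b K lam} (hx : x ≠ 0)
    (y : vermaHead h b K lam) : ∃ r : EnvAlg g K, r • x = y := by
  obtain ⟨v, rfl⟩ := Submodule.mkQ_surjective _ x
  obtain ⟨w, rfl⟩ := Submodule.mkQ_surjective _ y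
  have h1 : Submodule.span (EnvAlg g K) {v} = ⊤ := by
    by_contra hne
    exact hx ((Submodule.Quotient.mk_eq_zero _).2
      (Submodule.mem_sSup_of_mem hne (Submodule.mem_span_singleton_self v)))
  obtain ⟨r, rfl⟩ := Submodule.mem_span_singleton.1 (h1 ▸ Submodule.mem_top : w ∈ _)
  exact ⟨r, (map_smul _ r v).symm⟩

end VermaHead

/-! ### The simple modules over the local ring -/

section SimpleL

variable [IsScalarTower ℂ (SymmetricAlgebra ℂ h) A] [IsLocalRing A]

lemma resHom_act (x : AffineLie g) : resHom g A (act A x) = act (IsLocalRing.ResidueField A) x := by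
  simp [resHom, act]

lemma resHom_algebraMap (a : A) : resHom g A (algebraMap A (EnvAlg g A) a) =
    algebraMap (IsLocalRing.ResidueField A) (EnvAlg g (IsLocalRing.ResidueField A))
      (IsLocalRing.residue A a) := by
  simp [resHom, Algebra.TensorProduct.algebraMap_apply]

lemma resHom_surjective : Function.Surjective (resHom g A) := by
  intro y
  induction y using TensorProduct.induction_on with
  | zero => exact ⟨0, map_zero _⟩
  | add x y hx hy =>
    obtain ⟨x, rfl⟩ := hx
    obtain ⟨y, rfl⟩ := hy
    exact ⟨x + y, map_add _ _ _⟩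
  | tmul c u =>
    obtain ⟨a, rfl⟩ := IsLocalRing.residue_surjective c
    exact ⟨a ⊗ₜ u, by simp [resHom]⟩

lemma residue_wtScalar (lam : Wt h) (H : AffCartan h) :
    IsLocalRing.residue A (wtScalar h A lam H) = wtScalar h (IsLocalRing.ResidueField A) lam H := by
  simp only [wtScalar, map_add]
  rfl

/-- The highest weight vector of `L_A(lam)`. -/
def simpleGen (h b : LieSubalgebra ℂ g) (A : Type u) [CommRing A] [Algebra ℂ A]
    [Algebra (SymmetricAlgebra ℂ h) A] [IsLocalRing A] (lam : Wt h) : simpleL h b A lam :=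
  headGen h b (IsLocalRing.ResidueField A) lam

lemma simpleL_smul_def {lam : Wt h} (r : EnvAlg g A) (x : simpleL h b A lam) :
    r • x = HSMul.hSMul (α := EnvAlg g (IsLocalRing.ResidueField A))
      (β := vermaHead h b (IsLocalRing.ResidueField A) lam)
      (γ := vermaHead h b (IsLocalRing.ResidueField A) lam) (resHom g A r) x := rfl

lemma isHighest_simpleGen (lam : Wt h) : t.IsHighest lam (simpleGen h b A lam) := by
  have h1 := t.isHighest_headGen (K := IsLocalRing.ResidueField A) lam
  refine ⟨fun H => ?_, fun i hi => ?_⟩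
  · rw [base_smul_def, simpleL_smul_def, simpleL_smul_def, resHom_act, resHom_algebraMap,
      residue_wtScalar]
    exact h1.1 H
  · rw [simpleL_smul_def, resHom_act]
    exact h1.2 i hi

lemma simpleGen_ne_zero (t : TriBasis h b) (lam : Wt h) : simpleGen h b A lam ≠ 0 :=
  t.headGen_ne_zero lam

lemma simpleL_simple {lam : Wt h} {x : simpleL h b A lam} (hx : x ≠ 0)
    (y : simpleL h b A lam) : ∃ r : EnvAlg g A, r • x = y := by
  obtain ⟨r, hr⟩ := vermaHead_simple hx y
  obtain ⟨r, rfl⟩ := resHom_surjective (A := A) r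
  exact ⟨r, hr⟩

lemma smul_simpleL_eq_zero {lam : Wt h} {a : A} (ha : a ∈ IsLocalRing.maximalIdeal A)
    (x : simpleL h b A lam) : a • x = 0 := by
  rw [base_smul_def, simpleL_smul_def, resHom_algebraMap, (IsLocalRing.residue_eq_zero_iff a).2 ha,
    map_zero]
  exact zero_smul (EnvAlg g (IsLocalRing.ResidueField A))
    (show vermaHead h b (IsLocalRing.ResidueField A) lam from x)

lemma isUnit_of_smul_simpleGen_eq {lam : Wt h} {a : A}
    (ha : a • simpleGen h b A lam ≠ 0) : IsUnit a := by
  by_contra hu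
  exact ha (smul_simpleL_eq_zero ((IsLocalRing.mem_maximalIdeal a).2 hu) _)

variable [IsNoetherianRing A]

/-- `L(lam)` is a quotient of `projMod` for the set of weights below `lam`, which is locally bounded
because intervals are finite. -/
lemma catOTrunc_simpleL (t : TriBasis h b) {J : Set (Wt h)} (hJo : IsOpenWts h b J) {lam : Wt h}
    (hlam : lam ∈ J) : catOTrunc h b A J (simpleL h b A lam) := by
  let J' : Set (Wt h) := {μ | WtLE h b μ lam}
  have hJ' : IsOpenWts h b J' := fun γ hγ μ hμ => hμ.trans hγ
  have hJl : IsLocBddWts h b J' := fun μ => (finite_interval μ lam).subset fun γ hγ => ⟨hγ.2, hγ.1⟩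
  have hl := t.isHighest_simpleGen (A := A) lam
  have hw : ∀ μ, wtSpace h (simpleL h b A lam) μ ≠ ⊥ → WtLE h b μ lam := fun μ hμ =>
    hl.wtLE (simpleL_simple (t.simpleGen_ne_zero lam)) hμ
  obtain ⟨f, hf⟩ := t.exists_projMod_hom (J := J') hw hl.1
  have hsurj : Function.Surjective f := fun y => by
    obtain ⟨r, rfl⟩ := simpleL_simple (t.simpleGen_ne_zero lam) y
    exact ⟨r • t.gen A J' lam, by rw [map_smul, hf]⟩
  exact ⟨(catOTrunc_of_surjective f hsurj (t.catOTrunc_projMod hJ' hJl)).1,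
    fun μ hμ => hJo lam hlam μ (hw μ hμ)⟩

end SimpleL

end TriBasis

end AffineO

end

noncomputable section

set_option linter.unusedSectionVars false

/-! ### Modules over local rings -/

namespace LocalLift

open IsLocalRing

variable {A : Type*} [CommRing A] [IsLocalRing A]

/-- Finitely generated modules over local rings have projective covers. -/
lemma exists_cover (E : Type*) [AddCommGroup E] [Module A E] [Module.Finite A E] :
    ∃ (n : ℕ) (φ : (Fin n → A) →ₗ[A] E), Function.Surjective φ ∧
      ∀ x, φ x = 0 → x ∈ maximalIdeal A • (⊤ : Submodule A (Fin n → A)) := by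
  let k := A ⧸ maximalIdeal A
  let _ : Field k := Ideal.Quotient.field _
  let Ē := E ⧸ (maximalIdeal A • ⊤ : Submodule A E)
  have : Module.Finite A Ē := inferInstance
  have : Module.Finite k Ē := Module.Finite.of_restrictScalars_finite A k Ē
  let v := Module.finBasis k Ē
  choose x hx using fun i => Submodule.mkQ_surjective (maximalIdeal A • ⊤ : Submodule A E) (v i)
  let φ : (Fin (Module.finrank k Ē) → A) →ₗ[A] E := Fintype.linearCombination A x
  have hφ : ∀ a, Submodule.mkQ (maximalIdeal A • ⊤ : Submodule A E) (φ a) =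
      ∑ i, (Ideal.Quotient.mk (maximalIdeal A) (a i)) • v i := by
    intro a
    rw [Fintype.linearCombination_apply, map_sum]
    refine Finset.sum_congr rfl fun i _ => ?_
    rw [map_smul, hx]
    rfl
  refine ⟨_, φ, ?_, fun a ha => ?_⟩
  · rw [← LinearMap.range_eq_top, ← IsLocalRing.map_mkQ_eq_top, eq_top_iff]
    rintro y -
    have hy := v.sum_repr y
    choose c hc using fun i => Ideal.Quotient.mk_surjective (v.repr y i)
    refine ⟨φ c, ⟨c, rfl⟩, ?_⟩
    rw [hφ, ← hy]
    exact Finset.sum_congr rfl fun i _ => by rw [hc]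
  · have h1 := hφ a
    rw [ha, map_zero] at h1
    have h2 := Fintype.linearIndependent_iff.1 v.linearIndependent _ h1.symm
    rw [← Finset.univ_sum_single a]
    refine Submodule.sum_mem _ fun i _ => ?_
    have : (Pi.single i (a i) : Fin (Module.finrank k Ē) → A) = a i • Pi.single i 1 := by
      rw [← Pi.single_smul', smul_eq_mul, mul_one]
    rw [this]
    exact Submodule.smul_mem_smul (Ideal.Quotient.eq_zero_iff_mem.1 (h2 i)) trivial

variable {W : Type*} [AddCommGroup W] [Module A W]

lemma map_mem_smul_top {W' : Type*} [AddCommGroup W'] [Module A W'] (f : W →ₗ[A] W') {x : W}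
    {I : Ideal A} (hx : x ∈ I • (⊤ : Submodule A W)) : f x ∈ I • (⊤ : Submodule A W') := by
  have : f x ∈ (I • (⊤ : Submodule A W)).map f := ⟨x, hx, rfl⟩
  rw [Submodule.map_smul''] at this
  exact Submodule.smul_mono le_rfl le_top this

/-- Lifting an idempotent endomorphism of a quotient of a free module over a local ring. -/
lemma exists_idempotent [Module.Free A W] [Module.Finite A W] (Y : Submodule A W) (σ : W →ₗ[A] W)
    (hY : ∀ y ∈ Y, σ y ∈ Y) (hσ : ∀ w, σ (σ w) - σ w ∈ Y) :
    ∃ p : W →ₗ[A] W, p ∘ₗ p = p ∧ (∀ w, p w - σ w ∈ Y) ∧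
      ∀ y ∈ Y, p y ∈ maximalIdeal A • (⊤ : Submodule A W) := by
  let e : (W ⧸ Y) →ₗ[A] (W ⧸ Y) := Y.mapQ Y σ hY
  have he : ∀ w, e (Y.mkQ w) = Y.mkQ (σ w) := fun w => rfl
  have hee : ∀ x, e (e x) = e x := by
    intro x
    obtain ⟨w, rfl⟩ := Y.mkQ_surjective x
    rw [he, he, ← sub_eq_zero, ← map_sub]
    exact (Submodule.Quotient.mk_eq_zero Y).2 (hσ w)
  -- The image of the induced idempotent `e` need not be free, but its projective cover `A^n` is;
  -- `r` and `i` lift the projection to the image and its inclusion.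
  obtain ⟨n, φ, hφ, hker⟩ := exists_cover (A := A) (LinearMap.range e)
  obtain ⟨i, hi⟩ := Module.projective_lifting_property Y.mkQ ((LinearMap.range e).subtype ∘ₗ φ)
    Y.mkQ_surjective
  obtain ⟨r, hr⟩ := Module.projective_lifting_property φ (e.rangeRestrict ∘ₗ Y.mkQ) hφ
  have hi' : ∀ x, Y.mkQ (i x) = φ x := fun x => LinearMap.congr_fun hi x
  have hr' : ∀ w, (φ (r w) : W ⧸ Y) = e (Y.mkQ w) := fun w =>
    congrArg Subtype.val (LinearMap.congr_fun hr w)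
  have hri : ∀ x, φ (r (i x)) = φ x := by
    intro x
    apply Subtype.ext
    rw [hr', hi']
    obtain ⟨y, hy⟩ := (φ x).2
    rw [← hy, hee]
  -- `r ∘ i` is the identity modulo the maximal ideal, since `φ ∘ r ∘ i = φ` and `φ` has its kernel
  -- there.
  have hsurj : Function.Surjective (r ∘ₗ i) := by
    rw [← LinearMap.range_eq_top, eq_top_iff]
    refine Submodule.le_of_le_smul_of_le_jacobson_bot (I := maximalIdeal A) Module.Finite.fg_top
      (IsLocalRing.jacobson_eq_maximalIdeal ⊥ bot_ne_top).ge fun x _ => ?_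
    have : x = (r ∘ₗ i) x - (r (i x) - x) := by simp
    rw [this]
    refine Submodule.sub_mem_sup ⟨x, rfl⟩ (hker _ ?_)
    rw [map_sub, hri, sub_self]
  let u := LinearEquiv.ofBijective (r ∘ₗ i)
    (OrzechProperty.bijective_of_surjective_endomorphism _ hsurj)
  have hu : ∀ x, u x = r (i x) := fun x => rfl
  have hu' : ∀ x, φ (u.symm x) = φ x := fun x => by
    rw [← hri, ← hu, u.apply_symm_apply]
  -- Correcting by the automorphism `u = r ∘ i` makes the endomorphism idempotent, and it still
  -- induces `e`. On `Y` the map `r` takes values in the kernel of `φ`.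
  refine ⟨i ∘ₗ u.symm.toLinearMap ∘ₗ r, ?_, fun w => ?_, fun y hy => ?_⟩
  · ext w
    simp only [LinearMap.comp_apply, LinearEquiv.coe_coe, ← hu, u.symm_apply_apply]
  · rw [← Submodule.Quotient.mk_eq_zero]
    change Y.mkQ _ = 0
    rw [map_sub, sub_eq_zero]
    simp only [LinearMap.comp_apply, LinearEquiv.coe_coe]
    rw [hi', hu', hr', he]
  · refine map_mem_smul_top (i ∘ₗ u.symm.toLinearMap) (hker _ (Subtype.ext ?_))
    rw [hr', he, Submodule.mkQ_apply, (Submodule.Quotient.mk_eq_zero Y).2 (hY y hy)]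
    rfl

end LocalLift

namespace AffineO

/-! ### Simple subquotients -/

namespace TriBasis

variable {g : Type u} [LieRing g] [LieAlgebra ℂ g] [FiniteDimensional ℂ g] [LieAlgebra.IsKilling ℂ g]
variable {h : LieSubalgebra ℂ g} [h.IsCartanSubalgebra] {b : LieSubalgebra ℂ g}
variable [LieAlgebra.IsSolvable b]
variable (t : TriBasis h b)
variable {A : Type u} [CommRing A] [Algebra ℂ A] [Algebra (SymmetricAlgebra ℂ h) A]
  [IsScalarTower ℂ (SymmetricAlgebra ℂ h) A] [IsLocalRing A]

/-- `L(lam)` is a quotient of the module generated by `x`, such that `x` is mapped to the highest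
weight vector. -/
def HasFactor (h b : LieSubalgebra ℂ g) {A : Type u} [CommRing A] [Algebra ℂ A]
    [Algebra (SymmetricAlgebra ℂ h) A] [IsLocalRing A] {M : GMod g A} (lam : Wt h) (x : M) : Prop :=
  ∀ r : EnvAlg g A, r • x = 0 → r • simpleGen h b A lam = 0

lemma isSubquotientL_iff (t : TriBasis h b) {M : GMod g A} {lam : Wt h} :
    IsSubquotientL h b A lam M ↔ ∃ x : M, HasFactor h b lam x := by
  constructor
  · rintro ⟨N, q, hq⟩
    obtain ⟨n, hn⟩ := hq (simpleGen h b A lam)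
    refine ⟨n, fun r hr => ?_⟩
    have : r • n = 0 := Subtype.ext hr
    rw [← hn, ← map_smul, this, map_zero]
  · rintro ⟨x, hx⟩
    let φ := LinearMap.toSpanSingleton (EnvAlg g A) M x
    let ψ := LinearMap.toSpanSingleton (EnvAlg g A) (simpleL h b A lam) (simpleGen h b A lam)
    let q := ((LinearMap.ker φ).liftQ ψ fun r hr => hx r hr) ∘ₗ φ.quotKerEquivRange.symm.toLinearMap
    refine ⟨LinearMap.range φ, q, fun y => ?_⟩
    obtain ⟨r, rfl⟩ := simpleL_simple (t.simpleGen_ne_zero lam) y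
    refine ⟨φ.quotKerEquivRange ((LinearMap.ker φ).mkQ r), ?_⟩
    simp only [q, LinearMap.comp_apply, LinearEquiv.coe_coe, LinearEquiv.symm_apply_apply]
    rfl

lemma HasFactor.of_map {M N : GMod g A} (f : M →ₗ[EnvAlg g A] N) {lam : Wt h} {x : M}
    (hx : HasFactor h b lam (f x)) : HasFactor h b lam x :=
  fun r hr => hx r (by rw [← map_smul, hr, map_zero])

lemma HasFactor.map {M N : GMod g A} (f : M →ₗ[EnvAlg g A] N) (hf : Function.Injective f)
    {lam : Wt h} {x : M} (hx : HasFactor h b lam x) : HasFactor h b lam (f x) :=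
  fun r hr => hx r (hf (by rw [map_smul, hr, map_zero]))

lemma HasFactor.ne_zero (t : TriBasis h b) {M : GMod g A} {lam : Wt h} {x : M}
    (hx : HasFactor h b lam x) : x ≠ 0 := by
  rintro rfl
  exact t.simpleGen_ne_zero (A := A) lam (by simpa using hx 1 (smul_zero _))

/-- If `r` kills `x` but not the highest weight vector of `L(lam)`, some `r' * r` fixes that vector,
and then `(r' * r) • y` has the factor. This makes `blockPart` closed under sums. -/
lemma HasFactor.of_add {M : GMod g A} {lam : Wt h} {x y : M}
    (hxy : HasFactor h b lam (x + y)) :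
    HasFactor h b lam x ∨ ∃ s : EnvAlg g A, HasFactor h b lam (s • y) := by
  by_cases hx : HasFactor h b lam x
  · exact Or.inl hx
  unfold HasFactor at hx
  push Not at hx
  obtain ⟨r, hr, hr'⟩ := hx
  obtain ⟨r', hs⟩ := simpleL_simple hr' (simpleGen h b A lam)
  refine Or.inr ⟨r' * r, fun z hz => ?_⟩
  have h1 : (z * (r' * r)) • (x + y) = 0 := by
    rw [mul_smul, smul_add, mul_smul r' r x, hr, smul_zero, zero_add, hz]
  have := hxy _ h1
  rwa [mul_smul, mul_smul, hs] at this

variable {t} in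
-- If `r` kills `n` but not the highest weight vector of `L(ν)`, some `r' * r` fixes the latter. The
-- scalar of `r' * r` from `exists_character` is the same for both vectors: it is a unit by the
-- second and kills `n` by the first.
lemma IsHighest.hasFactor {M : GMod g A} {ν : Wt h} {n : M} (hn : t.IsHighest ν n) (hn0 : n ≠ 0) :
    HasFactor h b ν n := by
  intro r hr
  by_contra hr'
  obtain ⟨r', hs⟩ := simpleL_simple hr' (simpleGen h b A ν)
  rw [← mul_smul] at hs
  have hs' : (r' * r) • n = 0 := by rw [mul_smul, hr, smul_zero]
  obtain ⟨a, ha⟩ := t.exists_character ν (r' * r)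
  have h1 := ha M n hn
  have h2 := ha _ _ (t.isHighest_simpleGen (A := A) ν)
  have hl := (t.isHighest_simpleGen (A := A) ν).1
  rw [hs', zero_sub, ← neg_smul] at h1
  rw [hs] at h2
  have h3 : a • n = 0 := by
    have := eq_zero_of_mem_iSup_ne (Submodule.smul_mem _ _ hn.1) h1
    rwa [neg_smul, neg_eq_zero] at this
  have h4 := eq_zero_of_mem_iSup_ne (Submodule.sub_mem _ hl (Submodule.smul_mem _ _ hl)) h2
  have h5 : IsUnit a := by
    refine isUnit_of_smul_simpleGen_eq (lam := ν) (h := h) (b := b) fun h0 => ?_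
    rw [h0, sub_zero] at h4
    exact t.simpleGen_ne_zero ν h4
  obtain ⟨a, rfl⟩ := h5
  apply hn0
  rw [← one_smul A n, ← a.inv_mul, mul_smul, h3, smul_zero]

/-- Nonzero submodules of modules in the category `Ô` have simple subquotients. -/
lemma exists_hasFactor {M : GMod g A} (hM : catO h b A M) (t : TriBasis h b) {m : M} (hm : m ≠ 0) :
    ∃ (r : EnvAlg g A) (ν : Wt h), HasFactor h b ν (r • m) := by
  obtain ⟨r, ν, h0, hn⟩ := t.exists_isHighest hM hm
  exact ⟨r, ν, hn.hasFactor h0⟩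

end TriBasis

end AffineO

end

noncomputable section

set_option linter.unusedSectionVars false

namespace AffineO

/-! ### Projective covers -/

section WtMap

variable {g : Type u} [LieRing g] [LieAlgebra ℂ g] {h : LieSubalgebra ℂ g}
variable {A : Type u} [CommRing A] [Algebra ℂ A] [Algebra (SymmetricAlgebra ℂ h) A]

/-- The map between weight spaces that is induced by a homomorphism. -/
def wtMap {M N : GMod g A} (f : M →ₗ[EnvAlg g A] N) (ν : Wt h) :
    wtSpace h M ν →ₗ[A] wtSpace h N ν :=
  (toBaseLin f).restrict fun _ hx => map_mem_wtSpace f hx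

lemma wtMap_apply {M N : GMod g A} (f : M →ₗ[EnvAlg g A] N) (ν : Wt h) (x : wtSpace h M ν) :
    (wtMap f ν x : N) = f x := rfl

/-- The multiple of a homomorphism by an element of `A`. -/
def baseSMulHom {M N : GMod g A} (a : A) (f : M →ₗ[EnvAlg g A] N) : M →ₗ[EnvAlg g A] N where
  toFun x := a • f x
  map_add' x y := by rw [map_add, smul_add]
  map_smul' r x := by
    rw [map_smul, RingHom.id_apply, base_smul_def, base_smul_def, ← mul_smul, ← mul_smul,
      Algebra.commutes]

lemma map_base_smul {M N : GMod g A} (f : M →ₗ[EnvAlg g A] N) (a : A) (m : M) :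
    f (a • m) = a • f m := (toBaseLin f).map_smul a m

end WtMap

namespace TriBasis

variable {g : Type u} [LieRing g] [LieAlgebra ℂ g] [FiniteDimensional ℂ g] [LieAlgebra.IsKilling ℂ g]
variable {h : LieSubalgebra ℂ g} [h.IsCartanSubalgebra] {b : LieSubalgebra ℂ g}
variable [LieAlgebra.IsSolvable b]
variable (t : TriBasis h b)
variable {A : Type u} [CommRing A] [Algebra ℂ A] [Algebra (SymmetricAlgebra ℂ h) A]
  [IsScalarTower ℂ (SymmetricAlgebra ℂ h) A] [IsNoetherianRing A]
variable {J : Set (Wt h)} {lam ν : Wt h}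

variable {t} in
-- Dividing `projMod` by the submodule generated by its vectors of weight `ν` leaves weights in `J \
-- {ν}`, so the quotient map factors over the truncation `π`.
lemma mem_span_of_truncate_eq_zero (hJo : IsOpenWts h b J) (hJl : IsLocBddWts h b J)
    {π : t.projMod A J lam →ₗ[EnvAlg g A] t.projMod A (J \ {ν}) lam}
    (hπ : π (t.gen A J lam) = t.gen A (J \ {ν}) lam) {x : t.projMod A J lam} (hx : π x = 0) :
    x ∈ Submodule.span (EnvAlg g A) (wtSpace h (t.projMod A J lam) ν : Set (t.projMod A J lam)) := by
  set N := Submodule.span (EnvAlg g A) (wtSpace h (t.projMod A J lam) ν : Set (t.projMod A J lam))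
  have hQ := t.catOTrunc_projMod (A := A) (lam := lam) hJo hJl
  let C : GMod g A := ModuleCat.of (EnvAlg g A) (t.projMod A J lam ⧸ N)
  let q : t.projMod A J lam →ₗ[EnvAlg g A] C := N.mkQ
  have hq : Function.Surjective q := N.mkQ_surjective
  have hC : ∀ μ, wtSpace h C μ ≠ ⊥ → μ ∈ J \ {ν} := by
    intro μ hμ
    refine ⟨(catOTrunc_of_surjective q hq hQ).2 μ hμ, ?_⟩
    rintro rfl
    refine hμ ((Submodule.eq_bot_iff _).2 fun y hy => ?_)
    obtain ⟨z, hz, rfl⟩ := exists_lift_wtSpace q hq hQ.1.1 hy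
    exact (Submodule.Quotient.mk_eq_zero N).2 (Submodule.subset_span hz)
  obtain ⟨F, hF⟩ := t.exists_projMod_hom hC (map_mem_wtSpace q (t.gen_mem (A := A) (J := J)
    (lam := lam)))
  have hFπ : F ∘ₗ π = q := t.projMod_ext (by rw [LinearMap.comp_apply, hπ, hF])
  refine (Submodule.Quotient.mk_eq_zero N).1 ?_
  change q x = 0
  rw [← hFπ, LinearMap.comp_apply, hx, map_zero]

variable {t} in
/-- Endomorphisms that vanish after truncation factor over sums of copies of the module that
represents the vectors of the removed weight. -/
lemma exists_factorization (hJo : IsOpenWts h b J) (hJl : IsLocBddWts h b J)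
    {π : t.projMod A J lam →ₗ[EnvAlg g A] t.projMod A (J \ {ν}) lam}
    (hπ : π (t.gen A J lam) = t.gen A (J \ {ν}) lam) {κ : Type*} [Fintype κ]
    (v : Module.Basis κ A (wtSpace h (t.projMod A J lam) ν))
    {vh : κ → (t.projMod A J ν →ₗ[EnvAlg g A] t.projMod A J lam)}
    (hvh : ∀ k, vh k (t.gen A J ν) = v k)
    {s : t.projMod A J lam →ₗ[EnvAlg g A] t.projMod A J lam} (hs : ∀ x, π (s x) = 0) :
    ∃ y : κ → (t.projMod A J lam →ₗ[EnvAlg g A] t.projMod A J ν), ∀ x, s x = ∑ k, vh k (y k x) := by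
  classical
  have h1 := mem_span_of_truncate_eq_zero hJo hJl hπ (hs (t.gen A J lam))
  have h2 : s (t.gen A J lam) ∈ Submodule.span (EnvAlg g A) (Set.range fun k =>
      (v k : t.projMod A J lam)) := by
    refine Submodule.span_le.2 (fun x hx => ?_) h1
    have h3 := v.sum_repr ⟨x, hx⟩
    have h4 : x = ∑ k, v.repr ⟨x, hx⟩ k • (v k : t.projMod A J lam) := by
      have := congrArg Subtype.val h3
      rw [AddSubmonoidClass.coe_finsetSum] at this
      exact this.symm
    rw [h4]
    exact Submodule.sum_mem _ fun k _ => Submodule.smul_mem _ (algebraMap A (EnvAlg g A) _)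
      (Submodule.subset_span ⟨k, rfl⟩)
  obtain ⟨r, hr⟩ := (Submodule.mem_span_range_iff_exists_fun _).1 h2
  -- The elements `r k` need not have a definite weight; the components of weight `lam` suffice, as
  -- `s (gen)` has that weight.
  choose F d hd hF hsum using fun k =>
    (t.isWeightModule_projMod (A := A) (J := J) (lam := ν)).exists_sum (r k • t.gen A J ν)
  obtain ⟨p, hp⟩ := exists_wtProj (A := A) (Finset.univ.biUnion F) lam
  have hpd : ∀ k, p • r k • t.gen A J ν = d k lam := fun k => by
    rw [← hsum k]
    exact wtProj_sum (Finset.subset_biUnion_of_mem F (Finset.mem_univ k)) (hd k) (hF k)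
      (hp _).1 (hp _).2.1
  choose y hy using fun k => t.exists_projMod_hom (M := t.projMod A J ν) (J := J)
    (fun μ hμ => t.mem_of_wtSpace_projMod_ne_bot hJo hμ) (hd k lam)
  refine ⟨y, fun x => ?_⟩
  obtain ⟨r', rfl⟩ := t.exists_smul_gen x
  have h5 : s (t.gen A J lam) = ∑ k, vh k (y k (t.gen A J lam)) := by
    have h6 : p • s (t.gen A J lam) = s (t.gen A J lam) :=
      (hp _).2.1 _ (map_mem_wtSpace s t.gen_mem)
    rw [← h6, ← hr, Finset.smul_sum]
    refine Finset.sum_congr rfl fun k _ => ?_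
    rw [hy, ← hpd, map_smul, map_smul, hvh]
  simp only [map_smul]
  rw [h5, Finset.smul_sum]

variable [IsLocalRing A]

variable {t} in
-- Maps that vanish after truncation factor over copies of `projMod A J ν`, so the lift `s` of `f'`
-- is corrected through its action on the free space `V` of vectors of weight `ν`. The last
-- assertion says that on the image of `V` every map to `projMod A J ν` takes values in the maximal
-- ideal times the generator; it feeds Nakayama's lemma in `IsCoverIdempotent.lift`.
lemma exists_idempotent_of_truncation (hJo : IsOpenWts h b J) (hJl : IsLocBddWts h b J)
    (hν : ν ∈ J) (hmax : ∀ γ ∈ J, WtLE h b ν γ → γ = ν)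
    {π : t.projMod A J lam →ₗ[EnvAlg g A] t.projMod A (J \ {ν}) lam}
    (hπ : π (t.gen A J lam) = t.gen A (J \ {ν}) lam)
    {f' : t.projMod A (J \ {ν}) lam →ₗ[EnvAlg g A] t.projMod A (J \ {ν}) lam}
    (hf' : ∀ x, f' (f' x) = f' x) :
    ∃ f : t.projMod A J lam →ₗ[EnvAlg g A] t.projMod A J lam, (∀ x, f (f x) = f x) ∧
      (∀ x, π (f x) = f' (π x)) ∧
      ∀ (y : t.projMod A J lam →ₗ[EnvAlg g A] t.projMod A J ν),
        ∀ x ∈ wtSpace h (t.projMod A J lam) ν,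
        ∃ a ∈ IsLocalRing.maximalIdeal A, y (f x) = a • t.gen A J ν := by
  classical
  obtain ⟨hfree, hfin⟩ := t.free_wtSpace_projMod (A := A) (lam := lam) hJo hν hmax
  have hQ := t.catOTrunc_projMod (A := A) (lam := lam) hJo hJl
  have hπs : Function.Surjective π := fun x => by
    obtain ⟨r, rfl⟩ := t.exists_smul_gen x
    exact ⟨r • t.gen A J lam, by rw [map_smul, hπ]⟩
  have hπν : ∀ x ∈ wtSpace h (t.projMod A J lam) ν, π x = 0 := by
    intro x hx
    by_contra hne
    have hJ'o : IsOpenWts h b (J \ {ν}) := by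
      rintro γ ⟨hγ, hγν⟩ μ hμ
      refine ⟨hJo γ hγ μ hμ, ?_⟩
      rintro rfl
      exact hγν (hmax γ hγ hμ)
    exact (t.mem_of_wtSpace_projMod_ne_bot hJ'o (Submodule.ne_bot_iff _ |>.2
      ⟨_, map_mem_wtSpace π hx, hne⟩)).2 rfl
  -- coordinates
  obtain ⟨θ, hθ⟩ : ∃ θ : wtSpace h (t.projMod A J ν) ν →ₗ[A] A,
      ∀ x : wtSpace h (t.projMod A J ν) ν, (x : t.projMod A J ν) = θ x • t.gen A J ν := by
    let e : A →ₗ[A] wtSpace h (t.projMod A J ν) ν := LinearMap.toSpanSingleton A _ ⟨_, t.gen_mem⟩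
    have he : ∀ a, (e a : t.projMod A J ν) = a • t.gen A J ν := fun a => rfl
    let e' := LinearEquiv.ofBijective e ⟨(injective_iff_map_eq_zero e).2 fun a ha =>
        t.eq_zero_of_smul_gen_eq_zero hJo hν (by rw [← he, ha]; rfl), fun x => by
      obtain ⟨a, ha⟩ := t.exists_smul_gen_of_maximal hmax x.2
      exact ⟨a, Subtype.ext ha.symm⟩⟩
    exact ⟨e'.symm, fun x => by
      conv_lhs => rw [← e'.apply_symm_apply x]
      rfl⟩
  let V := wtSpace h (t.projMod A J lam) ν
  let v := Module.Free.chooseBasis A V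
  choose vh hvh using fun k => t.exists_projMod_hom (J := J) (M := t.projMod A J lam) hQ.2 (v k).2
  have hπvh : ∀ k x, π (vh k x) = 0 := fun k x => by
    obtain ⟨r, rfl⟩ := t.exists_smul_gen x
    rw [map_smul, map_smul, hvh, hπν _ (v k).2, smul_zero]
  -- A map to `projMod A J ν` restricts on `V` to a linear form, as the target has weight space `A ·
  -- gen`. The forms that arise make up `Y`, and modulo `Y` the transpose `σ` of a lift of `f'` is
  -- idempotent.
  let bar : (t.projMod A J lam →ₗ[EnvAlg g A] t.projMod A J ν) → Module.Dual A V :=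
    fun y => θ ∘ₗ wtMap y ν
  have hbar : ∀ y (x : V), y x = bar y x • t.gen A J ν := fun y x => hθ (wtMap y ν x)
  have hvy : ∀ k y (x : V), vh k (y x) = bar y x • (v k : t.projMod A J lam) := fun k y x => by
    rw [hbar, map_base_smul, hvh]
  let Y : Submodule A (Module.Dual A V) :=
    { carrier := Set.range bar
      zero_mem' := ⟨0, by
        ext x
        change θ 0 = 0
        exact map_zero θ⟩
      add_mem' := by
        rintro _ _ ⟨y, rfl⟩ ⟨z, rfl⟩
        exact ⟨y + z, by
          ext x
          exact map_add θ (wtMap y ν x) (wtMap z ν x)⟩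
      smul_mem' := by
        rintro a _ ⟨y, rfl⟩
        exact ⟨baseSMulHom a y, by
          ext x
          exact map_smul θ a (wtMap y ν x)⟩ }
  -- a lift of the idempotent
  obtain ⟨s, hs⟩ : ∃ s : t.projMod A J lam →ₗ[EnvAlg g A] t.projMod A J lam,
      ∀ x, π (s x) = f' (π x) := by
    obtain ⟨s, hs⟩ := t.exists_projMod_lift hQ hπs (f' ∘ₗ π)
    exact ⟨s, LinearMap.congr_fun hs⟩
  let σ : Module.Dual A V →ₗ[A] Module.Dual A V := (wtMap s ν).dualMap
  have hσY : ∀ φ ∈ Y, σ φ ∈ Y := by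
    rintro _ ⟨y, rfl⟩
    exact ⟨y ∘ₗ s, rfl⟩
  have hσσ : ∀ φ, σ (σ φ) - σ φ ∈ Y := by
    intro φ
    obtain ⟨y, hy⟩ := exists_factorization hJo hJl hπ v hvh (s := s ∘ₗ s - s) (fun x => by
      rw [LinearMap.sub_apply, LinearMap.comp_apply, map_sub, hs, hs, hf', sub_self])
    have : σ (σ φ) - σ φ = ∑ k, φ (v k) • bar (y k) := by
      ext x
      have h1 : wtMap s ν (wtMap s ν x) - wtMap s ν x = ∑ k, bar (y k) x • v k := by
        apply Subtype.ext
        rw [AddSubgroupClass.coe_sub, wtMap_apply, wtMap_apply]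
        refine (hy x).trans ?_
        simp [hvy]
      have h2 := congrArg φ h1
      rw [map_sub, map_sum] at h2
      simp only [map_smul, smul_eq_mul] at h2
      rw [LinearMap.sub_apply, LinearMap.sum_apply]
      refine h2.trans (Finset.sum_congr rfl fun k _ => ?_)
      rw [LinearMap.smul_apply, smul_eq_mul, mul_comm]
    rw [this]
    exact Submodule.sum_mem _ fun k _ => Y.smul_mem _ ⟨y k, rfl⟩
  obtain ⟨p, hpp, hpσ, hpY⟩ := LocalLift.exists_idempotent Y σ hσY hσσ
  choose y hy using fun k => (Y.neg_mem (hpσ (v.coord k)))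
  -- The correction changes the transposed action on `V` from `σ` to the idempotent `p` and is
  -- invisible after truncation.
  let s₁ : t.projMod A J lam →ₗ[EnvAlg g A] t.projMod A J lam := s - ∑ k, vh k ∘ₗ y k
  have hs₁ : ∀ x, π (s₁ x) = f' (π x) := fun x => by
    simp [s₁, LinearMap.sub_apply, LinearMap.sum_apply, hπvh, hs]
  have hs₁p : ∀ (φ : Module.Dual A V) x, φ (wtMap s₁ ν x) = p φ x := by
    intro φ x
    have h1 : wtMap s₁ ν x = wtMap s ν x - ∑ k, bar (y k) x • v k := by
      apply Subtype.ext
      simp [wtMap_apply, s₁, LinearMap.sub_apply, LinearMap.sum_apply, hvy]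
    have h2 := v.sum_dual_apply_smul_coord φ
    conv_rhs => rw [← h2]
    rw [h1, map_sub, map_sum, map_sum, LinearMap.sum_apply]
    have h3 : φ (wtMap s ν x) = ∑ k, φ (v k) • σ (v.coord k) x := by
      conv_lhs => rw [← h2]
      rw [LinearMap.sum_apply]
      rfl
    rw [h3, ← Finset.sum_sub_distrib]
    refine Finset.sum_congr rfl fun k _ => ?_
    rw [hy, map_smul, map_smul, LinearMap.smul_apply, LinearMap.neg_apply, LinearMap.sub_apply]
    simp only [smul_eq_mul]
    ring
  -- the idempotent
  have hnil : ∀ x, (s₁ ∘ₗ s₁ - s₁) ((s₁ ∘ₗ s₁ - s₁) x) = 0 := by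
    obtain ⟨z, hz⟩ := exists_factorization hJo hJl hπ v hvh (s := s₁ ∘ₗ s₁ - s₁) (fun x => by
      rw [LinearMap.sub_apply, LinearMap.comp_apply, map_sub, hs₁, hs₁, hf', sub_self])
    have h0 : ∀ x : V, (s₁ ∘ₗ s₁ - s₁) (x : t.projMod A J lam) = 0 := by
      intro x
      have : wtMap s₁ ν (wtMap s₁ ν x) = wtMap s₁ ν x := by
        refine v.ext_elem fun k => ?_
        have h1 : p (p (v.coord k)) = p (v.coord k) := LinearMap.congr_fun hpp _
        exact (hs₁p (v.coord k) _).trans ((hs₁p (p (v.coord k)) x).trans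
          ((LinearMap.congr_fun h1 x).trans (hs₁p (v.coord k) x).symm))
      rw [LinearMap.sub_apply, sub_eq_zero]
      exact congrArg Subtype.val this
    intro x
    -- The image of `s₁ ∘ s₁ - s₁` lies in the submodule generated by `V`, on which the map
    -- vanishes.
    rw [hz x, map_sum]
    refine Finset.sum_eq_zero fun k _ => ?_
    obtain ⟨r, hr⟩ := t.exists_smul_gen (z k x)
    rw [← hr, map_smul, map_smul, hvh, h0, smul_zero]
  let S : Module.End (EnvAlg g A) (t.projMod A J lam) := s₁
  have hS : (S * S - S) * (S * S - S) = 0 := LinearMap.ext hnil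
  -- The polynomial `3 S² - 2 S³` is idempotent modulo `(S² - S)²`, which is zero. It keeps the
  -- action on `V` and on the truncation, where `S` is idempotent already.
  let f : Module.End (EnvAlg g A) (t.projMod A J lam) := S * S + S * S + S * S - S * S * S - S * S * S
  have hf : f * f = f := by
    have : f * f - f = (S * S - S) * (S * S - S) *
        (S * S + S * S + S * S + S * S - S - S - S - S - 1 - 1 - 1) := by
      simp only [f]; noncomm_ring
    rwa [hS, zero_mul, sub_eq_zero] at this
  have hfx : ∀ x, f x = s₁ (s₁ x) + s₁ (s₁ x) + s₁ (s₁ x) - s₁ (s₁ (s₁ x)) - s₁ (s₁ (s₁ x)) :=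
    fun x => rfl
  refine ⟨f, fun x => LinearMap.congr_fun hf x, fun x => ?_, fun z x hx => ?_⟩
  · rw [hfx]
    simp only [map_sub, map_add, hs₁, hf']
    abel
  · refine ⟨p (bar z) ⟨x, hx⟩, ?_, ?_⟩
    · have := LocalLift.map_mem_smul_top (LinearMap.applyₗ (⟨x, hx⟩ : V)) (hpY (bar z) ⟨z, rfl⟩)
      rw [smul_eq_mul, Ideal.mul_top] at this
      exact this
    · have h1 : ∀ φ (x : V), p (p φ) x = p φ x := fun φ x => by
        rw [← LinearMap.comp_apply, hpp]
      have h2 : bar z (wtMap f ν ⟨x, hx⟩) = p (bar z) ⟨x, hx⟩ := by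
        have : wtMap f ν ⟨x, hx⟩ = wtMap s₁ ν (wtMap s₁ ν ⟨x, hx⟩) +
            wtMap s₁ ν (wtMap s₁ ν ⟨x, hx⟩) + wtMap s₁ ν (wtMap s₁ ν ⟨x, hx⟩) -
            wtMap s₁ ν (wtMap s₁ ν (wtMap s₁ ν ⟨x, hx⟩)) -
            wtMap s₁ ν (wtMap s₁ ν (wtMap s₁ ν ⟨x, hx⟩)) := rfl
        rw [this]
        simp only [map_sub, map_add, hs₁p, h1]
        abel
      rw [← h2, ← hbar]
      rfl

end TriBasis

end AffineO

end

noncomputable section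

set_option linter.unusedSectionVars false

namespace AffineO

/-! ### Idempotents that cut out projective covers -/

namespace TriBasis

variable {g : Type u} [LieRing g] [LieAlgebra ℂ g] [FiniteDimensional ℂ g] [LieAlgebra.IsKilling ℂ g]
variable {h : LieSubalgebra ℂ g} [h.IsCartanSubalgebra] {b : LieSubalgebra ℂ g}
variable [LieAlgebra.IsSolvable b]
variable (t : TriBasis h b)
variable {A : Type u} [CommRing A] [Algebra ℂ A] [Algebra (SymmetricAlgebra ℂ h) A]
  [IsScalarTower ℂ (SymmetricAlgebra ℂ h) A] [IsNoetherianRing A] [IsLocalRing A]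
variable {J : Set (Wt h)} {lam ν : Wt h}

/-- Idempotents whose image is a projective cover of `L(lam)`. -/
structure IsCoverIdempotent (f : t.projMod A J lam →ₗ[EnvAlg g A] t.projMod A J lam) : Prop where
  idem : ∀ x, f (f x) = f x
  ne_zero : ∀ c : t.projMod A J lam →ₗ[EnvAlg g A] simpleL h b A lam,
    c (t.gen A J lam) = simpleGen h b A lam → ∃ x, c (f x) ≠ 0
  essential : ∀ c : t.projMod A J lam →ₗ[EnvAlg g A] simpleL h b A lam,
    c (t.gen A J lam) = simpleGen h b A lam →
    ∀ e : t.projMod A J lam →ₗ[EnvAlg g A] t.projMod A J lam, (∀ x, f (e (f x)) = e x) →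
      (∀ x, c (e x) = c (f x)) → LinearMap.range f ≤ LinearMap.range e

/-- The vectors of weight `lam` are the multiples of the generator, so an endomorphism sends the
generator to `a • gen`; compatibility with `c` forces `a` to be a unit. -/
lemma isCoverIdempotent_id (hmax : ∀ γ ∈ J, WtLE h b lam γ → γ = lam) :
    t.IsCoverIdempotent (A := A) (J := J) (lam := lam) LinearMap.id where
  idem _ := rfl
  ne_zero c hc := ⟨t.gen A J lam, by
    rw [LinearMap.id_apply, hc]
    exact t.simpleGen_ne_zero lam⟩
  essential c hc e _ he := by
    obtain ⟨a, ha⟩ := t.exists_smul_gen_of_maximal hmax (map_mem_wtSpace e t.gen_mem)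
    have h1 := he (t.gen A J lam)
    rw [LinearMap.id_apply, ha, map_base_smul, hc] at h1
    obtain ⟨a, rfl⟩ := isUnit_of_smul_simpleGen_eq (a := a) (lam := lam) (h := h) (b := b) (by
      rw [h1]; exact t.simpleGen_ne_zero lam)
    rintro _ ⟨x, rfl⟩
    obtain ⟨r, rfl⟩ := t.exists_smul_gen x
    refine ⟨r • (↑a⁻¹ : A) • t.gen A J lam, ?_⟩
    rw [map_smul, map_base_smul, ha, smul_smul, a.inv_mul, one_smul, LinearMap.id_apply]

/-- A map `e` compatible with `c` has full range after truncation, by the hypothesis on `f'`. What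
is missing is generated by vectors of weight `ν`, and these are recovered by Nakayama's lemma. -/
lemma IsCoverIdempotent.lift (hJo : IsOpenWts h b J) (hJl : IsLocBddWts h b J)
    (hν : ν ∈ J) (hlam : lam ∈ J) (hne : lam ≠ ν) (hmax : ∀ γ ∈ J, WtLE h b ν γ → γ = ν)
    {f' : t.projMod A (J \ {ν}) lam →ₗ[EnvAlg g A] t.projMod A (J \ {ν}) lam}
    (hf' : t.IsCoverIdempotent f') :
    ∃ f : t.projMod A J lam →ₗ[EnvAlg g A] t.projMod A J lam, t.IsCoverIdempotent f := by
  classical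
  obtain ⟨hfree, hfin⟩ := t.free_wtSpace_projMod (A := A) (lam := lam) hJo hν hmax
  have hQ := t.catOTrunc_projMod (A := A) (lam := lam) hJo hJl
  have hJ'o : IsOpenWts h b (J \ {ν}) := by
    rintro γ ⟨hγ, hγν⟩ μ hμ
    refine ⟨hJo γ hγ μ hμ, ?_⟩
    rintro rfl
    exact hγν (hmax γ hγ hμ)
  obtain ⟨π, hπ⟩ := t.exists_projMod_hom (M := t.projMod A (J \ {ν}) lam) (J := J)
    (fun μ hμ => (t.mem_of_wtSpace_projMod_ne_bot hJ'o hμ).1) t.gen_mem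
  have hπs : Function.Surjective π := fun x => by
    obtain ⟨r, rfl⟩ := t.exists_smul_gen x
    exact ⟨r • t.gen A J lam, by rw [map_smul, hπ]⟩
  obtain ⟨c', hc'⟩ := t.exists_projMod_hom (M := simpleL h b A lam) (J := J \ {ν})
    (t.catOTrunc_simpleL hJ'o ⟨hlam, hne⟩).2 (t.isHighest_simpleGen lam).1
  have hc'π : ∀ c : t.projMod A J lam →ₗ[EnvAlg g A] simpleL h b A lam,
      c (t.gen A J lam) = simpleGen h b A lam → ∀ x, c x = c' (π x) := fun c hc =>
    LinearMap.congr_fun (t.projMod_ext (f := c) (f' := c' ∘ₗ π)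
      (by rw [LinearMap.comp_apply, hπ, hc, hc']))
  obtain ⟨f, hf, hπf, hfm⟩ := exists_idempotent_of_truncation hJo hJl hν hmax hπ hf'.idem
  let v := Module.Free.chooseBasis A (wtSpace h (t.projMod A J lam) ν)
  choose vh hvh using fun k => t.exists_projMod_hom (J := J) (M := t.projMod A J lam) hQ.2 (v k).2
  refine ⟨f, hf, fun c hc => ?_, fun c hc e he hce => ?_⟩
  · obtain ⟨x, hx⟩ := hf'.ne_zero c' hc'
    obtain ⟨x, rfl⟩ := hπs x
    exact ⟨x, by rwa [hc'π c hc, hπf]⟩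
  have hfe : ∀ x, f (e x) = e x := fun x => by rw [← he x, hf]
  -- the induced endomorphism of the truncation
  obtain ⟨e', he'⟩ := t.exists_projMod_hom (M := t.projMod A (J \ {ν}) lam) (J := J \ {ν})
    (fun μ hμ => t.mem_of_wtSpace_projMod_ne_bot hJ'o hμ)
    (map_mem_wtSpace (π ∘ₗ e) (t.gen_mem (A := A) (J := J) (lam := lam)))
  have heπ : ∀ x, e' (π x) = π (e x) :=
    LinearMap.congr_fun (t.projMod_ext (f := e' ∘ₗ π) (f' := π ∘ₗ e)
      (by rw [LinearMap.comp_apply, hπ, he']))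
  have hrange := hf'.essential c' hc' e' (fun x => by
    obtain ⟨x, rfl⟩ := hπs x
    rw [← hπf, heπ, ← hπf, he, heπ]) fun x => by
    obtain ⟨x, rfl⟩ := hπs x
    rw [heπ, ← hπf, ← hc'π c hc, ← hc'π c hc, hce]
  -- the difference factors over the weight space of `ν`
  obtain ⟨u, hu⟩ : ∃ u : t.projMod A J lam →ₗ[EnvAlg g A] t.projMod A J lam,
      ∀ x, π (f x - e (u x)) = 0 := by
    obtain ⟨x', hx'⟩ := hrange ⟨t.gen A (J \ {ν}) lam, rfl⟩
    obtain ⟨x, rfl⟩ := hπs x'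
    obtain ⟨F, d, hd, hF, rfl⟩ := (t.isWeightModule_projMod (A := A)).exists_sum x
    obtain ⟨p, hp⟩ := exists_wtProj (A := A) F lam
    obtain ⟨u, hu⟩ := t.exists_projMod_hom (J := J) hQ.2 (hd lam)
    refine ⟨u, fun x => ?_⟩
    obtain ⟨r, rfl⟩ := t.exists_smul_gen x
    have h1 : π (e (u (t.gen A J lam))) = π (f (t.gen A J lam)) := by
      rw [hu, ← heπ, ← wtProj_sum subset_rfl hd hF (hp _).1 (hp _).2.1, map_smul, map_smul, hx', hπf,
        hπ]
      exact (hp _).2.1 _ (map_mem_wtSpace f' t.gen_mem)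
    rw [map_smul, map_smul, map_smul, ← smul_sub, map_smul, map_sub, h1, sub_self, smul_zero]
  obtain ⟨y, hy⟩ := exists_factorization hJo hJl hπ v hvh (s := f - e ∘ₗ u) hu
  have hy' : ∀ x, f x = e (u x) + ∑ k, f (vh k (y k x)) := fun x => by
    have h1 := congrArg f (hy x)
    rw [LinearMap.sub_apply, map_sub, hf, LinearMap.comp_apply, hfe, map_sum] at h1
    rw [← h1, add_sub_cancel]
  -- Nakayama
  let Vf := (wtSpace h (t.projMod A J lam) ν).map (toBaseLin f)
  let Ve := (wtSpace h (t.projMod A J lam) ν).map (toBaseLin e)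
  have hVfg : Vf.FG := ((Module.Finite.iff_fg.1 hfin)).map _
  have hle : Vf ≤ Ve := by
    refine Submodule.le_of_le_smul_of_le_jacobson_bot (I := IsLocalRing.maximalIdeal A) hVfg
      (IsLocalRing.jacobson_eq_maximalIdeal ⊥ bot_ne_top).ge ?_
    rintro _ ⟨x, hx, rfl⟩
    have h1 : (toBaseLin f) x = f x := rfl
    rw [h1, ← hf x, hy' (f x)]
    refine Submodule.add_mem_sup ⟨u (f x), map_mem_wtSpace u (map_mem_wtSpace f hx), rfl⟩
      (Submodule.sum_mem _ fun k _ => ?_)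
    -- The choice of `f` makes the error terms multiples by elements of the maximal ideal.
    obtain ⟨a, ha, hya⟩ := hfm (y k) x hx
    rw [hya, map_base_smul, map_base_smul, hvh]
    exact Submodule.smul_mem_smul ha ⟨_, (v k).2, rfl⟩
  rintro _ ⟨x, rfl⟩
  rw [hy' x]
  refine add_mem ⟨_, rfl⟩ (Submodule.sum_mem _ fun k _ => ?_)
  obtain ⟨r, hr⟩ := t.exists_smul_gen (y k x)
  rw [← hr, map_smul, map_smul, hvh]
  obtain ⟨w, -, hw⟩ := hle ⟨_, (v k).2, rfl⟩
  exact Submodule.smul_mem _ _ ⟨w, hw⟩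

/-- Induction on the number of weights of `J` above `lam`. A maximal one `ν` is also maximal in `J`,
so `J \ {ν}` is still open. -/
lemma exists_isCoverIdempotent (A : Type u) [CommRing A] [Algebra ℂ A]
    [Algebra (SymmetricAlgebra ℂ h) A] [IsScalarTower ℂ (SymmetricAlgebra ℂ h) A]
    [IsNoetherianRing A] [IsLocalRing A] (hJo : IsOpenWts h b J) (hJl : IsLocBddWts h b J)
    (hlam : lam ∈ J) :
    ∃ f : t.projMod A J lam →ₗ[EnvAlg g A] t.projMod A J lam, t.IsCoverIdempotent f := by
  induction hn : {γ | γ ∈ J ∧ WtLE h b lam γ}.ncard using Nat.strong_induction_on generalizing J with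
  | _ n ih =>
  obtain ⟨ν, ⟨hν, hlν⟩, hmax⟩ := exists_maximal_wt b (hJl lam) ⟨lam, hlam, WtLE.refl lam⟩
  by_cases hne : lam = ν
  · subst hne
    exact ⟨_, t.isCoverIdempotent_id fun γ hγ hle => hmax γ ⟨hγ, hle⟩ hle⟩
  have hmax' : ∀ γ ∈ J, WtLE h b ν γ → γ = ν := fun γ hγ hle => hmax γ ⟨hγ, hlν.trans hle⟩ hle
  have hsub : {γ | γ ∈ J \ {ν} ∧ WtLE h b lam γ} ⊂ {γ | γ ∈ J ∧ WtLE h b lam γ} :=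
    Set.ssubset_iff_exists.2 ⟨fun γ hγ => ⟨hγ.1.1, hγ.2⟩, ν, ⟨hν, hlν⟩, fun hγ => hγ.1.2 rfl⟩
  obtain ⟨f', hf'⟩ := ih _ (hn ▸ Set.ncard_lt_ncard hsub (hJl lam)) (J := J \ {ν})
    (by
      rintro γ ⟨hγ, hγν⟩ μ hμ
      refine ⟨hJo γ hγ μ hμ, ?_⟩
      rintro rfl
      exact hγν (hmax' γ hγ hμ))
    (fun μ => (hJl μ).subset fun γ hγ => ⟨hγ.1.1, hγ.2⟩) ⟨hlam, hne⟩ rfl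
  exact hf'.lift t hJo hJl hν hlam hne hmax'

lemma surjective_of_epi {M N : (catOTrunc h b A J).FullSubcategory} (f : M ⟶ N) [Epi f] :
    Function.Surjective f.hom := by
  let C : (catOTrunc h b A J).FullSubcategory :=
    ⟨ModuleCat.of (EnvAlg g A) (N.obj ⧸ LinearMap.range f.hom.hom),
      catOTrunc_of_surjective (Submodule.mkQ _) (Submodule.mkQ_surjective _) N.property⟩
  let p : N ⟶ C := ObjectProperty.homMk (ModuleCat.ofHom (Submodule.mkQ (LinearMap.range f.hom.hom)))
  let z : N ⟶ C := ObjectProperty.homMk (ModuleCat.ofHom 0)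
  have h1 : f ≫ p = f ≫ z := by
    ext x
    exact (Submodule.Quotient.mk_eq_zero _).2 ⟨x, rfl⟩
  have h2 : p = z := (cancel_epi f).1 h1
  intro y
  have h3 : (Submodule.mkQ (LinearMap.range f.hom.hom)) y = 0 :=
    congrArg (fun q : N ⟶ C => q.hom.hom y) h2
  exact (Submodule.Quotient.mk_eq_zero _).1 h3

/-- Projective covers exist in the truncated categories. -/
lemma exists_isProjCover (t : TriBasis h b) (hJo : IsOpenWts h b J) (hJl : IsLocBddWts h b J)
    (hlam : lam ∈ J) : ∃ (P : (catOTrunc h b A J).FullSubcategory)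
      (c : P.obj ⟶ simpleL h b A lam), IsProjCover h b A J lam P c := by
  obtain ⟨f, hf⟩ := t.exists_isCoverIdempotent A hJo hJl hlam
  have hQ := t.catOTrunc_projMod (A := A) (lam := lam) hJo hJl
  obtain ⟨c, hc⟩ := t.exists_projMod_hom (M := simpleL h b A lam)
    (t.catOTrunc_simpleL hJo hlam).2 (t.isHighest_simpleGen lam).1
  let P : (catOTrunc h b A J).FullSubcategory :=
    ⟨ModuleCat.of (EnvAlg g A) (LinearMap.range f),
      catOTrunc_of_injective (LinearMap.range f).subtype Subtype.val_injective hQ⟩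
  let i : P.obj →ₗ[EnvAlg g A] t.projMod A J lam := (LinearMap.range f).subtype
  let r : t.projMod A J lam →ₗ[EnvAlg g A] P.obj := f.rangeRestrict
  have hi : Function.Injective i := Subtype.val_injective
  have hri : ∀ x, r (i x) = x := by
    rintro ⟨_, x, rfl⟩
    exact Subtype.ext (hf.idem x)
  have hir : ∀ x, i (r x) = f x := fun x => rfl
  have hlift : ∀ {M N : GMod g A}, catOTrunc h b A J M → ∀ φ : M →ₗ[EnvAlg g A] N,
      Function.Surjective φ → ∀ ψ : P.obj →ₗ[EnvAlg g A] N,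
      ∃ ψ' : P.obj →ₗ[EnvAlg g A] M, φ ∘ₗ ψ' = ψ := by
    intro M N hM φ hφ ψ
    obtain ⟨χ, hχ⟩ := t.exists_projMod_lift hM hφ (ψ ∘ₗ r)
    refine ⟨χ ∘ₗ i, LinearMap.ext fun x => ?_⟩
    rw [LinearMap.comp_apply, LinearMap.comp_apply, ← LinearMap.comp_apply φ, hχ,
      LinearMap.comp_apply, hri]
  let ci : P.obj →ₗ[EnvAlg g A] simpleL h b A lam := c ∘ₗ i
  let C : P.obj ⟶ simpleL h b A lam := ConcreteCategory.ofHom (C := ModuleCat (EnvAlg g A)) ci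
  refine ⟨P, C, ⟨⟨fun {E X} φ ε _ => ?_⟩, fun y => ?_, fun M φ hφ => ?_⟩⟩
  · obtain ⟨ψ, hψ⟩ := hlift E.property ε.hom.hom (surjective_of_epi ε) φ.hom.hom
    refine ⟨ObjectProperty.homMk (ModuleCat.ofHom ψ), ?_⟩
    ext x
    exact LinearMap.congr_fun hψ x
  · obtain ⟨x, hx⟩ := hf.ne_zero c hc
    obtain ⟨s, hs⟩ := simpleL_simple hx y
    refine ⟨s • r x, ?_⟩
    change c (i (s • r x)) = y
    rw [map_smul, map_smul, hir, hs]
  · obtain ⟨ψ, hψ⟩ := hlift M.property ((c ∘ₗ i) ∘ₗ φ.hom.hom) hφ (c ∘ₗ i)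
    have hψ' : ∀ x, c (i (φ.hom.hom (ψ x))) = c (i x) := LinearMap.congr_fun hψ
    -- By projectivity `c` factors through `φ` by some `ψ`. Essentiality of `f`, applied to `φ ∘ ψ`
    -- seen on `projMod`, shows that `φ` is surjective.
    have h1 := hf.essential c hc (i ∘ₗ φ.hom.hom ∘ₗ ψ ∘ₗ r) (fun x => ?_) fun x => ?_
    · intro y
      obtain ⟨x, hx⟩ := h1 y.2
      exact ⟨ψ (r x), hi hx⟩
    · simp only [LinearMap.comp_apply]
      rw [← hir x, hri, ← hir (i _), hri]
    · simp only [LinearMap.comp_apply]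
      rw [hψ', hir]

end TriBasis

end AffineO

end

noncomputable section

set_option linter.unusedSectionVars false

namespace AffineO

/-! ### Direct sums -/

section Sums

variable {g : Type u} [LieRing g] [LieAlgebra ℂ g] {A : Type u} [CommRing A] [Algebra ℂ A]
variable {ι : Type u}

lemma gSumIncl_injective (M : ι → GMod g A) (i : ι) : Function.Injective (gSumIncl M i) := by
  classical
  exact DirectSum.of_injective i

lemma lmap_gSumIncl {M N : ι → GMod g A} (f : ∀ i, M i →ₗ[EnvAlg g A] N i) (i : ι) (m : M i) :
    DirectSum.lmap f (gSumIncl M i m) = gSumIncl N i (f i m) := by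
  classical
  exact DirectSum.lmap_lof _ _ _

lemma gSumProj_gSumIncl_self (M : ι → GMod g A) (i : ι) (m : M i) :
    gSumProj M i (gSumIncl M i m) = m := by
  classical
  exact DirectSum.component.lof_self (EnvAlg g A) (M := fun i => M i) i m

lemma gSumProj_gSumIncl_of_ne (M : ι → GMod g A) {i j : ι} (hij : i ≠ j) (m : M i) :
    gSumProj M j (gSumIncl M i m) = 0 := by
  classical
  exact (DirectSum.component.of (EnvAlg g A) (M := fun i => M i) j i m).trans (dif_neg hij)

lemma gSum_ext {M : ι → GMod g A} {x y : gSum M} (hxy : ∀ i, gSumProj M i x = gSumProj M i y) :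
    x = y := DFinsupp.ext hxy

lemma gSum_hom_ext {M : ι → GMod g A} {N : GMod g A} {f f' : gSum M →ₗ[EnvAlg g A] N}
    (hff : ∀ i m, f (gSumIncl M i m) = f' (gSumIncl M i m)) : f = f' :=
  LinearMap.ext fun x => gSum_induction M (p := fun x => f x = f' x) (by rw [map_zero, map_zero])
    (fun x y hx hy => by rw [map_add, map_add, hx, hy]) hff x

end Sums

/-! ### Blocks -/

namespace TriBasis

variable {g : Type u} [LieRing g] [LieAlgebra ℂ g] [FiniteDimensional ℂ g] [LieAlgebra.IsKilling ℂ g]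
variable {h : LieSubalgebra ℂ g} [h.IsCartanSubalgebra] {b : LieSubalgebra ℂ g}
variable [LieAlgebra.IsSolvable b]
variable (t : TriBasis h b)
variable {A : Type u} [CommRing A] [Algebra ℂ A] [Algebra (SymmetricAlgebra ℂ h) A]
  [IsScalarTower ℂ (SymmetricAlgebra ℂ h) A] [IsNoetherianRing A] [IsLocalRing A]
variable {J : Set (Wt h)} {lam ν : Wt h}

lemma epi_of_surjective {M N : (catOTrunc h b A J).FullSubcategory} (f : M ⟶ N)
    (hf : Function.Surjective f.hom) : Epi f where
  left_cancellation p q hpq := by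
    ext x
    obtain ⟨y, rfl⟩ := hf x
    exact congrArg (fun r => r.hom.hom y) hpq

/-- Homomorphisms from projective objects lift along surjections in the truncated category. -/
lemma exists_lift_of_projective {P : (catOTrunc h b A J).FullSubcategory} (hP : Projective P)
    {M N : GMod g A} (hM : catOTrunc h b A J M) {f : M →ₗ[EnvAlg g A] N}
    (hf : Function.Surjective f) (p : P.obj →ₗ[EnvAlg g A] N) :
    ∃ q : P.obj →ₗ[EnvAlg g A] M, f ∘ₗ q = p := by
  let M' : (catOTrunc h b A J).FullSubcategory := ⟨M, hM⟩
  let N' : (catOTrunc h b A J).FullSubcategory := ⟨N, catOTrunc_of_surjective f hf hM⟩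
  let f' : M' ⟶ N' := ObjectProperty.homMk (ConcreteCategory.ofHom (C := ModuleCat (EnvAlg g A)) f)
  let p' : P ⟶ N' := ObjectProperty.homMk (ConcreteCategory.ofHom (C := ModuleCat (EnvAlg g A)) p)
  have : Epi f' := epi_of_surjective f' hf
  obtain ⟨q, hq⟩ := hP.factors p' f'
  exact ⟨q.hom.hom, congrArg (fun r => r.hom.hom) hq⟩

lemma mem_of_isSubquotientL (t : TriBasis h b) {M : GMod g A} (hM : catOTrunc h b A J M)
    (hlam : IsSubquotientL h b A lam M) : lam ∈ J := by
  obtain ⟨N, q, hq⟩ := hlam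
  have hN : catOTrunc h b A J (ModuleCat.of (EnvAlg g A) N) :=
    catOTrunc_of_injective N.subtype Subtype.val_injective hM
  have hL : catOTrunc h b A J (simpleL h b A lam) :=
    catOTrunc_of_surjective (M := ModuleCat.of (EnvAlg g A) N) q hq hN
  exact hL.2 lam ((Submodule.ne_bot_iff _).2
    ⟨_, (t.isHighest_simpleGen (A := A) lam).1, t.simpleGen_ne_zero lam⟩)

/-- The projective cover of a simple subquotient of a module maps to the module up to taking
quotients. -/
lemma exists_hom_of_isSubquotientL (t : TriBasis h b) {M : GMod g A} (hM : catOTrunc h b A J M)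
    (hlam : IsSubquotientL h b A lam M) {P : (catOTrunc h b A J).FullSubcategory}
    {c : P.obj ⟶ simpleL h b A lam} (hP : IsProjCover h b A J lam P c) :
    ∃ f : P.obj →ₗ[EnvAlg g A] M, f ≠ 0 := by
  obtain ⟨N, q, hq⟩ := hlam
  have hN : catOTrunc h b A J (ModuleCat.of (EnvAlg g A) N) :=
    catOTrunc_of_injective N.subtype Subtype.val_injective hM
  obtain ⟨f, hf⟩ := exists_lift_of_projective hP.projective hN hq c.hom
  obtain ⟨x, hx⟩ := hP.surj (simpleGen h b A lam)
  refine ⟨N.subtype ∘ₗ f, fun h0 => t.simpleGen_ne_zero (A := A) lam ?_⟩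
  have h1 : f x = 0 := Subtype.ext (LinearMap.congr_fun h0 x)
  rw [← hx]
  change c.hom x = 0
  rw [← hf, LinearMap.comp_apply, h1, map_zero]

/-- The projective cover of `L(ν)` has a nonzero homomorphism to `P`, which is the generating
relation. -/
lemma block_eq_of_isSubquotientL (t : TriBasis h b) (hJo : IsOpenWts h b J)
    (hJl : IsLocBddWts h b J) (hlam : lam ∈ J) {P : (catOTrunc h b A J).FullSubcategory}
    {c : P.obj ⟶ simpleL h b A lam} (hP : IsProjCover h b A J lam P c)
    (hν : IsSubquotientL h b A ν P.obj) :
    (Quotient.mk _ ν : Block h b A) = Quotient.mk _ lam := by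
  have hνJ := t.mem_of_isSubquotientL P.property hν
  obtain ⟨P', c', hP'⟩ := t.exists_isProjCover (A := A) hJo hJl hνJ
  obtain ⟨f, hf⟩ := t.exists_hom_of_isSubquotientL P.property hν hP'
  refine Quotient.sound (Relation.EqvGen.rel _ _ ⟨J, hJo, hJl, hνJ, hlam, P', P, c', c, hP', hP,
    ModuleCat.ofHom f, fun h0 => hf ?_⟩)
  exact congrArg ModuleCat.Hom.hom h0

/-- The elements that generate submodules whose simple subquotients belong to the blocks in `S`. -/
def blockPart (t : TriBasis h b) (M : GMod g A) (S : Set (Block h b A)) :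
    Submodule (EnvAlg g A) M where
  carrier := {m | ∀ (r : EnvAlg g A) (μ : Wt h), HasFactor h b μ (r • m) →
    (Quotient.mk _ μ : Block h b A) ∈ S}
  zero_mem' r μ hμ := absurd (smul_zero r) (hμ.ne_zero t)
  add_mem' {x y} hx hy r μ hμ := by
    rw [smul_add] at hμ
    rcases hμ.of_add with hμ | ⟨s, hμ⟩
    · exact hx r μ hμ
    · rw [← mul_smul] at hμ
      exact hy _ μ hμ
  smul_mem' _ _ hm _ μ hμ := by
    rw [← mul_smul] at hμ
    exact hm _ μ hμ

lemma blockPart_mono (M : GMod g A) {S S' : Set (Block h b A)} (hS : S ⊆ S') :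
    t.blockPart M S ≤ t.blockPart M S' := fun _ hm r μ hμ => hS (hm r μ hμ)

lemma map_blockPart {M N : GMod g A} (f : M →ₗ[EnvAlg g A] N) {S : Set (Block h b A)} {m : M}
    (hm : m ∈ t.blockPart M S) : f m ∈ t.blockPart N S := fun r μ hμ => by
  rw [← map_smul] at hμ
  exact hm r μ (hμ.of_map f)

lemma mem_blockPart_of_catOBlock {M : GMod g A} {Λ : Block h b A} (hM : catOBlock h b A Λ M)
    (m : M) : m ∈ t.blockPart M {Λ} := fun _ μ hμ =>
  hM.2 μ (t.isSubquotientL_iff.2 ⟨_, hμ⟩)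

lemma catOBlock_blockPart {M : GMod g A} (hM : catO h b A M) (Λ : Block h b A) :
    catOBlock h b A Λ (ModuleCat.of (EnvAlg g A) (t.blockPart M {Λ})) := by
  refine ⟨catO_of_injective (t.blockPart M {Λ}).subtype Subtype.val_injective hM, fun μ hμ => ?_⟩
  obtain ⟨x, hx⟩ := t.isSubquotientL_iff.1 hμ
  have h1 := HasFactor.map (t.blockPart M {Λ}).subtype Subtype.val_injective hx
  exact x.2 1 μ (by rwa [one_smul])

/-- A nonzero element of the intersection generates a module with a simple subquotient, whose class
would lie in both sets. -/
lemma disjoint_blockPart {M : GMod g A} (hM : catO h b A M) {S S' : Set (Block h b A)}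
    (hS : Disjoint S S') : Disjoint (t.blockPart M S) (t.blockPart M S') := by
  rw [Submodule.disjoint_def]
  intro x hx hx'
  by_contra h0
  obtain ⟨r, ν, hν⟩ := exists_hasFactor hM t h0
  exact Set.disjoint_left.1 hS (hx r ν hν) (hx' r ν hν)

lemma iSupIndep_blockPart {M : GMod g A} (hM : catO h b A M) :
    iSupIndep fun Λ => t.blockPart M {Λ} := by
  intro Λ
  refine (t.disjoint_blockPart hM (show Disjoint ({Λ} : Set (Block h b A)) {Λ}ᶜ from
    disjoint_compl_right)).mono_right ?_
  exact iSup₂_le fun Λ' hΛ' => t.blockPart_mono M (by simpa using Ne.symm hΛ')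

/-- If the quotient `C` by the sum were nonzero, it would receive a nonzero map from some `P(ν)`.
This map lifts to `M`, and as `P(ν)` involves one block only, the lift lands in the sum and dies in
`C`. -/
lemma iSup_blockPart_of_catOTrunc (hJo : IsOpenWts h b J) (hJl : IsLocBddWts h b J) {M : GMod g A}
    (hM : catOTrunc h b A J M) : ⨆ Λ, t.blockPart M {Λ} = ⊤ := by
  by_contra hne
  set N := ⨆ Λ, t.blockPart M {Λ}
  let C : GMod g A := ModuleCat.of (EnvAlg g A) (M ⧸ N)
  let q : M →ₗ[EnvAlg g A] C := N.mkQ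
  have hq : Function.Surjective q := N.mkQ_surjective
  have hC : catOTrunc h b A J C := catOTrunc_of_surjective q hq hM
  obtain ⟨m, hm⟩ : ∃ m, m ∉ N := by
    by_contra! hcon
    exact hne (eq_top_iff.2 fun m _ => hcon m)
  have hm0 : q m ≠ 0 := fun h0 => hm ((Submodule.Quotient.mk_eq_zero N).1 h0)
  obtain ⟨r, ν, hν⟩ := exists_hasFactor hC.1 t hm0
  have hν' : IsSubquotientL h b A ν C := t.isSubquotientL_iff.2 ⟨_, hν⟩
  have hνJ := t.mem_of_isSubquotientL hC hν'
  obtain ⟨P, c, hP⟩ := t.exists_isProjCover (A := A) hJo hJl hνJ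
  obtain ⟨f, hf⟩ := t.exists_hom_of_isSubquotientL hC hν' hP
  obtain ⟨f', hf'⟩ := exists_lift_of_projective hP.projective hM hq f
  refine hf (LinearMap.ext fun x => ?_)
  rw [← hf']
  refine (Submodule.Quotient.mk_eq_zero N).2 (Submodule.mem_iSup_of_mem (Quotient.mk _ ν) ?_)
  refine t.map_blockPart f' fun s μ hμ => ?_
  exact t.block_eq_of_isSubquotientL hJo hJl hνJ hP (t.isSubquotientL_iff.2 ⟨_, hμ⟩)

/-- Finitely generated submodules lie in a truncated category. -/
lemma exists_truncation (t : TriBasis h b) {M : GMod g A} (hM : catO h b A M) (m : M) :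
    ∃ J : Set (Wt h), IsOpenWts h b J ∧ IsLocBddWts h b J ∧
      catOTrunc h b A J (ModuleCat.of (EnvAlg g A) (Submodule.span (EnvAlg g A) {m})) := by
  classical
  obtain ⟨V, hmV, ⟨S, hS⟩, hst⟩ := hM.2 m
  choose F f hf hF hsum using fun x : M => hM.1.exists_sum x
  let W : Finset (Wt h) := S.biUnion F
  have hVW : V ≤ ⨆ γ ∈ W, wtSpace h M γ := by
    rw [← hS]
    refine Submodule.span_le.2 fun x hx => ?_
    rw [← hsum x]
    refine Submodule.sum_mem _ fun γ hγ => ?_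
    exact Submodule.mem_iSup_of_mem γ (Submodule.mem_iSup_of_mem
      (Finset.mem_biUnion.2 ⟨x, hx, hγ⟩) (hf x γ))
  -- Positive words keep `m` in `V`, Cartan factors preserve weights and negative ones lower them,
  -- so all weights lie below the finitely many weights of `V`.
  let J : Set (Wt h) := {μ | ∃ γ ∈ W, WtLE h b μ γ}
  have hwd : ∀ l : List t.ι, (∀ i ∈ l, t.sgn i = 1) → t.wd A l • m ∈ V := by
    intro l hl
    induction l with
    | nil => simpa using hmV
    | cons i l ih =>
      rw [wd_cons, mul_smul]
      refine hst _ (t.mem_borel i ?_) _ (ih fun j hj => hl j (by simp [hj]))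
      rw [hl i (by simp)]; decide
  have hJm : ∀ r : EnvAlg g A, r • m ∈ ⨆ μ ∈ J, wtSpace h M μ := by
    intro r
    obtain ⟨c, rfl⟩ := t.exists_mon_sum r
    rw [Finsupp.sum, Finset.sum_smul]
    refine Submodule.sum_mem _ fun s _ => ?_
    rw [mul_smul, ← base_smul_def]
    refine Submodule.smul_mem _ _ ?_
    rw [mon_eq_mul, mul_smul, mul_smul]
    have h1 := hVW (hwd ((t.part 1 s).sort (· ≤ ·)) fun i hi =>
      t.sgn_of_mem_part (s := s) (by simpa using hi))
    rw [← mon_eq_wd, iSup_subtype'] at h1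
    refine Submodule.iSup_induction (motive := fun y => t.mon A (t.part (-1) s) •
      t.mon A (t.part 0 s) • y ∈ ⨆ μ ∈ J, wtSpace h M μ) _ h1 (fun γ y hy => ?_) (by simp)
      fun y z hy hz => by rw [smul_add, smul_add]; exact add_mem hy hz
    have h2 := t.mon_smul_mem (t.mon_smul_mem hy (t.part 0 s)) (t.part (-1) s)
    rw [t.wts_part_zero (s := t.part 0 s) fun _ => t.sgn_of_mem_part, add_zero] at h2
    exact Submodule.mem_iSup_of_mem _ (Submodule.mem_iSup_of_mem
      ⟨γ, γ.2, t.wtLE_wts_add (fun _ => t.sgn_of_mem_part) _⟩ h2)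
  refine ⟨J, ?_, fun μ => ?_, ?_, fun μ hμ => ?_⟩
  · rintro μ ⟨γ, hγ, hμ⟩ μ' hμ'
    exact ⟨γ, hγ, hμ'.trans hμ⟩
  · refine (W.finite_toSet.biUnion fun γ _ => finite_interval (b := b) μ γ).subset ?_
    rintro μ' ⟨⟨γ, hγ, h1⟩, h2⟩
    exact Set.mem_biUnion hγ ⟨h2, h1⟩
  · exact catO_of_injective (Submodule.span (EnvAlg g A) {m}).subtype Subtype.val_injective hM
  · obtain ⟨x, hx, hx0⟩ := Submodule.exists_mem_ne_zero_of_ne_bot hμ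
    by_contra hμJ
    obtain ⟨r, hr⟩ := Submodule.mem_span_singleton.1 x.2
    have h1 := map_mem_wtSpace (M := ModuleCat.of (EnvAlg g A) (Submodule.span (EnvAlg g A) {m}))
      (Submodule.span (EnvAlg g A) {m}).subtype hx
    refine hx0 (Subtype.ext (Submodule.disjoint_def.1
      ((iSupIndep_wtSpace M).disjoint_biSup hμJ) _ h1 ?_))
    rw [← hr]
    exact hJm r

lemma iSup_blockPart {M : GMod g A} (hM : catO h b A M) : ⨆ Λ, t.blockPart M {Λ} = ⊤ := by
  refine eq_top_iff.2 fun m _ => ?_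
  obtain ⟨J, hJo, hJl, hm⟩ := t.exists_truncation hM m
  let X : GMod g A := ModuleCat.of (EnvAlg g A) (Submodule.span (EnvAlg g A) {m})
  let i : X →ₗ[EnvAlg g A] M := (Submodule.span (EnvAlg g A) {m}).subtype
  let x : X := ⟨m, Submodule.mem_span_singleton_self m⟩
  have hx : x ∈ ⨆ Λ, t.blockPart X {Λ} := by
    rw [t.iSup_blockPart_of_catOTrunc hJo hJl hm]; trivial
  have h1 : (⨆ Λ, t.blockPart X {Λ}).map i ≤ ⨆ Λ, t.blockPart M {Λ} := by
    rw [Submodule.map_iSup]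
    refine iSup_mono fun Λ => ?_
    rintro _ ⟨y, hy, rfl⟩
    exact t.map_blockPart i hy
  exact h1 ⟨x, hx, rfl⟩

open Classical in
lemma isInternal_blockPart {M : GMod g A} (hM : catO h b A M) :
    DirectSum.IsInternal fun Λ => t.blockPart M {Λ} :=
  (DirectSum.isInternal_submodule_iff_iSupIndep_and_iSup_eq_top _).2
    ⟨t.iSupIndep_blockPart hM, t.iSup_blockPart hM⟩

/-- There are no nonzero homomorphisms between different blocks. -/
lemma eq_zero_of_ne (t : TriBasis h b) {M N : GMod g A} {Λ Λ' : Block h b A} (hM : catOBlock h b A Λ M)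
    (hN : catOBlock h b A Λ' N) (hne : Λ ≠ Λ') (f : M →ₗ[EnvAlg g A] N) (m : M) : f m = 0 :=
  Submodule.disjoint_def.1 (t.disjoint_blockPart hN.1 (Set.disjoint_singleton.2 hne)) _
    (t.map_blockPart f (t.mem_blockPart_of_catOBlock hM m)) (t.mem_blockPart_of_catOBlock hN (f m))

/-! ### The functor is full, faithful and essentially surjective -/

lemma full_blockSum (t : TriBasis h b) : (blockSum h b A).Full where
  map_surjective {X Y} φ := by
    let f : ∀ Λ, X Λ ⟶ Y Λ := fun Λ => ObjectProperty.homMk (ModuleCat.ofHom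
      (gSumProj (fun Λ => (Y Λ).obj) Λ ∘ₗ φ.hom.hom ∘ₗ gSumIncl (fun Λ => (X Λ).obj) Λ))
    refine ⟨f, ?_⟩
    have key : ((blockSum h b A).map f).hom.hom = φ.hom.hom := by
      refine gSum_hom_ext (M := fun Λ => (X Λ).obj) fun Λ x => ?_
      refine (lmap_gSumIncl (M := fun Λ => (X Λ).obj) (N := fun Λ => (Y Λ).obj)
        (fun Λ => (f Λ).hom.hom) Λ x).trans (gSum_ext fun Λ' => ?_)
      by_cases hΛ : Λ = Λ'
      · subst hΛ
        exact gSumProj_gSumIncl_self (fun Λ => (Y Λ).obj) Λ _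
      -- Components between different blocks vanish, so `φ` is determined by its diagonal.
      · refine (gSumProj_gSumIncl_of_ne (fun Λ => (Y Λ).obj) hΛ _).trans ?_
        exact (t.eq_zero_of_ne (X Λ).property (Y Λ').property hΛ
          (gSumProj (fun Λ => (Y Λ).obj) Λ' ∘ₗ φ.hom.hom ∘ₗ gSumIncl (fun Λ => (X Λ).obj) Λ)
          x).symm
    ext x
    exact LinearMap.congr_fun key x

lemma faithful_blockSum : (blockSum h b A).Faithful where
  map_injective {X Y} f f' hff := by
    funext Λ
    ext x
    have h1 : ∀ f : X ⟶ Y, ((blockSum h b A).map f).hom.hom (gSumIncl (fun Λ => (X Λ).obj) Λ x) =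
        gSumIncl (fun Λ => (Y Λ).obj) Λ ((f Λ).hom.hom x) := fun f =>
      lmap_gSumIncl (M := fun Λ => (X Λ).obj) (N := fun Λ => (Y Λ).obj)
        (fun Λ => (f Λ).hom.hom) Λ x
    have h2 := congrArg (fun φ => φ.hom.hom (gSumIncl (fun Λ => (X Λ).obj) Λ x)) hff
    exact gSumIncl_injective _ Λ ((h1 f).symm.trans (h2.trans (h1 f')))

lemma essSurj_blockSum (t : TriBasis h b) : (blockSum h b A).EssSurj where
  mem_essImage M := by
    classical
    let X : ∀ Λ : Block h b A, (catOBlock h b A Λ).FullSubcategory := fun Λ =>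
      ⟨ModuleCat.of (EnvAlg g A) (t.blockPart M.obj {Λ}), t.catOBlock_blockPart M.property Λ⟩
    let e : ((blockSum h b A).obj X).obj ≃ₗ[EnvAlg g A] M.obj :=
      LinearEquiv.ofBijective (DirectSum.coeLinearMap fun Λ => t.blockPart M.obj {Λ})
        (t.isInternal_blockPart M.property)
    exact ⟨X, ⟨ObjectProperty.isoMk _ e.toModuleIso⟩⟩

end TriBasis

end AffineO

theorem mainTheorem3 (g : Type u) [LieRing g] [LieAlgebra ℂ g] [FiniteDimensional ℂ g]
    [LieAlgebra.IsSimple ℂ g]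
    (h : LieSubalgebra ℂ g) [h.IsCartanSubalgebra]
    (b : LieSubalgebra ℂ g) (hb : AffineO.IsBorel b) (hhb : h ≤ b)
    (A : Type u) [CommRing A] [Algebra ℂ A] [Algebra (SymmetricAlgebra ℂ h) A]
    [IsScalarTower ℂ (SymmetricAlgebra ℂ h) A] [IsNoetherianRing A] [IsLocalRing A] :
    (AffineO.blockSum h b A).IsEquivalence := by
  have : LieAlgebra.IsSolvable b := hb.1
  obtain ⟨t⟩ := AffineO.exists_triBasis b hb hhb
  exact { faithful := AffineO.TriBasis.faithful_blockSum
          full := t.full_blockSum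
          essSurj := t.essSurj_blockSum }

end
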